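/- **Conventions.** Permutations are applied from left to right and $[g,h]=g^{-1}h^{-1}gh$. *Spaces.* A quadratic space $\Lambda=(K,L,q)$ (Case I) is a quadratic form $q$ on a non-zero vector space $L$ over a commutative field $K$, with bilinear form $f(a,b)=q(a+b)-q(a)-q(b)$; put $\sigma=1$. It is non-degenerate if $\{a\in L\mid q(a)=0,\ f(a,L)=0\}=\{0\}$. A pseudo-quadratic space $\Lambda=(K,K_0,\sigma,L,q)$ (Case II) consists of a skew field $K$, an anti-automorphism $\sigma$ of $K$ with $\sigma^2=1$ (possibly $\sigma=1$), an additive subgroup $K_0\ni 1$ of $K$ with $\{t+t^\sigma\mid t\in K\}\subset K_0\subset\{t\mid t^\sigma=t\}$ and $t^\sigma K_0t\subset K_0$ for all $t\in K$, a right vector space $L$ over $K$ ($L=0$ allowed), a skew-hermitian form $f$ on $L$ ($f$ biadditive, $f(a,bt)=f(a,b)t$, $f(a,b)^\sigma=-f(b,a)$) and a map $q\colon L\to K$ with $q(a+b)\equiv q(a)+q(b)+f(a,b)$ and $q(at)\equiv t^\sigma q(a)t$ modulo $K_0$. It is non-degenerate if $\{a\in L\mid q(a)\in K_0,\ f(a,L)=0\}=\{0\}$.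 Let $T=(L,+)$ in Case I; in Case II let $T=\{(a,t)\in L\times K\mid q(a)-t\in K_0\}$ with product $(a,t)(b,u)=(a+b,\,t+u+f(b,a))$. *Graph.* Let $V=K^4\oplus L$ and $Q(t_1,t_1',t_2,t_2',a)=t_1^\sigma t_1'+t_2^\sigma t_2'+q(a)$, considered modulo $K_0$ in Case II. For $v=(s_1,s_1',s_2,s_2',b)$ and $w=(t_1,t_1',t_2,t_2',a)$ let $F(v,w)=s_1t_1'+t_1s_1'+s_2t_2'+t_2s_2'+f(a,b)$ in Case I and $F(v,w)=s_1^\sigma t_1'-(s_1')^\sigma t_1+s_2^\sigma t_2'-(s_2')^\sigma t_2+f(b,a)$ in Case II. Let $W_i$ be the set of $i$-dimensional subspaces of $V$ on which $Q$ and $F$ vanish identically. Let $S_\Lambda$ be the line space with point set $W_1$ whose lines are the elements of $W_2$, each viewed as the set of points it contains. Let $\Gamma$ be the incidence graph of $S_\Lambda$, in which two lines $x,y$ on a point are called opposite there if the subspace $\langle x\cup y\rangle$ of $S_\Lambda$ generated by them is not singular (a set of points is singular if any two of its points are collinear), and two points of a line are called opposite there if they are distinct. *Veldkamp $n$-gons.*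 A path $(v_0,\dots,v_s)$ ($v_{i-1},v_i$ adjacent, $v_{i-2}\neq v_i$) is straight if $v_{i-1},v_{i+1}$ are opposite at $v_i$ for $0<i<s$. A Veldkamp $n$-gon is a connected bipartite graph with a symmetric anti-reflexive relation ("opposite at $v$") on the neighbourhood $\Gamma_v$ of each vertex $v$, such that any two elements of $\Gamma_v$ have a common opposite at $v$ (and $\Gamma_v\ne\emptyset$); each straight $k$-path with $1\le k\le n-1$ is the unique straight path of length at most $k$ between its ends; and every straight $(n+1)$-path lies in a straight $2n$-circuit. A root is a straight $n$-path; the root group of a root $(x_0,\dots,x_n)$ is the group of all automorphisms (respecting the opposition relations) that fix $\Gamma_{x_1}\cup\dots\cup\Gamma_{x_{n-1}}$ pointwise. The $n$-gon is Moufang, i.e. for $n\ge3$ a Tits $n$-gon, if the root group of each root $(x_0,\dots,x_n)$ is transitive on the vertices opposite $x_{n-1}$ at $x_n$. Two vertices are opposite if some root joins them; the $n$-gon is flat if distinct vertices have distinct sets of opposite vertices. A coordinate system of a Tits quadrangle is a cyclic numbering $(w_i)_{i\in\mathbb Z/8}$ of the vertices of a straight $8$-circuit; $U_i$ is the root group of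 $(w_i,w_{i+1},\dots,w_{i+4})$. The opposite coordinate system is $i\mapsto w_{9-i}$. *Types.* A Tits quadrangle is **orthogonal of type** $\Lambda$ (Case I) if for every coordinate system, after replacing it by its opposite if necessary, $[U_i,U_{i+1}]=1$ for all $i$, $[U_1,U_3]=1$, and there are isomorphisms $x_1,x_3$ from $K^+$ to $U_1,U_3$ and $x_2,x_4$ from $T$ to $U_2,U_4$ with $$[x_2(a),x_4(b)^{-1}]=x_3(f(a,b)),\qquad [x_1(t),x_4(a)^{-1}]=x_2(ta)\,x_3(tq(a))$$ for all $t\in K$, $a,b\in L$. It is **pseudo-quadratic of type** $\Lambda$ (Case II) if for every coordinate system, after replacing it by its opposite if necessary, $[U_i,U_{i+1}]=1$ for all $i$ and there are isomorphisms $x_1,x_3$ from $T$ to $U_1,U_3$ and $x_2,x_4$ from $K^+$ to $U_2,U_4$ with $$[x_1(a,t),x_3(b,s)^{-1}]=x_2(f(a,b)),\quad [x_2(v),x_4(w)^{-1}]=x_3(0,v^\sigma w+w^\sigma v),\quad [x_1(a,t),x_4(v)^{-1}]=x_2(tv)\,x_3(av,v^\sigma tv)$$ for all $(a,t),(b,s)\in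 T$, $v,w\in K$. **Theorem.** Let $\Lambda$ be a non-degenerate quadratic space, or a non-degenerate pseudo-quadratic space with $\operatorname{char}K\neq2$ if $K_0=K$ (no restriction on the Witt index). Then $S_\Lambda$ is a non-degenerate polar space (for each point $a$ and each line $x$, exactly one or all points of $x$ are collinear with or equal to $a$; and no point is collinear with all others) that has lines, each with at least three points; $\Gamma$ is a flat Veldkamp quadrangle whose local opposition relations at lines are trivial (any two distinct points of a line are opposite there); $\Gamma$ is Moufang, i.e. a Tits quadrangle; and $\Gamma$ is orthogonal of type $\Lambda$ in Case I and pseudo-quadratic of type $\Lambda$ in Case II. Moreover, write $x_1,x_1',x_2,x_2'$ for the standard basis of $K^4\subset V$, and let a vector, or a pair of vectors, stand for the subspace it spans. Then there is a coordinate system $$(w_1,\dots,w_8)=(x_1'x_2,\;x_1',\;x_1'x_2',\;x_2',\;x_1x_2',\;x_1,\;x_1x_2,\;x_2)\quad\text{(Case I)},$$ $$(w_1,\dots,w_8)=(x_2,\;x_1x_2,\;x_1,\;x_1x_2',\;x_2',\;x_1'x_2',\;x_1',\;x_1'x_2)\quad\text{(Case II)},$$ for which isomorphisms as in the definition of the type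 (without passing to the opposite coordinate system) are given by $(x_1,x_2,x_3,x_4)=(\delta,\beta,\gamma,\alpha)$ in Case I and $(\alpha,\gamma,\beta,\delta)$ in Case II. Here $\alpha,\beta,\gamma,\delta$ are the automorphisms of $\Gamma$ induced by the following linear automorphisms of $V$, which are isometries of $Q$ and $F$ ($u$ runs through $L$; basis vectors not mentioned are fixed, and so is $L$ when $u$ is not mentioned). Case I: $\alpha_a\colon x_1'\mapsto x_1'-q(a)x_1+a,\ u\mapsto u-f(u,a)x_1$; $\ \beta_b\colon x_2\mapsto x_2-q(b)x_2'+b,\ u\mapsto u-f(u,b)x_2'$; $\ \gamma_t\colon x_1'\mapsto x_1'-tx_2',\ x_2\mapsto x_2+tx_1$; $\ \delta_s\colon x_1\mapsto x_1+sx_2',\ x_2\mapsto x_2-sx_1'$. Case II: $\alpha_{(a,t)}\colon x_1'\mapsto x_1'+x_1t+a,\ u\mapsto u+x_1f(a,u)$; $\ \beta_{(b,s)}\colon x_2\mapsto x_2-x_2's-b,\ u\mapsto u+x_2'f(b,u)$; $\ \gamma_t\colon x_1'\mapsto x_1'+x_2't^\sigma,\ x_2\mapsto x_2-x_1t$; $\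 \delta_s\colon x_1\mapsto x_1-x_2's^\sigma,\ x_2\mapsto x_2-x_1's$. -/

import Mathlib

namespace TitsQuad

open MulOpposite

/-! ## Graphs with local opposition relations, Veldkamp polygons -/

/-- A graph in which every neighbourhood carries a relation: `opp v x y` reads
"`x` and `y` are opposite at `v`". That these relations are opposition relations (symmetric and
anti-reflexive) is part of `IsVeldkampGraph`. -/
structure OppGraph (V : Type*) where
  graph : SimpleGraph V
  opp : V → V → V → Prop
  opp_adj : ∀ {v x y : V}, opp v x y → graph.Adj v x ∧ graph.Adj v y

namespace OppGraph

variable {V : Type*} (Γ : OppGraph V)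

/-- Every set of at most `k` neighbours of `v` has a common opposite among the neighbours. -/
def PlumpAt (k : ℕ) (v : V) : Prop :=
  ∀ S : Finset V, (∀ s ∈ S, Γ.graph.Adj v s) → S.card ≤ k →
    ∃ u, Γ.graph.Adj v u ∧ ∀ s ∈ S, Γ.opp v u s

/-- The local opposition relation at `v` is trivial. -/
def TrivialAt (v : V) : Prop :=
  ∀ x y : V, Γ.graph.Adj v x → Γ.graph.Adj v y → x ≠ y → Γ.opp v x y

structure IsVeldkampGraph : Prop where
  symm : ∀ v x y : V, Γ.opp v x y → Γ.opp v y x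
  irrefl : ∀ v x : V, ¬ Γ.opp v x x
  plump : ∀ v : V, Γ.PlumpAt 2 v

/-- `(x 0, …, x s)` is an `s`-path; the further values of `x` play no role. -/
def IsPath (s : ℕ) (x : ℕ → V) : Prop :=
  (∀ i, i + 1 ≤ s → Γ.graph.Adj (x i) (x (i + 1))) ∧ (∀ i, i + 2 ≤ s → x i ≠ x (i + 2))

/-- `(x 0, …, x s)` is a straight `s`-path. -/
def IsStraightPath (s : ℕ) (x : ℕ → V) : Prop :=
  Γ.IsPath s x ∧ ∀ i, i + 2 ≤ s → Γ.opp (x (i + 1)) (x i) (x (i + 2))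

/-- The vertices `w i`, in this cyclic order, form a straight `2n`-circuit. -/
def IsStraightCircuit (n : ℕ) (w : ZMod (2 * n) → V) : Prop :=
  Function.Injective w ∧ (∀ i, Γ.graph.Adj (w i) (w (i + 1))) ∧
    ∀ i, Γ.opp (w i) (w (i - 1)) (w (i + 1))

/-- Veldkamp `n`-gons (for `n ≥ 2`). -/
structure IsVeldkampPolygon (n : ℕ) : Prop extends Γ.IsVeldkampGraph where
  two_le : 2 ≤ n
  connected : Γ.graph.Connected
  bipartite : Γ.graph.IsBipartite
  unique_straight : ∀ k, 1 ≤ k → k + 1 ≤ n → ∀ x, Γ.IsStraightPath k x →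
    ∀ j, j ≤ k → ∀ y, Γ.IsStraightPath j y → y 0 = x 0 → y j = x k →
      j = k ∧ ∀ i, i ≤ k → y i = x i
  exists_circuit : ∀ x, Γ.IsStraightPath (n + 1) x →
    ∃ w : ZMod (2 * n) → V, Γ.IsStraightCircuit n w ∧ ∀ i : ℕ, i ≤ n + 1 → w (i : ZMod (2 * n)) = x i

/-- `x` and `y` are opposite vertices of the `n`-gon: there is a root (a straight `n`-path)
from `x` to `y`. -/
def Opposite (n : ℕ) (x y : V) : Prop :=
  ∃ z, Γ.IsStraightPath n z ∧ z 0 = x ∧ z n = y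

def IsFlat (n : ℕ) : Prop :=
  ∀ x y : V, (∀ z, Γ.Opposite n x z ↔ Γ.Opposite n y z) → x = y

/-- The automorphism group. Permutations are composed from left to right, so the
group is a subgroup of the opposite of `Equiv.Perm V`: `unop (g * h) v = unop h (unop g v)`. -/
def Aut : Subgroup (Equiv.Perm V)ᵐᵒᵖ where
  carrier := {g | (∀ x y, Γ.graph.Adj (unop g x) (unop g y) ↔ Γ.graph.Adj x y) ∧
    ∀ v x y, Γ.opp (unop g v) (unop g x) (unop g y) ↔ Γ.opp v x y}
  mul_mem' := by
    rintro g h ⟨hg, hg2⟩ ⟨hh, hh2⟩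
    refine ⟨fun x y => ?_, fun v x y => ?_⟩
    · simp only [unop_mul, Equiv.Perm.mul_apply]
      rw [hh, hg]
    · simp only [unop_mul, Equiv.Perm.mul_apply]
      rw [hh2, hg2]
  one_mem' := by simp
  inv_mem' := by
    rintro g ⟨hg, hg2⟩
    refine ⟨fun x y => ?_, fun v x y => ?_⟩
    · rw [← hg]; simp
    · rw [← hg2]; simp

/-- The root group of the root `(x 0, …, x n)`: all automorphisms that fix every neighbour of each
of the vertices `x 1, …, x (n - 1)`. -/
def rootGroup (n : ℕ) (x : ℕ → V) : Subgroup (Equiv.Perm V)ᵐᵒᵖ where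
  carrier := {g | g ∈ Γ.Aut ∧
    ∀ i, 1 ≤ i → i + 1 ≤ n → ∀ u, Γ.graph.Adj (x i) u → unop g u = u}
  mul_mem' := by
    rintro g h ⟨hg, hg2⟩ ⟨hh, hh2⟩
    refine ⟨mul_mem hg hh, fun i h1 h2 u hu => ?_⟩
    simp only [unop_mul, Equiv.Perm.mul_apply]
    rw [hg2 i h1 h2 u hu, hh2 i h1 h2 u hu]
  one_mem' := ⟨one_mem _, by simp⟩
  inv_mem' := by
    rintro g ⟨hg, hg2⟩
    refine ⟨inv_mem hg, fun i h1 h2 u hu => ?_⟩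
    rw [unop_inv, Equiv.Perm.inv_eq_iff_eq]
    exact (hg2 i h1 h2 u hu).symm

/-- The Moufang condition for a Veldkamp `n`-gon. -/
def IsMoufang (n : ℕ) : Prop :=
  ∀ x, Γ.IsStraightPath n x → ∀ u v, Γ.opp (x n) (x (n - 1)) u → Γ.opp (x n) (x (n - 1)) v →
    ∃ g ∈ Γ.rootGroup n x, unop g u = v

/-- Tits `n`-gons, i.e. Moufang Veldkamp `n`-gons (for `n ≥ 3`). -/
def IsTitsPolygon (n : ℕ) : Prop :=
  3 ≤ n ∧ Γ.IsVeldkampPolygon n ∧ Γ.IsMoufang n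

/-- The root group labelling `i ↦ U_i` of a coordinate system `w`, that is, of a cyclic numbering
`w` of the vertices of a straight `2n`-circuit: `U_i` is the root group of
`(w i, w (i + 1), …, w (i + n))`. -/
def labelling (n : ℕ) (w : ZMod (2 * n) → V) (i : ZMod (2 * n)) : Subgroup (Equiv.Perm V)ᵐᵒᵖ :=
  Γ.rootGroup n fun j => w (i + (j : ZMod (2 * n)))

end OppGraph

/-- The opposite coordinate system `i ↦ w (2n + 1 - i)`; it replaces `U_i` by `U_(n + 1 - i)`. -/
def oppositeCoord {V : Type*} (n : ℕ) (w : ZMod (2 * n) → V) : ZMod (2 * n) → V :=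
  fun i => w (1 - i)

/-- The commutator `[g, h] = g⁻¹ h⁻¹ g h`. -/
def comm {G : Type*} [Group G] (g h : G) : G := g⁻¹ * h⁻¹ * g * h

/-! ## Line spaces and polar spaces

A line space on the point set `P` is given by its set `𝓛` of lines. -/

section LineSpace

variable {P : Type*} (𝓛 : Set (Set P))

/-- The set of points collinear with `a`, including `a` itself. -/
def perp (a : P) : Set P := {b | b = a ∨ ∃ x ∈ 𝓛, a ∈ x ∧ b ∈ x}

def IsSubspace (X : Set P) : Prop := ∀ x ∈ 𝓛, x ⊆ X ∨ (x ∩ X).Subsingleton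

/-- The subspace generated by `X`. -/
def generated (X : Set P) : Set P := ⋂₀ {Y | IsSubspace 𝓛 Y ∧ X ⊆ Y}

/-- Any two points of `X` are collinear. -/
def IsSingular (X : Set P) : Prop := ∀ a ∈ X, ∀ b ∈ X, b ∈ perp 𝓛 a

def IsLineSpace : Prop := ∀ x ∈ 𝓛, 2 ≤ x.encard

def IsThick : Prop := ∀ x ∈ 𝓛, 3 ≤ x.encard

def IsPolarSpace : Prop :=
  IsLineSpace 𝓛 ∧ ∀ a : P, ∀ x ∈ 𝓛, (perp 𝓛 a ∩ x).encard = 1 ∨ x ⊆ perp 𝓛 a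

def IsNondegeneratePolar : Prop := ∀ a : P, perp 𝓛 a ≠ Set.univ

/-- The incidence graph of a line space, with the following local opposition relations: two lines
`x`, `y` on a point are opposite there if the subspace generated by `x ∪ y` is not singular, and
two points of a line are opposite there if they are distinct. -/
def incidenceGraph : OppGraph (P ⊕ 𝓛) where
  graph :=
    { Adj := fun u v => match u, v with
        | .inl a, .inr x => a ∈ x.1
        | .inr x, .inl a => a ∈ x.1
        | _, _ => False
      symm := ⟨by rintro (a | x) (b | y) h <;> exact h⟩
      loopless := ⟨by rintro (a | x) h <;> exact h⟩ }
  opp := fun v u w => match v, u, w with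
    | .inl a, .inr x, .inr y => a ∈ x.1 ∧ a ∈ y.1 ∧ ¬ IsSingular 𝓛 (generated 𝓛 (x.1 ∪ y.1))
    | .inr x, .inl a, .inl b => a ∈ x.1 ∧ b ∈ x.1 ∧ a ≠ b
    | _, _, _ => False
  opp_adj := by
    rintro (a | x) (b | y) (c | z) h <;>
      first
        | exact ⟨h.1, h.2.1⟩
        | exact h.elim

end LineSpace

/-! ## The polar space of totally isotropic subspaces -/

section Isotropic

variable {R M : Type*} [DivisionRing R] [AddCommGroup M] [Module R M] (tot : Submodule R M → Prop)

/-- The `1`-dimensional subspaces that satisfy `tot`. -/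
abbrev Points : Type _ := {U : Submodule R M // Module.finrank R U = 1 ∧ tot U}

/-- The `2`-dimensional subspaces that satisfy `tot`, each identified with the set of
points that it contains. -/
def isoLines : Set (Set (Points tot)) :=
  {x | ∃ E : Submodule R M, Module.finrank R E = 2 ∧ tot E ∧ x = {p | p.1 ≤ E}}

/-- The subspace of `M` that a vertex (a point or a line) stands for. -/
def vertexSpace : Points tot ⊕ isoLines tot → Submodule R M
  | .inl p => p.1
  | .inr x => ⨆ p ∈ x.1, p.1

/-- The permutation `g` of the set of points and lines is induced by `φ`. -/
def Induces (φ : M ≃ₗ[R] M) (g : (Equiv.Perm (Points tot ⊕ isoLines tot))ᵐᵒᵖ) : Prop :=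
  ∀ v, vertexSpace tot (unop g v) = (vertexSpace tot v).map (φ : M →ₗ[R] M)

end Isotropic

/-! ## The space `K⁴ ⊕ L` -/

/-- `V = K⁴ ⊕ L`, with elements `(t₁, t₁', t₂, t₂', a)`. -/
abbrev HypSum (K L : Type*) : Type _ := K × K × K × K × L

section Vectors

variable (K : Type*) {L : Type*} [Ring K] [AddCommGroup L]

/-- The vector `x₁`. -/
def vx1 : HypSum K L := (1, 0, 0, 0, 0)
/-- The vector `x₁'`. -/
def vy1 : HypSum K L := (0, 1, 0, 0, 0)
/-- The vector `x₂`. -/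
def vx2 : HypSum K L := (0, 0, 1, 0, 0)
/-- The vector `x₂'`. -/
def vy2 : HypSum K L := (0, 0, 0, 1, 0)
/-- The embedding of `L` in `V`. -/
def vL (u : L) : HypSum K L := (0, 0, 0, 0, u)

end Vectors

/-! ## Quadratic spaces -/

section Quadratic

variable {K L : Type*} [Field K] [AddCommGroup L] [Module K L] (q : QuadraticForm K L)

/-- Non-degeneracy: `q` has no non-trivial zero in the radical of the associated bilinear form. -/
def QNondegenerate : Prop :=
  ∀ a : L, q a = 0 → (∀ b : L, QuadraticMap.polar q a b = 0) → a = 0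

/-- `Q(t₁, t₁', t₂, t₂', a) = t₁ t₁' + t₂ t₂' + q(a)`. -/
def bigQ : HypSum K L → K := fun ⟨t1, t1', t2, t2', a⟩ => t1 * t1' + t2 * t2' + q a

def bigF : HypSum K L → HypSum K L → K :=
  fun ⟨s1, s1', s2, s2', b⟩ ⟨t1, t1', t2, t2', a⟩ =>
    s1 * t1' + t1 * s1' + s2 * t2' + t2 * s2' + QuadraticMap.polar q a b

/-- `Q` and `F` vanish identically on `U`. -/
def QTot (U : Submodule K (HypSum K L)) : Prop :=
  (∀ v ∈ U, bigQ q v = 0) ∧ ∀ v ∈ U, ∀ w ∈ U, bigF q v w = 0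

/-- The graph `Γ` of the polar space of a quadratic space. -/
def quadGraph : OppGraph (Points (QTot q) ⊕ isoLines (QTot q)) := incidenceGraph (isoLines (QTot q))

def QIsometry (φ : HypSum K L ≃ₗ[K] HypSum K L) : Prop :=
  (∀ v, bigQ q (φ v) = bigQ q v) ∧ ∀ v w, bigF q (φ v) (φ w) = bigF q v w

/-- The map `α_a`. -/
def IsQAlpha (a : L) (φ : HypSum K L ≃ₗ[K] HypSum K L) : Prop :=
  φ (vx1 K) = vx1 K ∧ φ (vx2 K) = vx2 K ∧ φ (vy2 K) = vy2 K ∧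
    φ (vy1 K) = vy1 K - q a • vx1 K + vL K a ∧
    ∀ u, φ (vL K u) = vL K u - QuadraticMap.polar q u a • vx1 K

/-- The map `β_b`. -/
def IsQBeta (b : L) (φ : HypSum K L ≃ₗ[K] HypSum K L) : Prop :=
  φ (vx1 K) = vx1 K ∧ φ (vy1 K) = vy1 K ∧ φ (vy2 K) = vy2 K ∧
    φ (vx2 K) = vx2 K - q b • vy2 K + vL K b ∧
    ∀ u, φ (vL K u) = vL K u - QuadraticMap.polar q u b • vy2 K

/-- The map `γ_t`. -/
def IsQGamma (t : K) (φ : HypSum K L ≃ₗ[K] HypSum K L) : Prop :=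
  φ (vx1 K) = vx1 K ∧ φ (vy2 K) = vy2 K ∧ (∀ u, φ (vL K u) = vL K u) ∧
    φ (vy1 K) = vy1 K - t • vy2 K ∧ φ (vx2 K) = vx2 K + t • vx1 K

/-- The map `δ_s`. -/
def IsQDelta (s : K) (φ : HypSum K L ≃ₗ[K] HypSum K L) : Prop :=
  φ (vy1 K) = vy1 K ∧ φ (vy2 K) = vy2 K ∧ (∀ u, φ (vL K u) = vL K u) ∧
    φ (vx1 K) = vx1 K + s • vy2 K ∧ φ (vx2 K) = vx2 K - s • vy1 K

/-- The numbering `(w₁, …, w₈) = (x₁'x₂, x₁', x₁'x₂', x₂', x₁x₂', x₁, x₁x₂, x₂)`. -/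
def IsQStandard (w : ZMod (2 * 4) → Points (QTot q) ⊕ isoLines (QTot q)) : Prop :=
  vertexSpace (QTot q) (w 1) = Submodule.span K {vy1 K, vx2 K} ∧
  vertexSpace (QTot q) (w 2) = Submodule.span K {vy1 K} ∧
  vertexSpace (QTot q) (w 3) = Submodule.span K {vy1 K, vy2 K} ∧
  vertexSpace (QTot q) (w 4) = Submodule.span K {vy2 K} ∧
  vertexSpace (QTot q) (w 5) = Submodule.span K {vx1 K, vy2 K} ∧
  vertexSpace (QTot q) (w 6) = Submodule.span K {vx1 K} ∧
  vertexSpace (QTot q) (w 7) = Submodule.span K {vx1 K, vx2 K} ∧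
  vertexSpace (QTot q) (w 8) = Submodule.span K {vx2 K}

/-- The commutator relations of orthogonal type; `Multiplicative A` is the additive group of `A`,
written multiplicatively. -/
def OrthRel {G : Type*} [Group G] (U : ZMod (2 * 4) → Subgroup G)
    (x₁ : Multiplicative K ≃* U 1) (x₂ : Multiplicative L ≃* U 2)
    (x₃ : Multiplicative K ≃* U 3) (x₄ : Multiplicative L ≃* U 4) : Prop :=
  (∀ i, ∀ g ∈ U i, ∀ h ∈ U (i + 1), comm g h = 1) ∧
  (∀ g ∈ U 1, ∀ h ∈ U 3, comm g h = 1) ∧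
  (∀ a b : L, comm (x₂ (.ofAdd a) : G) ((x₄ (.ofAdd b) : G)⁻¹) =
    x₃ (.ofAdd (QuadraticMap.polar q a b))) ∧
  (∀ (t : K) (a : L), comm (x₁ (.ofAdd t) : G) ((x₄ (.ofAdd a) : G)⁻¹) =
    (x₂ (.ofAdd (t • a)) : G) * x₃ (.ofAdd (t * q a)))

/-- `Γ` is a Tits quadrangle that is orthogonal of type `(K, L, q)`. -/
def IsOrthogonalOfType {V : Type*} (Γ : OppGraph V) : Prop :=
  Γ.IsTitsPolygon 4 ∧ ∀ w : ZMod (2 * 4) → V, Γ.IsStraightCircuit 4 w →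
    (∃ x₁ x₂ x₃ x₄, OrthRel q (Γ.labelling 4 w) x₁ x₂ x₃ x₄) ∨
    (∃ x₁ x₂ x₃ x₄, OrthRel q (Γ.labelling 4 (oppositeCoord 4 w)) x₁ x₂ x₃ x₄)

end Quadratic

/-! ## Pseudo-quadratic spaces -/

/-- A pseudo-quadratic space `(K, K₀, σ, L, q)` together with its skew-hermitian form `f`. Here
`σ` is the map `star`, and the right vector space `L` is a module over the opposite of `K`, so that
`op t • a` is the vector `a t`. -/
structure PQSpace (K L : Type*) [DivisionRing K] [StarRing K] [AddCommGroup L]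
    [Module Kᵐᵒᵖ L] where
  K₀ : AddSubgroup K
  one_mem : (1 : K) ∈ K₀
  trace_mem : ∀ t : K, t + star t ∈ K₀
  star_eq : ∀ t ∈ K₀, star t = t
  conj_mem : ∀ t : K, ∀ s ∈ K₀, star t * s * t ∈ K₀
  f : L → L → K
  f_add_right : ∀ a b c : L, f a (b + c) = f a b + f a c
  f_smul_right : ∀ (a b : L) (t : K), f a (op t • b) = f a b * t
  f_skew : ∀ a b : L, star (f a b) = - f b a
  q : L → K
  q_add : ∀ a b : L, q (a + b) - (q a + q b + f a b) ∈ K₀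
  q_smul : ∀ (a : L) (t : K), q (op t • a) - star t * q a * t ∈ K₀

namespace PQSpace

variable {K L : Type*} [DivisionRing K] [StarRing K] [AddCommGroup L] [Module Kᵐᵒᵖ L]
  (Λ : PQSpace K L)

/-- Non-degeneracy: no non-zero vector `a` in the radical of `f` satisfies `q(a) ∈ K₀`. -/
def Nondegenerate : Prop := ∀ a : L, (∀ b : L, Λ.f a b = 0) → Λ.q a ∈ Λ.K₀ → a = 0

theorem f_add_left (a b c : L) : Λ.f (a + b) c = Λ.f a c + Λ.f b c := by
  have h := Λ.f_skew c (a + b)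
  rw [Λ.f_add_right, star_add, Λ.f_skew, Λ.f_skew] at h
  have h2 := congrArg Neg.neg h
  simpa [add_comm] using h2.symm

theorem f_zero_right (a : L) : Λ.f a 0 = 0 := by
  simpa using Λ.f_add_right a 0 0

theorem f_zero_left (a : L) : Λ.f 0 a = 0 := by
  simpa using Λ.f_add_left 0 0 a

theorem f_neg_left (a b : L) : Λ.f (-a) b = - Λ.f a b := by
  have h := Λ.f_add_left a (-a) b
  rw [add_neg_cancel, f_zero_left] at h
  exact (neg_eq_of_add_eq_zero_right h.symm).symm

theorem f_neg_right (a b : L) : Λ.f a (-b) = - Λ.f a b := by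
  have h := Λ.f_add_right a b (-b)
  rw [add_neg_cancel, f_zero_right] at h
  exact (neg_eq_of_add_eq_zero_right h.symm).symm

theorem q_zero_mem : Λ.q 0 ∈ Λ.K₀ := by
  simpa using Λ.q_smul 0 0

/-- The underlying set `{(a, t) | q(a) - t ∈ K₀}` of the group `T`. -/
def T : Type _ := {p : L × K // Λ.q p.1 - p.2 ∈ Λ.K₀}

variable {Λ}

@[ext] theorem T.ext {x y : Λ.T} (h1 : x.1.1 = y.1.1) (h2 : x.1.2 = y.1.2) : x = y :=
  Subtype.ext (Prod.ext h1 h2)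

theorem mul_mem_T (x y : Λ.T) :
    Λ.q (x.1.1 + y.1.1) - (x.1.2 + y.1.2 + Λ.f y.1.1 x.1.1) ∈ Λ.K₀ := by
  have h1 := Λ.q_add x.1.1 y.1.1
  have h2 := Λ.trace_mem (Λ.f x.1.1 y.1.1)
  rw [Λ.f_skew] at h2
  have h := add_mem (add_mem h1 h2) (add_mem x.2 y.2)
  convert h using 1
  abel

theorem inv_mem_T (x : Λ.T) :
    Λ.q (-x.1.1) - (-x.1.2 + Λ.f x.1.1 x.1.1) ∈ Λ.K₀ := by
  have h1 := Λ.q_add x.1.1 (-x.1.1)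
  rw [add_neg_cancel, Λ.f_neg_right] at h1
  have h2 := Λ.q_smul x.1.1 (-1)
  have h3 : op (-1 : K) • x.1.1 = -x.1.1 := by
    rw [op_neg, neg_smul, op_one, one_smul]
  rw [h3] at h2
  have h4 : star (-1 : K) * Λ.q x.1.1 * (-1) = Λ.q x.1.1 := by simp
  rw [h4] at h2
  have h := sub_mem (sub_mem Λ.q_zero_mem h1) x.2
  convert h using 1
  abel

/-- `(a, t) (b, u) = (a + b, t + u + f(b, a))`. -/
instance : Mul Λ.T := ⟨fun x y => ⟨(x.1.1 + y.1.1, x.1.2 + y.1.2 + Λ.f y.1.1 x.1.1), mul_mem_T x y⟩⟩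

instance : One Λ.T := ⟨⟨(0, 0), by simpa using Λ.q_zero_mem⟩⟩

instance : Inv Λ.T := ⟨fun x => ⟨(-x.1.1, -x.1.2 + Λ.f x.1.1 x.1.1), inv_mem_T x⟩⟩

theorem T.mul_fst (x y : Λ.T) : (x * y).1.1 = x.1.1 + y.1.1 := rfl
theorem T.mul_snd (x y : Λ.T) : (x * y).1.2 = x.1.2 + y.1.2 + Λ.f y.1.1 x.1.1 := rfl
theorem T.one_fst : (1 : Λ.T).1.1 = 0 := rfl
theorem T.one_snd : (1 : Λ.T).1.2 = 0 := rfl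
theorem T.inv_fst (x : Λ.T) : (x⁻¹).1.1 = -x.1.1 := rfl
theorem T.inv_snd (x : Λ.T) : (x⁻¹).1.2 = -x.1.2 + Λ.f x.1.1 x.1.1 := rfl

instance : Group Λ.T :=
  Group.ofLeftAxioms
    (fun x y z => by
      ext
      · simp only [T.mul_fst]; abel
      · simp only [T.mul_fst, T.mul_snd, Λ.f_add_right, Λ.f_add_left]; abel)
    (fun x => by
      ext
      · simp only [T.mul_fst, T.one_fst, zero_add]
      · simp only [T.mul_snd, T.one_fst, T.one_snd, Λ.f_zero_right, zero_add, add_zero])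
    (fun x => by
      ext
      · simp only [T.mul_fst, T.inv_fst, T.one_fst, neg_add_cancel]
      · simp only [T.mul_snd, T.inv_snd, T.inv_fst, T.one_snd, Λ.f_neg_right]; abel)

variable (Λ)

/-- The element `(0, v^σ w + w^σ v)` of `T`. -/
def traceElt (v w : K) : Λ.T :=
  ⟨(0, star v * w + star w * v), by
    have h := Λ.trace_mem (star v * w)
    rw [star_mul, star_star] at h
    exact sub_mem Λ.q_zero_mem h⟩

variable {Λ}

/-- The element `(a v, v^σ t v)` of `T`, for `(a, t) ∈ T` and `v ∈ K`. -/
def scaleElt (x : Λ.T) (v : K) : Λ.T :=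
  ⟨(op v • x.1.1, star v * x.1.2 * v), by
    have h1 := Λ.q_smul x.1.1 v
    have h2 := Λ.conj_mem v _ x.2
    have h := add_mem h1 h2
    rw [mul_sub, sub_mul] at h
    convert h using 1
    abel⟩

variable (Λ)

/-- `Q(t₁, t₁', t₂, t₂', a) = t₁^σ t₁' + t₂^σ t₂' + q(a)`, to be read modulo `K₀`. -/
def bigQ : HypSum K L → K := fun ⟨t1, t1', t2, t2', a⟩ => star t1 * t1' + star t2 * t2' + Λ.q a

def bigF : HypSum K L → HypSum K L → K :=
  fun ⟨s1, s1', s2, s2', b⟩ ⟨t1, t1', t2, t2', a⟩ =>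
    star s1 * t1' - star s1' * t1 + star s2 * t2' - star s2' * t2 + Λ.f b a

/-- `Q` (modulo `K₀`) and `F` vanish identically on `U`. -/
def Tot (U : Submodule Kᵐᵒᵖ (HypSum K L)) : Prop :=
  (∀ v ∈ U, Λ.bigQ v ∈ Λ.K₀) ∧ ∀ v ∈ U, ∀ w ∈ U, Λ.bigF v w = 0

/-- The graph `Γ` of the polar space of a pseudo-quadratic space. -/
def graph : OppGraph (Points Λ.Tot ⊕ isoLines Λ.Tot) := incidenceGraph (isoLines Λ.Tot)

def Isometry (φ : HypSum K L ≃ₗ[Kᵐᵒᵖ] HypSum K L) : Prop :=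
  (∀ v, Λ.bigQ (φ v) - Λ.bigQ v ∈ Λ.K₀) ∧ ∀ v w, Λ.bigF (φ v) (φ w) = Λ.bigF v w

variable {Λ}

/-- The map `α_(a, t)`. -/
def IsAlpha (z : Λ.T) (φ : HypSum K L ≃ₗ[Kᵐᵒᵖ] HypSum K L) : Prop :=
  φ (vx1 K) = vx1 K ∧ φ (vx2 K) = vx2 K ∧ φ (vy2 K) = vy2 K ∧
    φ (vy1 K) = vy1 K + op z.1.2 • vx1 K + vL K z.1.1 ∧
    ∀ u, φ (vL K u) = vL K u + op (Λ.f z.1.1 u) • vx1 K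

/-- The map `β_(b, s)`. -/
def IsBeta (z : Λ.T) (φ : HypSum K L ≃ₗ[Kᵐᵒᵖ] HypSum K L) : Prop :=
  φ (vx1 K) = vx1 K ∧ φ (vy1 K) = vy1 K ∧ φ (vy2 K) = vy2 K ∧
    φ (vx2 K) = vx2 K - op z.1.2 • vy2 K - vL K z.1.1 ∧
    ∀ u, φ (vL K u) = vL K u + op (Λ.f z.1.1 u) • vy2 K

/-- The map `γ_t`. -/
def IsGamma (t : K) (φ : HypSum K L ≃ₗ[Kᵐᵒᵖ] HypSum K L) : Prop :=
  φ (vx1 K) = vx1 K ∧ φ (vy2 K) = vy2 K ∧ (∀ u, φ (vL K u) = vL K u) ∧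
    φ (vy1 K) = vy1 K + op (star t) • vy2 K ∧ φ (vx2 K) = vx2 K - op t • vx1 K

/-- The map `δ_s`. -/
def IsDelta (s : K) (φ : HypSum K L ≃ₗ[Kᵐᵒᵖ] HypSum K L) : Prop :=
  φ (vy1 K) = vy1 K ∧ φ (vy2 K) = vy2 K ∧ (∀ u, φ (vL K u) = vL K u) ∧
    φ (vx1 K) = vx1 K - op (star s) • vy2 K ∧ φ (vx2 K) = vx2 K - op s • vy1 K

variable (Λ)

/-- The numbering `(w₁, …, w₈) = (x₂, x₁x₂, x₁, x₁x₂', x₂', x₁'x₂', x₁', x₁'x₂)`. -/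
def IsStandard (w : ZMod (2 * 4) → Points Λ.Tot ⊕ isoLines Λ.Tot) : Prop :=
  vertexSpace Λ.Tot (w 1) = Submodule.span Kᵐᵒᵖ {vx2 K} ∧
  vertexSpace Λ.Tot (w 2) = Submodule.span Kᵐᵒᵖ {vx1 K, vx2 K} ∧
  vertexSpace Λ.Tot (w 3) = Submodule.span Kᵐᵒᵖ {vx1 K} ∧
  vertexSpace Λ.Tot (w 4) = Submodule.span Kᵐᵒᵖ {vx1 K, vy2 K} ∧
  vertexSpace Λ.Tot (w 5) = Submodule.span Kᵐᵒᵖ {vy2 K} ∧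
  vertexSpace Λ.Tot (w 6) = Submodule.span Kᵐᵒᵖ {vy1 K, vy2 K} ∧
  vertexSpace Λ.Tot (w 7) = Submodule.span Kᵐᵒᵖ {vy1 K} ∧
  vertexSpace Λ.Tot (w 8) = Submodule.span Kᵐᵒᵖ {vy1 K, vx2 K}

/-- The commutator relations of pseudo-quadratic type. -/
def PQRel {G : Type*} [Group G] (U : ZMod (2 * 4) → Subgroup G)
    (x₁ : Λ.T ≃* U 1) (x₂ : Multiplicative K ≃* U 2)
    (x₃ : Λ.T ≃* U 3) (x₄ : Multiplicative K ≃* U 4) : Prop :=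
  (∀ i, ∀ g ∈ U i, ∀ h ∈ U (i + 1), comm g h = 1) ∧
  (∀ y z : Λ.T, comm (x₁ y : G) ((x₃ z : G)⁻¹) = x₂ (.ofAdd (Λ.f y.1.1 z.1.1))) ∧
  (∀ v w : K, comm (x₂ (.ofAdd v) : G) ((x₄ (.ofAdd w) : G)⁻¹) = x₃ (Λ.traceElt v w)) ∧
  (∀ (y : Λ.T) (v : K), comm (x₁ y : G) ((x₄ (.ofAdd v) : G)⁻¹) =
    (x₂ (.ofAdd (y.1.2 * v)) : G) * x₃ (scaleElt y v))

/-- `Γ` is a Tits quadrangle that is pseudo-quadratic of type `Λ`. -/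
def IsOfType {V : Type*} (Γ : OppGraph V) : Prop :=
  Γ.IsTitsPolygon 4 ∧ ∀ w : ZMod (2 * 4) → V, Γ.IsStraightCircuit 4 w →
    (∃ x₁ x₂ x₃ x₄, Λ.PQRel (Γ.labelling 4 w) x₁ x₂ x₃ x₄) ∨
    (∃ x₁ x₂ x₃ x₄, Λ.PQRel (Γ.labelling 4 (oppositeCoord 4 w)) x₁ x₂ x₃ x₄)

end PQSpace

end TitsQuad

open TitsQuad

universe u v

/-! Both cases are treated through one geometric interface. Of the pair (Q, F) only two relations
matter, "v is isotropic" and "v is orthogonal to w", and `PolarForm` collects the few facts about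
them that are needed. From these facts and a frame of four isotropic vectors (the basis of K⁴),
`PolarForm.isThickPolarSpace` obtains a thick non-degenerate polar space. The one fact that is not
formal is `exists_third`, which gives two lines on a point a common opposite. It holds because L ≠ 0
in Case I (`quad_exists_third`) and because 1 ∈ K₀ in Case II, where L may vanish.

The "one or all" axiom turns the incidence graph into a Veldkamp quadrangle
(`IsThickPolarSpace.isVeldkampPolygon`): two lines on a point are opposite there exactly when they
carry non-collinear points, the uniqueness of the projection of a point to a line gives the
uniqueness of straight 3-paths, and the existence of projections closes straight 5-paths to
circuits. Flatness holds because perpendicular sets separate points and separate lines.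

The Moufang property and the type concern all roots and all coordinate systems, but one circuit
suffices. Every straight circuit is reached from a given one by steps that keep a root
(`induction_circuit`). If, for one circuit, the root groups of one root of each parity are
transitive, and the rotation by two places and a reflection are induced by automorphisms, then each
step is realized by an automorphism, so all circuits are images of the given one up to renumbering
(`equivalent`). The only obstruction to matching numberings is parity, and passing to the opposite
coordinate system removes it (`exists_aut`).

On the standard circuit the root groups are determined by rigidity: an element of U_i that fixes the
vertex after the root is trivial (`eq_one_of_mem_labelling`). So a group of automorphisms in U_i
that acts regularly on the vertices opposite w_{i+3} at w_{i+4} is all of U_i (`exists_mulEquiv`).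
The maps α, β, γ, δ have this property; regularity says that an isotropic vector can be normalized
by a scalar in exactly one way. The relation [U_i, U_{i+1}] = 1 is formal (`comm_eq_one`), and the
other commutator relations become identities between linear maps of V.

In Case II the condition on the characteristic enters through the identity f(a, a) = q(a) - q(a)^σ.
It makes isotropic vectors orthogonal to themselves and makes α and β preserve F exactly. -/

namespace TitsQuad

open MulOpposite

namespace OppGraph

variable {V : Type*} {Γ : OppGraph V}

/-! ## Straight circuits of Veldkamp quadrangles -/

theorem IsVeldkampGraph.isStraightPath (hΓ : Γ.IsVeldkampGraph) {s : ℕ} {x : ℕ → V}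
    (ha : ∀ i, i + 1 ≤ s → Γ.graph.Adj (x i) (x (i + 1)))
    (ho : ∀ i, i + 2 ≤ s → Γ.opp (x (i + 1)) (x i) (x (i + 2))) : Γ.IsStraightPath s x :=
  ⟨⟨ha, fun i hi h => hΓ.irrefl (x (i + 1)) (x i) (by
    have h2 := ho i hi
    rwa [← h] at h2)⟩, ho⟩

theorem IsStraightCircuit.isStraightPath (hΓ : Γ.IsVeldkampGraph) {w : ZMod (2 * 4) → V}
    (hw : Γ.IsStraightCircuit 4 w) (k : ZMod (2 * 4)) (s : ℕ) :
    Γ.IsStraightPath s fun i => w (k + i) := by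
  refine hΓ.isStraightPath (fun i _ => ?_) (fun i _ => ?_)
  · have := hw.2.1 (k + i)
    rwa [add_assoc, ← Nat.cast_succ] at this
  · have := hw.2.2 (k + (i + 1 : ℕ))
    have e1 : k + ((i + 1 : ℕ) : ZMod (2 * 4)) - 1 = k + i := by push_cast; ring
    have e2 : k + ((i + 1 : ℕ) : ZMod (2 * 4)) + 1 = k + (i + 2 : ℕ) := by push_cast; ring
    rwa [e1, e2] at this

theorem IsStraightCircuit.rotate {w : ZMod (2 * 4) → V}
    (hw : Γ.IsStraightCircuit 4 w) (k : ZMod (2 * 4)) :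
    Γ.IsStraightCircuit 4 fun i => w (i + k) := by
  refine ⟨fun i j h => add_right_cancel (hw.1 h), fun i => ?_, fun i => ?_⟩
  · have := hw.2.1 (i + k)
    rwa [add_right_comm] at this
  · have := hw.2.2 (i + k)
    rwa [add_right_comm, ← sub_add_eq_add_sub] at this

theorem IsStraightCircuit.reflect (hΓ : Γ.IsVeldkampGraph) {w : ZMod (2 * 4) → V}
    (hw : Γ.IsStraightCircuit 4 w) (k : ZMod (2 * 4)) :
    Γ.IsStraightCircuit 4 fun i => w (k - i) := by
  refine ⟨fun i j h => sub_right_injective (hw.1 h), fun i => ?_, fun i => ?_⟩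
  · have := hw.2.1 (k - (i + 1))
    rw [show k - (i + 1) + 1 = k - i by ring] at this
    exact this.symm
  · have := hw.2.2 (k - i)
    rw [show k - i - 1 = k - (i + 1) by ring, show k - i + 1 = k - (i - 1) by ring] at this
    exact hΓ.symm _ _ _ this

theorem IsStraightCircuit.map {w : ZMod (2 * 4) → V} (hw : Γ.IsStraightCircuit 4 w)
    {g : (Equiv.Perm V)ᵐᵒᵖ} (hg : g ∈ Γ.Aut) : Γ.IsStraightCircuit 4 fun i => unop g (w i) :=
  ⟨fun _ _ h => hw.1 ((unop g).injective h), fun i => (hg.1 _ _).2 (hw.2.1 i),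
    fun i => (hg.2 _ _ _).2 (hw.2.2 i)⟩

theorem IsVeldkampGraph.exists_opp (hΓ : Γ.IsVeldkampGraph) {v x y : V} (hx : Γ.graph.Adj v x)
    (hy : Γ.graph.Adj v y) : ∃ u, Γ.graph.Adj v u ∧ Γ.opp v u x ∧ Γ.opp v u y := by
  classical
  obtain ⟨u, hu, h⟩ := hΓ.plump v {x, y} (by simp [hx, hy]) (Finset.card_le_two)
  exact ⟨u, hu, h x (by simp), h y (by simp)⟩

namespace IsVeldkampPolygon

variable (hΓ : Γ.IsVeldkampPolygon 4)
include hΓ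

/-- A root followed by `u` is a straight 5-path, which the last axiom of a Veldkamp quadrangle
completes to a circuit. This is the elementary move between circuits: everything outside one root
may change. -/
theorem exists_circuit_fwd {w : ZMod (2 * 4) → V} (hw : Γ.IsStraightCircuit 4 w)
    (k : ZMod (2 * 4)) {u : V} (hu : Γ.opp (w (k + 4)) (w (k + 3)) u) :
    ∃ w', Γ.IsStraightCircuit 4 w' ∧ w' k = w k ∧ w' (k + 1) = w (k + 1) ∧
      w' (k + 2) = w (k + 2) ∧ w' (k + 3) = w (k + 3) ∧ w' (k + 4) = w (k + 4) ∧
      w' (k + 5) = u := by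
  have h0 := hw.isStraightPath hΓ.toIsVeldkampGraph k 4
  obtain ⟨w', hw', h⟩ := hΓ.exists_circuit (fun i => if i = 5 then u else w (k + i))
    (hΓ.toIsVeldkampGraph.isStraightPath (fun i hi => by
      rcases Nat.lt_or_ge i 4 with h | h
      · rw [if_neg (by omega), if_neg (by omega)]
        exact h0.1.1 i h
      · obtain rfl : i = 4 := by omega
        simpa using (Γ.opp_adj hu).2)
      (fun i hi => by
        rcases Nat.lt_or_ge i 3 with h | h
        · rw [if_neg (by omega), if_neg (by omega), if_neg (by omega)]
          exact h0.2 i (by omega)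
        · obtain rfl : i = 3 := by omega
          simpa using hu))
  refine ⟨fun i => w' (i - k), by simpa [sub_eq_add_neg] using hw'.rotate (-k), ?_⟩
  have e := fun i hi => (h i hi)
  refine ⟨?_, ?_, ?_, ?_, ?_, ?_⟩
  · simpa using h 0
  · simpa using h 1
  · simpa using h 2
  · simpa using h 3
  · simpa using h 4
  · simpa using h 5

/-- The mirror image of `exists_circuit_fwd`: the reflection i ↦ k + 4 - i reverses the root and
exchanges the places before and after it. -/
theorem exists_circuit_bwd {w : ZMod (2 * 4) → V} (hw : Γ.IsStraightCircuit 4 w)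
    (k : ZMod (2 * 4)) {u : V} (hu : Γ.opp (w k) (w (k + 1)) u) :
    ∃ w', Γ.IsStraightCircuit 4 w' ∧ w' k = w k ∧ w' (k + 1) = w (k + 1) ∧
      w' (k + 2) = w (k + 2) ∧ w' (k + 3) = w (k + 3) ∧ w' (k + 4) = w (k + 4) ∧
      w' (k + 7) = u := by
  obtain ⟨w', hw', h0, h1, h2, h3, h4, h5⟩ := hΓ.exists_circuit_fwd
    (hw.reflect hΓ.toIsVeldkampGraph (k + 4)) 0 (u := u) (by
      rwa [show k + 4 - (0 + 4) = k by ring, show k + 4 - (0 + 3) = k + 1 by ring])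
  refine ⟨_, hw'.reflect hΓ.toIsVeldkampGraph (k + 4), ?_, ?_, ?_, ?_, ?_, ?_⟩
  · rw [show k + 4 - k = 0 + 4 by ring, h4]; congr 1; ring
  · rw [show k + 4 - (k + 1) = 0 + 3 by ring, h3]; congr 1; ring
  · rw [show k + 4 - (k + 2) = 0 + 2 by ring, h2]; congr 1; ring
  · rw [show k + 4 - (k + 3) = 0 + 1 by ring, h1]; congr 1; ring
  · rw [show k + 4 - (k + 4) = 0 by ring, h0]; congr 1; ring
  -- This identity uses 8 = 0, so it is checked in `ZMod 8` rather than by `ring`.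
  · rw [← h5]; congr 1; exact (by decide : ∀ k : ZMod (2 * 4), k + 4 - (k + 7) = 0 + 5) k

/-- Straight `3`-paths of two circuits between the same ends coincide. -/
theorem circuit_interpolate {w w' : ZMod (2 * 4) → V} (hw : Γ.IsStraightCircuit 4 w)
    (hw' : Γ.IsStraightCircuit 4 w') {k k' : ZMod (2 * 4)} (h0 : w' k' = w k)
    (h3 : w' (k' + 3) = w (k + 3)) : w' (k' + 1) = w (k + 1) ∧ w' (k' + 2) = w (k + 2) := by
  have h := (hΓ.unique_straight 3 (by norm_num) (by norm_num) _
    (hw.isStraightPath hΓ.toIsVeldkampGraph k 3) 3 le_rfl _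
    (hw'.isStraightPath hΓ.toIsVeldkampGraph k' 3) (by simpa using h0) (by simpa using h3)).2
  exact ⟨by simpa using h 1, by simpa using h 2⟩

/-- Six consecutive vertices leave only the interior of the straight 3-path from place 5 to place 8
= 0, and that path is determined by its ends. -/
theorem circuit_ext {w w' : ZMod (2 * 4) → V} (hw : Γ.IsStraightCircuit 4 w)
    (hw' : Γ.IsStraightCircuit 4 w') (h0 : w' 0 = w 0) (h1 : w' 1 = w 1) (h2 : w' 2 = w 2)
    (h3 : w' 3 = w 3) (h4 : w' 4 = w 4) (h5 : w' 5 = w 5) : w' = w := by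
  obtain ⟨h6, h7⟩ := hΓ.circuit_interpolate hw hw' (k := 5) (k' := 5) h5 h0
  funext i
  revert i
  exact fun | 0 => h0 | 1 => h1 | 2 => h2 | 3 => h3 | 4 => h4 | 5 => h5 | 6 => h6 | 7 => h7

/-! ### Induction over straight circuits -/

section Induction

variable {P : (ZMod (2 * 4) → V) → Prop} (hrot : ∀ w, P w → P fun i => w (i + 1))
  (hroot : ∀ w w', Γ.IsStraightCircuit 4 w → P w → Γ.IsStraightCircuit 4 w' → w' 0 = w 0 →
    w' 1 = w 1 → w' 2 = w 2 → w' 3 = w 3 → w' 4 = w 4 → P w')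
include hrot

omit hΓ in
theorem induction_rotate (k : ZMod (2 * 4)) : ∀ w, P w → P fun i => w (i + k) := by
  obtain ⟨n, rfl⟩ : ∃ n : ℕ, (n : ZMod (2 * 4)) = k := ⟨k.val, ZMod.natCast_zmod_val k⟩
  induction n with
  | zero => simp
  | succ n ih =>
    intro w hw
    have := hrot _ (ih w hw)
    convert this using 3
    push_cast
    ring

include hroot

theorem induction_fwd {w : ZMod (2 * 4) → V} (hw : Γ.IsStraightCircuit 4 w) (hP : P w)
    (k : ZMod (2 * 4)) {u : V} (hu : Γ.opp (w (k + 4)) (w (k + 3)) u) :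
    ∃ w', Γ.IsStraightCircuit 4 w' ∧ P w' ∧ w' k = w k ∧ w' (k + 1) = w (k + 1) ∧
      w' (k + 2) = w (k + 2) ∧ w' (k + 3) = w (k + 3) ∧ w' (k + 4) = w (k + 4) ∧
      w' (k + 5) = u := by
  obtain ⟨w', hw', h0, h1, h2, h3, h4, h5⟩ := hΓ.exists_circuit_fwd hw k hu
  refine ⟨w', hw', ?_, h0, h1, h2, h3, h4, h5⟩
  have := hroot _ _ (hw.rotate k) (induction_rotate hrot k w hP) (hw'.rotate k)
    (by simpa using h0) (by simpa [add_comm] using h1) (by simpa [add_comm] using h2)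
    (by simpa [add_comm] using h3) (by simpa [add_comm] using h4)
  simpa using induction_rotate hrot (-k) _ this

theorem induction_bwd {w : ZMod (2 * 4) → V} (hw : Γ.IsStraightCircuit 4 w) (hP : P w)
    (k : ZMod (2 * 4)) {u : V} (hu : Γ.opp (w k) (w (k + 1)) u) :
    ∃ w', Γ.IsStraightCircuit 4 w' ∧ P w' ∧ w' k = w k ∧ w' (k + 1) = w (k + 1) ∧
      w' (k + 2) = w (k + 2) ∧ w' (k + 3) = w (k + 3) ∧ w' (k + 4) = w (k + 4) ∧
      w' (k + 7) = u := by
  obtain ⟨w', hw', h0, h1, h2, h3, h4, h5⟩ := hΓ.exists_circuit_bwd hw k hu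
  refine ⟨w', hw', ?_, h0, h1, h2, h3, h4, h5⟩
  have := hroot _ _ (hw.rotate k) (induction_rotate hrot k w hP) (hw'.rotate k)
    (by simpa using h0) (by simpa [add_comm] using h1) (by simpa [add_comm] using h2)
    (by simpa [add_comm] using h3) (by simpa [add_comm] using h4)
  simpa using induction_rotate hrot (-k) _ this

/-- A common opposite `z` of `w 1` and `y` at `w 0` mediates between them. The circuit is first
changed so that `z` precedes `w 0`; then the root that arrives at `w 0` through `z` can be continued
by `y`. -/
theorem induction_adj {w : ZMod (2 * 4) → V} (hw : Γ.IsStraightCircuit 4 w) (hP : P w) {y : V}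
    (hy : Γ.graph.Adj (w 0) y) : ∃ w', Γ.IsStraightCircuit 4 w' ∧ P w' ∧ w' 0 = w 0 ∧ w' 1 = y := by
  obtain ⟨z, -, hz1, hz2⟩ := hΓ.exists_opp (hw.2.1 0) hy
  obtain ⟨w1, hw1, hP1, h0, -, -, -, -, h7⟩ :=
    hΓ.induction_bwd hrot hroot hw hP 0 (hΓ.symm _ _ _ hz1)
  obtain ⟨w2, hw2, hP2, -, -, -, -, e4, e5⟩ :=
    hΓ.induction_fwd hrot hroot hw1 hP1 4 (u := y) (by
      change Γ.opp (w1 0) (w1 7) y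
      rw [h0]
      change w1 7 = z at h7
      rwa [h7])
  exact ⟨w2, hw2, hP2, (e4 : w2 0 = w1 0).trans h0, e5⟩

/-- Since the graph is connected, `induction_adj` can be applied along a walk. -/
theorem induction_vertex {w : ZMod (2 * 4) → V} (hw : Γ.IsStraightCircuit 4 w) (hP : P w) (v : V) :
    ∃ w', Γ.IsStraightCircuit 4 w' ∧ P w' ∧ w' 0 = v := by
  obtain ⟨p⟩ := hΓ.connected.preconnected (w 0) v
  have key : ∀ a b (p : Γ.graph.Walk a b), (∃ w', Γ.IsStraightCircuit 4 w' ∧ P w' ∧ w' 0 = a) →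
      ∃ w', Γ.IsStraightCircuit 4 w' ∧ P w' ∧ w' 0 = b := by
    intro a b p
    induction p with
    | nil => exact id
    | cons h p ih =>
      rintro ⟨w', hw', hP', rfl⟩
      obtain ⟨w2, hw2, hP2, -, h1⟩ := hΓ.induction_adj hrot hroot hw' hP' h
      exact ih ⟨_, hw2.rotate 1, hrot _ hP2, h1⟩
  exact key _ _ p ⟨w, hw, hP, rfl⟩

/-- A property of circuits that is invariant under renumbering and under replacing a circuit by one
that shares a root with it holds for all circuits. -/
theorem induction_circuit {w c : ZMod (2 * 4) → V} (hw : Γ.IsStraightCircuit 4 w) (hP : P w)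
    (hc : Γ.IsStraightCircuit 4 c) : P c := by
  -- The circuit is adjusted to `c` vertex by vertex. After places 0 and 1, the roots that end at
  -- places 1, 2, 3, 4 are continued by the vertices of `c` at places 2, 3, 4, 5; a move keeps its
  -- whole root, hence all places already adjusted. Agreement at places 0 to 5 is enough.
  obtain ⟨w0, hw0, hP0, h0⟩ := hΓ.induction_vertex hrot hroot hw hP (c 0)
  obtain ⟨w1, hw1, hP1, h10, h11⟩ := hΓ.induction_adj hrot hroot hw0 hP0 (y := c 1)
    (by rw [h0]; exact hc.2.1 0)
  rw [h0] at h10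
  obtain ⟨w2, hw2, hP2, -, -, -, h20, h21, h22⟩ := hΓ.induction_fwd hrot hroot hw1 hP1 5 (u := c 2)
    (by
      change Γ.opp (w1 1) (w1 0) (c 2)
      rw [h10, h11]
      exact hc.2.2 1)
  replace h20 : w2 0 = c 0 := h20.trans h10
  replace h21 : w2 1 = c 1 := h21.trans h11
  replace h22 : w2 2 = c 2 := h22
  obtain ⟨w3, hw3, hP3, -, -, h30, h31, h32, h33⟩ := hΓ.induction_fwd hrot hroot hw2 hP2 6
    (u := c 3) (by
      change Γ.opp (w2 2) (w2 1) (c 3)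
      rw [h21, h22]
      exact hc.2.2 2)
  replace h30 : w3 0 = c 0 := h30.trans h20
  replace h31 : w3 1 = c 1 := h31.trans h21
  replace h32 : w3 2 = c 2 := h32.trans h22
  replace h33 : w3 3 = c 3 := h33
  obtain ⟨w4, hw4, hP4, -, h40, h41, h42, h43, h44⟩ := hΓ.induction_fwd hrot hroot hw3 hP3 7
    (u := c 4) (by
      change Γ.opp (w3 3) (w3 2) (c 4)
      rw [h32, h33]
      exact hc.2.2 3)
  replace h40 : w4 0 = c 0 := h40.trans h30
  replace h41 : w4 1 = c 1 := h41.trans h31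
  replace h42 : w4 2 = c 2 := h42.trans h32
  replace h43 : w4 3 = c 3 := h43.trans h33
  replace h44 : w4 4 = c 4 := h44
  obtain ⟨w5, hw5, hP5, h50, h51, h52, h53, h54, h55⟩ := hΓ.induction_fwd hrot hroot hw4 hP4 0
    (u := c 5) (by
      change Γ.opp (w4 4) (w4 3) (c 5)
      rw [h43, h44]
      exact hc.2.2 4)
  have := hΓ.circuit_ext hc hw5 (h50.trans h40) (h51.trans h41) (h52.trans h42) (h53.trans h43)
    (h54.trans h44) h55
  rwa [← this]

end Induction

end IsVeldkampPolygon

end OppGraph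

end TitsQuad

namespace TitsQuad

open MulOpposite

namespace OppGraph

variable {V : Type*} {Γ : OppGraph V}

/-! ## Root groups of Veldkamp quadrangles -/

/-- All neighbours of `v` are fixed by `g`. -/
def FixesNeighbours (Γ : OppGraph V) (g : (Equiv.Perm V)ᵐᵒᵖ) (v : V) : Prop :=
  ∀ u, Γ.graph.Adj v u → unop g u = u

namespace IsVeldkampPolygon

variable (hΓ : Γ.IsVeldkampPolygon 4) {g : (Equiv.Perm V)ᵐᵒᵖ} (hg : g ∈ Γ.Aut)
include hΓ hg

theorem fixes_interpolate {w : ZMod (2 * 4) → V} (hw : Γ.IsStraightCircuit 4 w)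
    {k : ZMod (2 * 4)} (h0 : unop g (w k) = w k) (h3 : unop g (w (k + 3)) = w (k + 3)) :
    unop g (w (k + 1)) = w (k + 1) ∧ unop g (w (k + 2)) = w (k + 2) :=
  hΓ.circuit_interpolate hw (hw.map hg) h0 h3

theorem fixes_circuit {w : ZMod (2 * 4) → V} (hw : Γ.IsStraightCircuit 4 w)
    (h0 : unop g (w 0) = w 0) (h1 : unop g (w 1) = w 1) (h2 : unop g (w 2) = w 2)
    (h3 : unop g (w 3) = w 3) (h4 : unop g (w 4) = w 4) (h5 : unop g (w 5) = w 5) (i) :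
    unop g (w i) = w i :=
  congrFun (hΓ.circuit_ext hw (hw.map hg) h0 h1 h2 h3 h4 h5) i

/-- Every neighbour `u` of `w 4` lies on a straight path from `w 0` to `w 4`; two circuit moves,
through a common opposite of `w 3` and `u`, produce it. The neighbour of `w 0` on that path is
fixed, and together with `w 4` it determines `u`, as the two are the ends of a straight 3-path
through `u`. -/
theorem fixesNeighbours_opposite_zero {w : ZMod (2 * 4) → V} (hw : Γ.IsStraightCircuit 4 w)
    (h4 : unop g (w 4) = w 4) (hf : Γ.FixesNeighbours g (w 0)) : Γ.FixesNeighbours g (w 4) := by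
  intro u hu
  obtain ⟨v, -, hv1, hv2⟩ := hΓ.exists_opp (hw.2.1 3).symm hu
  obtain ⟨c, hc, h0, -, -, -, c4, c5⟩ := hΓ.exists_circuit_fwd hw 0 (hΓ.symm _ _ _ hv1)
  obtain ⟨d, hd, d0, -, -, -, d4, d5⟩ := hΓ.exists_circuit_fwd
    (hc.reflect hΓ.toIsVeldkampGraph 0) 0 (u := u) (by
      change c 4 = w 4 at c4
      change c 5 = v at c5
      change Γ.opp (c 4) (c 5) u
      rwa [c4, c5])
  replace d0 : d 0 = w 0 := d0.trans h0
  replace d4 : d 4 = w 4 := d4.trans c4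
  have h7 : unop g (d 7) = d 7 := hf _ (by rw [← d0]; exact (hd.2.1 7).symm)
  have := (hΓ.fixes_interpolate hg hd (k := 4) (by rw [d4, h4]) h7).1
  change unop g (d 5) = d 5 at this
  replace d5 : d 5 = u := d5
  rwa [d5] at this

theorem fixesNeighbours_opposite {w : ZMod (2 * 4) → V} (hw : Γ.IsStraightCircuit 4 w)
    (k : ZMod (2 * 4)) (h4 : unop g (w (k + 4)) = w (k + 4)) (hf : Γ.FixesNeighbours g (w k)) :
    Γ.FixesNeighbours g (w (k + 4)) := by
  have := hΓ.fixesNeighbours_opposite_zero hg (hw.rotate k) (by simpa [add_comm] using h4)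
    (by simpa using hf)
  simpa [add_comm] using this

/-- Passing to opposite vertices settles all places but 0 and 4, which are opposite each other. They
are reached by a detour: for a common opposite `y` of `w 4` and `w 6` at `w 5`, the circuits `c`
(through `w 1`, …, `w 5`, `y`) and `d` (through `y`, `w 5`, `w 6`, `w 7`, `w 0`, `w 1`) share the
straight path from `y` to `w 1`, so `c 0 = d 2`. Now `y` is opposite `w 2` in `c` and opposite `w 0`
in `d`, while `c 0` is opposite `w 6` in `d` and opposite `w 4` in `c`. -/
theorem fixesNeighbours_of_root {w : ZMod (2 * 4) → V} (hw : Γ.IsStraightCircuit 4 w)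
    (hfix : ∀ i, unop g (w i) = w i) (h1 : Γ.FixesNeighbours g (w 1))
    (h2 : Γ.FixesNeighbours g (w 2)) (h3 : Γ.FixesNeighbours g (w 3)) (i) :
    Γ.FixesNeighbours g (w i) := by
  have opp := fun k => hΓ.fixesNeighbours_opposite hg hw k (hfix _)
  have h5 : Γ.FixesNeighbours g (w 5) := opp 1 h1
  have h6 : Γ.FixesNeighbours g (w 6) := opp 2 h2
  have h7 : Γ.FixesNeighbours g (w 7) := opp 3 h3
  obtain ⟨y, hy, hy4, hy6⟩ := hΓ.exists_opp (hw.2.1 4).symm (hw.2.1 5)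
  have fy := h5 y hy
  obtain ⟨c, hc, c1, c2, c3, c4, c5, c6⟩ :=
    hΓ.exists_circuit_fwd hw 1 (hΓ.symm _ _ _ hy4)
  obtain ⟨d, hd, d5, d6, d7, d0, d1, d4⟩ :=
    hΓ.exists_circuit_bwd hw 5 (hΓ.symm _ _ _ hy6)
  replace c1 : c 1 = w 1 := c1
  replace c2 : c 2 = w 2 := c2
  replace c4 : c 4 = w 4 := c4
  replace c6 : c 6 = y := c6
  replace d0 : d 0 = w 0 := d0
  replace d1 : d 1 = w 1 := d1
  replace d6 : d 6 = w 6 := d6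
  replace d4 : d 4 = y := d4
  obtain ⟨-, e⟩ := hΓ.circuit_interpolate (hd.reflect hΓ.toIsVeldkampGraph 2) hc (k := 6) (k' := 6)
    (c6.trans d4.symm) (c1.trans d1.symm)
  replace e : c 0 = d 2 := e
  obtain ⟨-, f0⟩ := hΓ.fixes_interpolate hg hc (k := 6) (by rw [c6, fy]) (by
    change unop g (c 1) = c 1
    rw [c1, hfix])
  replace f0 : unop g (c 0) = c 0 := f0
  have k6 : Γ.FixesNeighbours g (c 6) :=
    hΓ.fixesNeighbours_opposite hg hc 2 (by change unop g (c 6) = c 6; rw [c6, fy]) (by rwa [c2])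
  have k2 : Γ.FixesNeighbours g (d 2) :=
    hΓ.fixesNeighbours_opposite hg hd 6 (by change unop g (d 2) = d 2; rwa [← e]) (by rwa [d6])
  have k4 : Γ.FixesNeighbours g (w 4) := by
    rw [← c4]
    exact hΓ.fixesNeighbours_opposite hg hc 0 (by change unop g (c 4) = c 4; rw [c4, hfix])
      (by rwa [e])
  have k0 : Γ.FixesNeighbours g (w 0) := by
    rw [← d0]
    exact hΓ.fixesNeighbours_opposite hg hd 4 (by change unop g (d 0) = d 0; rw [d0, hfix])
      (by rwa [d4, ← c6])
  revert i
  exact fun | 0 => k0 | 1 => h1 | 2 => h2 | 3 => h3 | 4 => k4 | 5 => h5 | 6 => h6 | 7 => h7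

/-- An automorphism that fixes a straight circuit and all neighbours of three consecutive
vertices of it is trivial. -/
theorem eq_one_of_fixes {w : ZMod (2 * 4) → V} (hw : Γ.IsStraightCircuit 4 w)
    (hfix : ∀ i, unop g (w i) = w i) (h1 : Γ.FixesNeighbours g (w 1))
    (h2 : Γ.FixesNeighbours g (w 2)) (h3 : Γ.FixesNeighbours g (w 3)) : g = 1 := by
  apply unop_injective
  ext v
  -- The property carried from circuit to circuit is that all vertices and all their neighbours are
  -- fixed. It survives a change outside the root at places 0 to 4: place 5 is a neighbour of place
  -- 4, six fixed vertices fix the circuit, and places 5, 6, 7 are opposite places 1, 2, 3.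
  obtain ⟨c, -, hc, rfl⟩ := hΓ.induction_vertex
    (P := fun w => ∀ i, unop g (w i) = w i ∧ Γ.FixesNeighbours g (w i))
    (fun w h i => h _)
    (by
      rintro w w' - h hw' e0 e1 e2 e3 e4
      have f5 : unop g (w' 5) = w' 5 := (h 4).2 _ (by rw [← e4]; exact hw'.2.1 4)
      have fix := hΓ.fixes_circuit hg hw' (by rw [e0, (h 0).1]) (by rw [e1, (h 1).1])
        (by rw [e2, (h 2).1]) (by rw [e3, (h 3).1]) (by rw [e4, (h 4).1]) f5
      refine fun i => ⟨fix i, ?_⟩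
      revert i
      exact fun
        | 0 => by rw [e0]; exact (h 0).2
        | 1 => by rw [e1]; exact (h 1).2
        | 2 => by rw [e2]; exact (h 2).2
        | 3 => by rw [e3]; exact (h 3).2
        | 4 => by rw [e4]; exact (h 4).2
        | 5 => hΓ.fixesNeighbours_opposite hg hw' 1 (fix _) (by rw [e1]; exact (h 1).2)
        | 6 => hΓ.fixesNeighbours_opposite hg hw' 2 (fix _) (by rw [e2]; exact (h 2).2)
        | 7 => hΓ.fixesNeighbours_opposite hg hw' 3 (fix _) (by rw [e3]; exact (h 3).2))
    hw (fun i => ⟨hfix i, hΓ.fixesNeighbours_of_root hg hw hfix h1 h2 h3 i⟩) v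
  exact (hc 0).1

end IsVeldkampPolygon

theorem mem_labelling {w : ZMod (2 * 4) → V} {i : ZMod (2 * 4)} {g : (Equiv.Perm V)ᵐᵒᵖ} :
    g ∈ Γ.labelling 4 w i ↔ g ∈ Γ.Aut ∧ Γ.FixesNeighbours g (w (i + 1)) ∧
      Γ.FixesNeighbours g (w (i + 2)) ∧ Γ.FixesNeighbours g (w (i + 3)) := by
  refine ⟨fun h => ⟨h.1, ?_, ?_, ?_⟩, fun h => ⟨h.1, fun j h1 h2 => ?_⟩⟩
  · simpa [FixesNeighbours] using h.2 1 (by norm_num) (by norm_num)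
  · simpa [FixesNeighbours] using h.2 2 (by norm_num) (by norm_num)
  · simpa [FixesNeighbours] using h.2 3 (by norm_num) (by norm_num)
  · obtain rfl | rfl | rfl : j = 1 ∨ j = 2 ∨ j = 3 := by omega
    · simpa [FixesNeighbours] using h.2.1
    · simpa [FixesNeighbours] using h.2.2.1
    · simpa [FixesNeighbours] using h.2.2.2

namespace IsVeldkampPolygon

/-- Membership in the root group already fixes the five vertices of the root, and a sixth one fixes
the whole circuit. This freeness identifies root groups and proves commutators trivial. -/
theorem eq_one_of_mem_labelling (hΓ : Γ.IsVeldkampPolygon 4) {g : (Equiv.Perm V)ᵐᵒᵖ}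
    {w : ZMod (2 * 4) → V} (hw : Γ.IsStraightCircuit 4 w) {i : ZMod (2 * 4)}
    (hg : g ∈ Γ.labelling 4 w i) (h5 : unop g (w (i + 5)) = w (i + 5)) : g = 1 := by
  obtain ⟨hg, h1, h2, h3⟩ := mem_labelling.1 hg
  have hw' := hw.rotate i
  simp only [add_comm i] at h1 h2 h3 h5
  refine hΓ.eq_one_of_fixes hg hw' (hΓ.fixes_circuit hg hw' ?_ ?_ ?_ ?_ ?_ h5) h1 h2 h3
  · exact h1 _ (hw'.2.1 0).symm
  · exact h2 _ (hw'.2.1 1).symm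
  · exact h1 _ (hw'.2.1 1)
  · exact h2 _ (hw'.2.1 2)
  · exact h3 _ (hw'.2.1 3)

/-- At w_{i+1} the element `g` fixes all neighbours and `h` permutes them, so the commutator fixes
them; at w_{i+4} the roles are exchanged; at w_{i+2} and w_{i+3} both elements act trivially. So the
commutator lies in U_i and fixes w_{i+5}, a neighbour of w_{i+4}. -/
theorem comm_eq_one (hΓ : Γ.IsVeldkampPolygon 4) {w : ZMod (2 * 4) → V}
    (hw : Γ.IsStraightCircuit 4 w) (i : ZMod (2 * 4)) (g : (Equiv.Perm V)ᵐᵒᵖ)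
    (hg : g ∈ Γ.labelling 4 w i) (h : (Equiv.Perm V)ᵐᵒᵖ) (hh : h ∈ Γ.labelling 4 w (i + 1)) :
    comm g h = 1 := by
  obtain ⟨ga, g1, g2, g3⟩ := mem_labelling.1 hg
  obtain ⟨ha, h2, h3, h4⟩ := mem_labelling.1 hh
  rw [add_assoc] at h2 h3 h4
  norm_num at h2 h3 h4
  have fix_inv : ∀ {k : (Equiv.Perm V)ᵐᵒᵖ} {v}, unop k v = v → unop k⁻¹ v = v := by
    intro k v e
    rw [unop_inv, Equiv.Perm.inv_eq_iff_eq, e]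
  have comm_apply : ∀ v, unop (comm g h) v = unop h (unop g (unop h⁻¹ (unop g⁻¹ v))) := fun _ => rfl
  have inv_apply : ∀ (k : (Equiv.Perm V)ᵐᵒᵖ) v, unop k (unop k⁻¹ v) = v := fun k v =>
    (unop k).apply_symm_apply v
  have f1 : Γ.FixesNeighbours (comm g h) (w (i + 1)) := by
    intro u hu
    have e1 : unop h (w (i + 1)) = w (i + 1) := h2 _ (by
      have := (hw.2.1 (i + 1)).symm
      rwa [add_assoc, one_add_one_eq_two] at this)
    rw [comm_apply, fix_inv (g1 u hu), g1, inv_apply]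
    rw [← fix_inv e1]
    exact ((inv_mem ha).1 _ _).2 hu
  have f4 : Γ.FixesNeighbours (comm g h) (w (i + 4)) := by
    intro u hu
    have e1 : unop g (w (i + 4)) = w (i + 4) := g3 _ (by
      have := hw.2.1 (i + 3)
      rw [add_assoc] at this
      norm_num at this
      exact this)
    rw [comm_apply, fix_inv (h4 _ _), inv_apply, h4 u hu]
    rw [← fix_inv e1]
    exact ((inv_mem ga).1 _ _).2 hu
  refine hΓ.eq_one_of_mem_labelling hw (i := i) (mem_labelling.2 ⟨?_, f1, ?_, ?_⟩) (f4 _ ?_)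
  · exact mul_mem (mul_mem (mul_mem (inv_mem ga) (inv_mem ha)) ga) ha
  · intro u hu
    rw [comm_apply, fix_inv (g2 u hu), fix_inv (h2 u hu), g2 u hu, h2 u hu]
  · intro u hu
    rw [comm_apply, fix_inv (g3 u hu), fix_inv (h3 u hu), g3 u hu, h3 u hu]
  · have := hw.2.1 (i + 4)
    rw [add_assoc] at this
    norm_num at this
    exact this

end IsVeldkampPolygon

end OppGraph

end TitsQuad

namespace TitsQuad

open MulOpposite

namespace OppGraph

variable {V : Type*} {Γ : OppGraph V}

/-! ## Transitivity of root groups -/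

/-- The root group of `(w 0, …, w 4)` is transitive on the vertices opposite `w 3` at `w 4`. -/
def RootTransitive (Γ : OppGraph V) (w : ZMod (2 * 4) → V) : Prop :=
  ∀ u, Γ.opp (w 4) (w 3) u → ∃ g ∈ Γ.labelling 4 w 0, unop g (w 5) = u

theorem unop_apply_inv_apply (g : (Equiv.Perm V)ᵐᵒᵖ) (v : V) : unop g (unop g⁻¹ v) = v :=
  (unop g).apply_symm_apply v

theorem unop_inv_apply_apply (g : (Equiv.Perm V)ᵐᵒᵖ) (v : V) : unop g⁻¹ (unop g v) = v :=
  (unop g).symm_apply_apply v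

theorem fixesNeighbours_conj {g h : (Equiv.Perm V)ᵐᵒᵖ} (hg : g ∈ Γ.Aut) {v : V} :
    Γ.FixesNeighbours (g⁻¹ * h * g) (unop g v) ↔ Γ.FixesNeighbours h v := by
  have e : ∀ u, unop (g⁻¹ * h * g) (unop g u) = unop g (unop h u) := fun u => by
    change unop g (unop h (unop g⁻¹ (unop g u))) = _
    rw [unop_inv_apply_apply]
  constructor
  · intro H u hu
    have := H _ ((hg.1 _ _).2 hu)
    rw [e] at this
    exact (unop g).injective this
  · intro H u hu
    have := H (unop g⁻¹ u) (by
      rw [← hg.1, unop_apply_inv_apply]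
      exact hu)
    rw [← unop_apply_inv_apply g u, e, this]

theorem conj_mem_labelling {g h : (Equiv.Perm V)ᵐᵒᵖ} (hg : g ∈ Γ.Aut) {w : ZMod (2 * 4) → V}
    {i : ZMod (2 * 4)} :
    g⁻¹ * h * g ∈ Γ.labelling 4 (fun i => unop g (w i)) i ↔ h ∈ Γ.labelling 4 w i := by
  rw [mem_labelling, mem_labelling, fixesNeighbours_conj hg, fixesNeighbours_conj hg,
    fixesNeighbours_conj hg]
  refine and_congr_left fun _ => ⟨fun H => ?_, fun H => mul_mem (mul_mem (inv_mem hg) H) hg⟩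
  have := mul_mem (mul_mem hg H) (inv_mem hg)
  simpa [mul_assoc] using this

theorem labelling_map {g : (Equiv.Perm V)ᵐᵒᵖ} (hg : g ∈ Γ.Aut) (w : ZMod (2 * 4) → V)
    (i : ZMod (2 * 4)) : Γ.labelling 4 (fun i => unop g (w i)) i =
      (Γ.labelling 4 w i).map (MulAut.conj g⁻¹ : _ ≃* _).toMonoidHom := by
  ext h
  rw [Subgroup.mem_map]
  constructor
  · intro H
    refine ⟨g * h * g⁻¹, ?_, by simp [mul_assoc]⟩
    rw [← conj_mem_labelling hg]
    simpa [mul_assoc] using H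
  · rintro ⟨k, hk, rfl⟩
    simpa [mul_assoc] using (conj_mem_labelling hg).2 hk

theorem RootTransitive.map {w : ZMod (2 * 4) → V} (h : Γ.RootTransitive w)
    {g : (Equiv.Perm V)ᵐᵒᵖ} (hg : g ∈ Γ.Aut) : Γ.RootTransitive fun i => unop g (w i) := by
  intro u hu
  obtain ⟨k, hk, e⟩ := h (unop g⁻¹ u) (by
    rw [← hg.2, unop_apply_inv_apply]
    exact hu)
  refine ⟨g⁻¹ * k * g, (conj_mem_labelling hg).2 hk, ?_⟩
  change unop g (unop k (unop g⁻¹ (unop g (w 5)))) = u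
  rw [unop_inv_apply_apply, e, unop_apply_inv_apply]

/-- `c` is the image of a renumbering of `w` under an automorphism. -/
def Equivalent (Γ : OppGraph V) (w c : ZMod (2 * 4) → V) : Prop :=
  ∃ g ∈ Γ.Aut, ∃ k, (∀ i, c i = unop g (w (i + k))) ∨ ∀ i, c i = unop g (w (k - i))

/-! ### Straight circuits up to automorphisms -/

section Transitivity

variable {w : ZMod (2 * 4) → V}
  {r : (Equiv.Perm V)ᵐᵒᵖ} (hr : r ∈ Γ.Aut) (hrw : ∀ i, unop r (w i) = w (i + 2))
  {s : (Equiv.Perm V)ᵐᵒᵖ} (hs : s ∈ Γ.Aut) (hsw : ∀ i, unop s (w i) = w (-i))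

include hr hrw in
theorem exists_aut_rotate (k : ZMod (2 * 4)) : ∃ g ∈ Γ.Aut, ∀ i, unop g (w i) = w (i + 2 * k) := by
  obtain ⟨n, rfl⟩ : ∃ n : ℕ, (n : ZMod (2 * 4)) = k := ⟨k.val, ZMod.natCast_zmod_val k⟩
  induction n with
  | zero => exact ⟨1, one_mem _, by simp⟩
  | succ n ih =>
    obtain ⟨g, hg, h⟩ := ih
    refine ⟨r * g, mul_mem hr hg, fun i => ?_⟩
    change unop g (unop r (w i)) = _
    rw [hrw, h]
    congr 1
    push_cast
    ring

theorem exists_eq_two_mul (k : ZMod (2 * 4)) : (∃ m, k = 2 * m) ∨ ∃ m, k = 1 + 2 * m :=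
  (by decide : ∀ k : ZMod (2 * 4), (∃ m, k = 2 * m) ∨ ∃ m, k = 1 + 2 * m) k

include hr hrw

/-- Rotations by an even number of places are induced by automorphisms, so one root of each parity
represents all ascending roots of the circuit. -/
theorem rootTransitive_rotate (h1 : Γ.RootTransitive fun i => w (i + 1))
    (h2 : Γ.RootTransitive fun i => w (i + 2)) (k : ZMod (2 * 4)) :
    Γ.RootTransitive fun i => w (i + k) := by
  obtain ⟨m, rfl⟩ | ⟨m, rfl⟩ := exists_eq_two_mul k
  · obtain ⟨g, hg, h⟩ := exists_aut_rotate hr hrw (m - 1)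
    convert h2.map hg using 2
    rw [h]
    congr 1
    ring
  · obtain ⟨g, hg, h⟩ := exists_aut_rotate hr hrw m
    convert h1.map hg using 2
    rw [h]
    congr 1
    ring

include hs hsw

theorem Equivalent.rootTransitive (h1 : Γ.RootTransitive fun i => w (i + 1))
    (h2 : Γ.RootTransitive fun i => w (i + 2)) {c : ZMod (2 * 4) → V} (hc : Γ.Equivalent w c) :
    Γ.RootTransitive c := by
  obtain ⟨g, hg, k, h | h⟩ := hc
  · rw [funext h]
    exact (rootTransitive_rotate hr hrw h1 h2 k).map hg
  · rw [funext h]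
    refine RootTransitive.map (w := fun i => w (k - i)) ?_ hg
    convert (rootTransitive_rotate hr hrw h1 h2 (-k)).map hs using 2
    rw [hsw]
    congr 1
    ring

/-- If `c'` shares the root at places 0 to 4 with `c`, transitivity of the root group of that root
gives an element that carries `c 5` to `c' 5`. It fixes the root, so it carries `c` to `c'`, since
six vertices determine a circuit. -/
theorem IsVeldkampPolygon.equivalent (hΓ : Γ.IsVeldkampPolygon 4) (hw : Γ.IsStraightCircuit 4 w)
    (h1 : Γ.RootTransitive fun i => w (i + 1)) (h2 : Γ.RootTransitive fun i => w (i + 2))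
    {c : ZMod (2 * 4) → V} (hc : Γ.IsStraightCircuit 4 c) : Γ.Equivalent w c := by
  refine hΓ.induction_circuit (P := Γ.Equivalent w) ?_ ?_ hw
    ⟨1, one_mem _, 0, .inl fun i => by simp⟩ hc
  · rintro c ⟨g, hg, k, h | h⟩
    · exact ⟨g, hg, k + 1, .inl fun i => (h _).trans (by rw [add_assoc, add_comm 1])⟩
    · exact ⟨g, hg, k - 1, .inr fun i => (h _).trans (by congr 2; ring)⟩
  · intro c c' hc hP hc' e0 e1 e2 e3 e4
    obtain ⟨a, ha, h5⟩ := hP.rootTransitive hr hrw hs hsw h1 h2 (c' 5) (by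
      rw [← e3, ← e4]
      exact hc'.2.2 4)
    obtain ⟨ha, a1, a2, a3⟩ := mem_labelling.1 ha
    have e := hΓ.circuit_ext (hc.map ha) hc' (e0.trans (a1 _ (hc.2.1 0).symm).symm)
      (e1.trans (a2 _ (hc.2.1 1).symm).symm) (e2.trans (a1 _ (hc.2.1 1)).symm)
      (e3.trans (a2 _ (hc.2.1 2)).symm) (e4.trans (a3 _ (hc.2.1 3)).symm) h5.symm
    rw [e]
    obtain ⟨g, hg, k, h | h⟩ := hP
    · exact ⟨g * a, mul_mem hg ha, k, .inl fun i => congrArg (fun v => unop a v) (h i)⟩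
    · exact ⟨g * a, mul_mem hg ha, k, .inr fun i => congrArg (fun v => unop a v) (h i)⟩

/-- The Moufang condition follows from its special case for two roots of a circuit, if sufficiently
many symmetries of that circuit are induced by automorphisms. -/
theorem IsVeldkampPolygon.isMoufang (hΓ : Γ.IsVeldkampPolygon 4) (hw : Γ.IsStraightCircuit 4 w)
    (h1 : Γ.RootTransitive fun i => w (i + 1)) (h2 : Γ.RootTransitive fun i => w (i + 2)) :
    Γ.IsMoufang 4 := by
  intro x hx u v hu hv
  -- Any root, continued by `u`, lies in a circuit, and every circuit is equivalent to `w` and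
  -- inherits its transitivity.
  obtain ⟨c, hc, h⟩ := hΓ.exists_circuit (fun i => if i = 5 then u else x i)
    (hΓ.toIsVeldkampGraph.isStraightPath (fun i hi => by
      rcases Nat.lt_or_ge i 4 with h | h
      · rw [if_neg (by omega), if_neg (by omega)]
        exact hx.1.1 i h
      · obtain rfl : i = 4 := by omega
        simpa using (Γ.opp_adj hu).2)
      (fun i hi => by
        rcases Nat.lt_or_ge i 3 with h | h
        · rw [if_neg (by omega), if_neg (by omega), if_neg (by omega)]
          exact hx.2 i (by omega)
        · obtain rfl : i = 3 := by omega
          simpa using hu))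
  have c1 : c 1 = x 1 := by simpa using h 1
  have c2 : c 2 = x 2 := by simpa using h 2
  have c3 : c 3 = x 3 := by simpa using h 3
  have c4 : c 4 = x 4 := by simpa using h 4
  have c5 : c 5 = u := by simpa using h 5
  obtain ⟨g, hg, hgv⟩ := (hΓ.equivalent hr hrw hs hsw hw h1 h2 hc).rootTransitive hr hrw hs hsw
    h1 h2 v (by rw [c4, c3]; exact hv)
  refine ⟨g, ⟨hg.1, fun i hi hi' => ?_⟩, by rw [← c5, hgv]⟩
  obtain ⟨-, a1, a2, a3⟩ := mem_labelling.1 hg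
  obtain rfl | rfl | rfl : i = 1 ∨ i = 2 ∨ i = 3 := by omega
  · rw [← c1]; exact a1
  · rw [← c2]; exact a2
  · rw [← c3]; exact a3

/-- The automorphisms `r` and `s` induce on the circuit all its symmetries i ↦ ±i + k with k even. A
numbering of `c` that differs from that of `w` by an odd k becomes even after i ↦ 1 - i. -/
theorem IsVeldkampPolygon.exists_aut (hΓ : Γ.IsVeldkampPolygon 4) (hw : Γ.IsStraightCircuit 4 w)
    (h1 : Γ.RootTransitive fun i => w (i + 1)) (h2 : Γ.RootTransitive fun i => w (i + 2))
    {c : ZMod (2 * 4) → V} (hc : Γ.IsStraightCircuit 4 c) :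
    (∃ g ∈ Γ.Aut, c = fun i => unop g (w i)) ∨
      ∃ g ∈ Γ.Aut, oppositeCoord 4 c = fun i => unop g (w i) := by
  obtain ⟨g, hg, k, h | h⟩ := hΓ.equivalent hr hrw hs hsw hw h1 h2 hc
  · obtain ⟨m, rfl⟩ | ⟨m, rfl⟩ := exists_eq_two_mul k
    · obtain ⟨a, ha, e⟩ := exists_aut_rotate hr hrw m
      refine .inl ⟨a * g, mul_mem ha hg, funext fun i => ?_⟩
      change _ = unop g (unop a (w i))
      rw [h, e]
    · obtain ⟨a, ha, e⟩ := exists_aut_rotate hr hrw (1 + m)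
      refine .inr ⟨s * a * g, mul_mem (mul_mem hs ha) hg, funext fun i => ?_⟩
      change c (1 - i) = unop g (unop a (unop s (w i)))
      rw [h, hsw, e]
      congr 2
      ring
  · obtain ⟨m, rfl⟩ | ⟨m, rfl⟩ := exists_eq_two_mul k
    · obtain ⟨a, ha, e⟩ := exists_aut_rotate hr hrw m
      refine .inl ⟨s * a * g, mul_mem (mul_mem hs ha) hg, funext fun i => ?_⟩
      change _ = unop g (unop a (unop s (w i)))
      rw [h, hsw, e]
      congr 2
      ring
    · obtain ⟨a, ha, e⟩ := exists_aut_rotate hr hrw m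
      refine .inr ⟨a * g, mul_mem ha hg, funext fun i => ?_⟩
      change c (1 - i) = unop g (unop a (w i))
      rw [h, e]
      congr 2
      ring

end Transitivity

/-- A family of automorphisms parametrized by a group is an isomorphism onto a root group of a
Veldkamp quadrangle if it acts regularly on the appropriate set of vertices. -/
theorem IsVeldkampPolygon.exists_mulEquiv (hΓ : Γ.IsVeldkampPolygon 4) {w : ZMod (2 * 4) → V}
    (hw : Γ.IsStraightCircuit 4 w) (i : ZMod (2 * 4)) {A : Type*} [Group A]
    (x : A →* (Equiv.Perm V)ᵐᵒᵖ) (hx : ∀ a, x a ∈ Γ.labelling 4 w i)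
    (hinj : ∀ a, unop (x a) (w (i + 5)) = w (i + 5) → a = 1)
    (hsurj : ∀ u, Γ.opp (w (i + 4)) (w (i + 3)) u → ∃ a, unop (x a) (w (i + 5)) = u) :
    ∃ e : A ≃* Γ.labelling 4 w i, ∀ a, (e a : (Equiv.Perm V)ᵐᵒᵖ) = x a := by
  refine ⟨MulEquiv.ofBijective (x.codRestrict _ hx) ⟨?_, ?_⟩, fun a => rfl⟩
  · rw [injective_iff_map_eq_one]
    intro a ha
    refine hinj a ?_
    have e : x a = 1 := congrArg Subtype.val ha
    rw [e]
    rfl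
  · rintro ⟨g, hg⟩
    obtain ⟨ga, -, -, g3⟩ := mem_labelling.1 hg
    have hopp : Γ.opp (w (i + 4)) (w (i + 3)) (w (i + 5)) := by
      have := hw.2.2 (i + 4)
      rwa [add_sub_assoc, add_assoc, show (4 : ZMod (2 * 4)) - 1 = 3 from rfl,
        show (4 : ZMod (2 * 4)) + 1 = 5 from rfl] at this
    have hadj : Γ.graph.Adj (w (i + 3)) (w (i + 2)) := by
      have := hw.2.1 (i + 2)
      rw [add_assoc, show (2 : ZMod (2 * 4)) + 1 = 3 from rfl] at this
      exact this.symm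
    have hadj' : Γ.graph.Adj (w (i + 3)) (w (i + 4)) := (Γ.opp_adj hopp).1.symm
    have g3' : unop g (w (i + 3)) = w (i + 3) :=
      (mem_labelling.1 hg).2.2.1 _ hadj.symm
    -- Both `g` and some `x a` send the vertex after the root to the same place, so their quotient
    -- fixes it and is trivial by freeness.
    obtain ⟨a, ha⟩ := hsurj (unop g (w (i + 5))) (by
      have := (ga.2 _ _ _).2 hopp
      rwa [g3', g3 _ hadj'] at this)
    refine ⟨a, Subtype.ext ?_⟩
    change x a = g
    rw [← mul_inv_eq_one]
    refine hΓ.eq_one_of_mem_labelling hw (i := i) (mul_mem (hx a) (inv_mem hg)) ?_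
    change unop g⁻¹ (unop (x a) (w (i + 5))) = _
    rw [ha, unop_inv_apply_apply]

theorem rootTransitive_of_mulEquiv {w : ZMod (2 * 4) → V} {i : ZMod (2 * 4)} {A : Type*}
    {x : A → (Equiv.Perm V)ᵐᵒᵖ} (hx : ∀ a, x a ∈ Γ.labelling 4 w i)
    (hsurj : ∀ u, Γ.opp (w (i + 4)) (w (i + 3)) u → ∃ a, unop (x a) (w (i + 5)) = u) :
    Γ.RootTransitive fun j => w (j + i) := by
  intro u hu
  obtain ⟨a, ha⟩ := hsurj u (by simpa [add_comm] using hu)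
  refine ⟨x a, ?_, by simpa [add_comm] using ha⟩
  have := hx a
  rw [mem_labelling] at this ⊢
  simpa [add_comm] using this

end OppGraph

end TitsQuad

namespace TitsQuad

open MulOpposite

/-! ## The incidence graph of a polar space -/

variable {P : Type*} {𝓛 : Set (Set P)}

/-- Non-degenerate polar spaces with thick lines, in which the lines on a point have opposites and
points and lines are separated by the points collinear with them. -/
structure IsThickPolarSpace (𝓛 : Set (Set P)) : Prop where
  nonempty : Nonempty P
  polar : IsPolarSpace 𝓛
  thick : IsThick 𝓛
  nondegenerate : IsNondegeneratePolar 𝓛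
  linear : ∀ x ∈ 𝓛, ∀ y ∈ 𝓛, ∀ a b, a ≠ b → a ∈ x → b ∈ x → a ∈ y → b ∈ y → x = y
  exists_line : ∀ a : P, ∃ x ∈ 𝓛, a ∈ x
  exists_opp : ∀ a, ∀ x ∈ 𝓛, ∀ y ∈ 𝓛, a ∈ x → a ∈ y → ∃ z ∈ 𝓛, a ∈ z ∧
    (∃ b ∈ z, ∃ c ∈ x, c ∉ perp 𝓛 b) ∧ ∃ b ∈ z, ∃ c ∈ y, c ∉ perp 𝓛 b
  separates_points : ∀ a b : P, a ≠ b → ∃ r ∈ perp 𝓛 a, r ∉ perp 𝓛 b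
  separates_lines : ∀ x ∈ 𝓛, ∀ y ∈ 𝓛, x ≠ y → ∃ a ∈ x, ∃ r, r ∉ perp 𝓛 a ∧ y ⊆ perp 𝓛 r

theorem IsThickPolarSpace.nonempty_lines {𝓛 : Set (Set P)} (h : IsThickPolarSpace 𝓛) :
    𝓛.Nonempty := by
  obtain ⟨a⟩ := h.nonempty
  obtain ⟨x, hx, -⟩ := h.exists_line a
  exact ⟨x, hx⟩

theorem mem_perp_self (a : P) : a ∈ perp 𝓛 a := .inl rfl

theorem mem_perp_comm {a b : P} : b ∈ perp 𝓛 a ↔ a ∈ perp 𝓛 b := by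
  constructor <;>
  · rintro (h | ⟨x, hx, h1, h2⟩)
    · exact .inl h.symm
    · exact .inr ⟨x, hx, h2, h1⟩

theorem mem_perp_of_mem {x : Set P} (hx : x ∈ 𝓛) {a b : P} (ha : a ∈ x) (hb : b ∈ x) :
    b ∈ perp 𝓛 a := .inr ⟨x, hx, ha, hb⟩

theorem exists_line_of_mem_perp {a b : P} (h : b ∈ perp 𝓛 a) (hab : a ≠ b) :
    ∃ x ∈ 𝓛, a ∈ x ∧ b ∈ x := h.resolve_left fun e => hab e.symm

namespace IsPolarSpace

variable (h : IsPolarSpace 𝓛)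
include h

theorem exists_mem_perp (a : P) {x : Set P} (hx : x ∈ 𝓛) : ∃ b ∈ x, b ∈ perp 𝓛 a := by
  rcases h.2 a x hx with h1 | h1
  · obtain ⟨b, hb⟩ := Set.encard_eq_one.1 h1
    have : b ∈ perp 𝓛 a ∩ x := by rw [hb]; rfl
    exact ⟨b, this.2, this.1⟩
  · have h2 := h.1 x hx
    obtain ⟨b, hb⟩ : x.Nonempty := by
      rw [← Set.encard_ne_zero]
      rintro e
      rw [e] at h2
      norm_num at h2
    exact ⟨b, hb, h1 hb⟩

theorem subset_perp {a b c : P} {x : Set P} (hx : x ∈ 𝓛) (hbc : b ≠ c) (hb : b ∈ x) (hc : c ∈ x)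
    (hab : b ∈ perp 𝓛 a) (hac : c ∈ perp 𝓛 a) : x ⊆ perp 𝓛 a := by
  refine (h.2 a x hx).resolve_left fun h1 => hbc ?_
  obtain ⟨d, hd⟩ := Set.encard_eq_one.1 h1
  have e1 : b ∈ perp 𝓛 a ∩ x := ⟨hab, hb⟩
  have e2 : c ∈ perp 𝓛 a ∩ x := ⟨hac, hc⟩
  rw [hd] at e1 e2
  exact e1.trans e2.symm

theorem isSubspace_perp (X : Set P) : IsSubspace 𝓛 {a | ∀ b ∈ X, a ∈ perp 𝓛 b} := by
  intro x hx
  by_cases hs : (x ∩ {a | ∀ b ∈ X, a ∈ perp 𝓛 b}).Subsingleton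
  · exact .inr hs
  · left
    rw [Set.not_subsingleton_iff] at hs
    obtain ⟨a, ha, c, hc, hac⟩ := hs
    exact fun d hd b hb => h.subset_perp hx hac ha.1 hc.1 (ha.2 b hb) (hc.2 b hb) hd

/-- Sets of points collinear with a given set are subspaces. Hence the generated subspace is
collinear with X, and by the same argument once more it is collinear with itself. -/
theorem isSingular_generated {X : Set P} (hX : IsSingular 𝓛 X) :
    IsSingular 𝓛 (generated 𝓛 X) := by
  have h1 : ∀ a ∈ generated 𝓛 X, ∀ b ∈ X, a ∈ perp 𝓛 b := fun a ha =>
    ha _ ⟨h.isSubspace_perp X, fun a ha b hb => hX b hb a ha⟩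
  have h2 : ∀ a ∈ generated 𝓛 X, ∀ b ∈ generated 𝓛 X, a ∈ perp 𝓛 b := fun a ha =>
    ha _ ⟨h.isSubspace_perp _, fun a ha b hb => mem_perp_comm.1 (h1 b hb a ha)⟩
  exact fun a ha b hb => h2 b hb a ha

theorem isSingular_generated_iff {x y : Set P} (hx : x ∈ 𝓛) (hy : y ∈ 𝓛) :
    IsSingular 𝓛 (generated 𝓛 (x ∪ y)) ↔ ∀ a ∈ x, ∀ b ∈ y, b ∈ perp 𝓛 a := by
  constructor
  · intro hs a ha b hb
    exact hs a (fun Y hY => hY.2 (.inl ha)) b (fun Y hY => hY.2 (.inr hb))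
  · intro H
    refine h.isSingular_generated ?_
    rintro a (ha | ha) b (hb | hb)
    · exact mem_perp_of_mem hx ha hb
    · exact H a ha b hb
    · exact mem_perp_comm.1 (H b hb a ha)
    · exact mem_perp_of_mem hy ha hb

theorem opp_point_iff {a : P} {x y : 𝓛} : (incidenceGraph 𝓛).opp (.inl a) (.inr x) (.inr y) ↔
    a ∈ x.1 ∧ a ∈ y.1 ∧ ∃ b ∈ x.1, ∃ c ∈ y.1, c ∉ perp 𝓛 b := by
  change a ∈ x.1 ∧ a ∈ y.1 ∧ ¬ IsSingular 𝓛 (generated 𝓛 (x.1 ∪ y.1)) ↔ _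
  rw [h.isSingular_generated_iff x.2 y.2]
  push Not
  rfl

/-- A single pair of points decides opposition. If `c` is collinear with `b`, then, being collinear
with `a` too, it is collinear with all of `x`; each point of `x` is then collinear with the two
points `a`, `c` of `y`, hence with all of `y`. -/
theorem opp_point_iff_notMem_perp {a b c : P} {x y : 𝓛} (hax : a ∈ x.1) (hay : a ∈ y.1)
    (hb : b ∈ x.1) (hc : c ∈ y.1) (hab : a ≠ b) (hac : a ≠ c) :
    (incidenceGraph 𝓛).opp (.inl a) (.inr x) (.inr y) ↔ c ∉ perp 𝓛 b := by
  rw [h.opp_point_iff]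
  refine ⟨?_, fun hbc => ⟨hax, hay, b, hb, c, hc, hbc⟩⟩
  rintro ⟨-, -, b', hb', c', hc', hn⟩ hbc
  have h1 := h.subset_perp x.2 hab hax hb (mem_perp_of_mem y.2 hc hay) (mem_perp_comm.1 hbc) hb'
  exact hn (h.subset_perp y.2 hac hay hc (mem_perp_of_mem x.2 hb' hax) (mem_perp_comm.1 h1) hc')

end IsPolarSpace

theorem adj_inl_iff {a : P} {v : P ⊕ 𝓛} : (incidenceGraph 𝓛).graph.Adj (.inl a) v ↔
    ∃ x : 𝓛, v = .inr x ∧ a ∈ x.1 := by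
  rcases v with b | y
  · exact ⟨False.elim, by rintro ⟨x, h, -⟩; cases h⟩
  · exact ⟨fun h => ⟨y, rfl, h⟩, by rintro ⟨x, h, h'⟩; cases h; exact h'⟩

theorem adj_inr_iff {x : 𝓛} {v : P ⊕ 𝓛} : (incidenceGraph 𝓛).graph.Adj (.inr x) v ↔
    ∃ a : P, v = .inl a ∧ a ∈ x.1 := by
  rcases v with b | y
  · exact ⟨fun h => ⟨b, rfl, h⟩, by rintro ⟨a, h, h'⟩; cases h; exact h'⟩
  · exact ⟨False.elim, by rintro ⟨a, h, -⟩; cases h⟩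

theorem isLeft_of_adj {u v : P ⊕ 𝓛} (h : (incidenceGraph 𝓛).graph.Adj u v) :
    v.isLeft = !u.isLeft := by
  rcases u with a | x
  · obtain ⟨x, rfl, -⟩ := adj_inl_iff.1 h; rfl
  · obtain ⟨x, rfl, -⟩ := adj_inr_iff.1 h; rfl

/-- The circuit with the points `a`, `b`, `c`, `d` and the lines `x`, `y`, `z`, `t`. -/
def quadCircuit (a b c d : P) (x y z t : 𝓛) : ZMod (2 * 4) → P ⊕ 𝓛 := fun
  | 0 => .inl a | 1 => .inr x | 2 => .inl b | 3 => .inr y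
  | 4 => .inl c | 5 => .inr z | 6 => .inl d | 7 => .inr t

theorem isBipartite_incidenceGraph : (incidenceGraph 𝓛).graph.IsBipartite :=
  ⟨⟨fun v => if v.isLeft then 0 else 1, fun {u v} h => by
    rw [SimpleGraph.top_adj, isLeft_of_adj h]
    cases u.isLeft <;> simp⟩⟩

theorem trivialAt_line (x : 𝓛) : (incidenceGraph 𝓛).TrivialAt (.inr x) := by
  intro u v hu hv huv
  obtain ⟨a, rfl, ha⟩ := adj_inr_iff.1 hu
  obtain ⟨b, rfl, hb⟩ := adj_inr_iff.1 hv
  exact ⟨ha, hb, fun e => huv (by rw [e])⟩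

namespace IsThickPolarSpace

variable (h : IsThickPolarSpace 𝓛)
include h

theorem exists_mem_ne (a b : P) {x : Set P} (hx : x ∈ 𝓛) : ∃ c ∈ x, c ≠ a ∧ c ≠ b := by
  have h3 := h.thick x hx
  by_contra! H
  have : x ⊆ {a, b} := fun c hc => by
    by_cases e : c = a
    · exact .inl e
    · exact .inr (H c hc e)
  have h4 := (h3.trans (Set.encard_le_encard this)).trans (Set.encard_insert_le _ _)
  rw [Set.encard_singleton] at h4
  exact absurd h4 (by norm_num)

theorem isVeldkampGraph : (incidenceGraph 𝓛).IsVeldkampGraph := by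
  classical
  have irrefl : ∀ v x, ¬ (incidenceGraph 𝓛).opp v x x := by
    rintro (a | x) (b | y) H
    · exact H
    · obtain ⟨-, -, b, hb, c, hc, hn⟩ := h.polar.opp_point_iff.1 H
      exact hn (mem_perp_of_mem y.2 hb hc)
    · exact H.2.2 rfl
    · exact H
  have symm : ∀ v x y, (incidenceGraph 𝓛).opp v x y → (incidenceGraph 𝓛).opp v y x := by
    rintro (a | x) (b | y) (c | z) H
    · exact H
    · exact H
    · exact H
    · obtain ⟨h1, h2, b, hb, c, hc, hn⟩ := h.polar.opp_point_iff.1 H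
      exact h.polar.opp_point_iff.2 ⟨h2, h1, c, hc, b, hb, fun e => hn (mem_perp_comm.1 e)⟩
    · exact ⟨H.2.1, H.1, H.2.2.symm⟩
    · exact H
    · exact H
    · exact H
  refine ⟨symm, irrefl, fun v => ?_⟩
  have key : ∀ u₁ u₂, (incidenceGraph 𝓛).graph.Adj v u₁ → (incidenceGraph 𝓛).graph.Adj v u₂ →
      ∃ u, (incidenceGraph 𝓛).graph.Adj v u ∧ (incidenceGraph 𝓛).opp v u u₁ ∧
        (incidenceGraph 𝓛).opp v u u₂ := by
    intro u₁ u₂ h1 h2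
    rcases v with a | x
    · obtain ⟨x, rfl, hx⟩ := adj_inl_iff.1 h1
      obtain ⟨y, rfl, hy⟩ := adj_inl_iff.1 h2
      obtain ⟨z, hz, haz, H1, H2⟩ := h.exists_opp a x.1 x.2 y.1 y.2 hx hy
      exact ⟨.inr ⟨z, hz⟩, haz, h.polar.opp_point_iff.2 ⟨haz, hx, H1⟩,
        h.polar.opp_point_iff.2 ⟨haz, hy, H2⟩⟩
    · obtain ⟨a, rfl, ha⟩ := adj_inr_iff.1 h1
      obtain ⟨b, rfl, hb⟩ := adj_inr_iff.1 h2
      obtain ⟨c, hc, hca, hcb⟩ := h.exists_mem_ne a b x.2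
      exact ⟨.inl c, hc, ⟨hc, ha, hca⟩, ⟨hc, hb, hcb⟩⟩
  intro S hS hc
  obtain ⟨w, hw⟩ : ∃ w, (incidenceGraph 𝓛).graph.Adj v w := by
    rcases v with a | x
    · obtain ⟨x, hx, ha⟩ := h.exists_line a
      exact ⟨.inr ⟨x, hx⟩, ha⟩
    · obtain ⟨a⟩ := h.nonempty
      obtain ⟨c, hc, -, -⟩ := h.exists_mem_ne a a x.2
      exact ⟨.inl c, hc⟩
  -- A set of at most two neighbours is enclosed in a pair, possibly with equal entries; the
  -- arbitrary neighbour `w` serves for the empty set.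
  obtain ⟨u₁, u₂, h1, h2, hsub⟩ : ∃ u₁ u₂, (incidenceGraph 𝓛).graph.Adj v u₁ ∧
      (incidenceGraph 𝓛).graph.Adj v u₂ ∧ S ⊆ {u₁, u₂} := by
    obtain h0 | h1 | h2 : S.card = 0 ∨ S.card = 1 ∨ S.card = 2 := by omega
    · rw [Finset.card_eq_zero] at h0
      exact ⟨w, w, hw, hw, by simp [h0]⟩
    · obtain ⟨u, rfl⟩ := Finset.card_eq_one.1 h1
      exact ⟨u, u, hS u (by simp), hS u (by simp), by simp⟩
    · obtain ⟨u, u', -, rfl⟩ := Finset.card_eq_two.1 h2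
      exact ⟨u, u', hS u (by simp), hS u' (by simp), by simp⟩
  obtain ⟨u, hu, o1, o2⟩ := key u₁ u₂ h1 h2
  refine ⟨u, hu, fun s hs => ?_⟩
  have := hsub hs
  simp only [Finset.mem_insert, Finset.mem_singleton] at this
  rcases this with rfl | rfl
  exacts [o1, o2]

theorem connected : (incidenceGraph 𝓛).graph.Connected := by
  obtain ⟨p⟩ := h.nonempty
  have key : ∀ a b : P, (incidenceGraph 𝓛).graph.Reachable (.inl a) (.inl b) := by
    have step : ∀ {a b : P}, b ∈ perp 𝓛 a →
        (incidenceGraph 𝓛).graph.Reachable (.inl a) (.inl b) := by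
      rintro a b (rfl | ⟨x, hx, ha, hb⟩)
      · rfl
      · have h1 : (incidenceGraph 𝓛).graph.Adj (.inl a) (.inr ⟨x, hx⟩) := ha
        have h2 : (incidenceGraph 𝓛).graph.Adj (.inr ⟨x, hx⟩) (.inl b) := hb
        exact h1.reachable.trans h2.reachable
    intro a b
    obtain ⟨x, hx, ha⟩ := h.exists_line a
    obtain ⟨c, hc, hbc⟩ := h.polar.exists_mem_perp b hx
    exact (step (mem_perp_of_mem hx ha hc)).trans (step (mem_perp_comm.1 hbc))
  have key' : ∀ v, (incidenceGraph 𝓛).graph.Reachable v (.inl p) := by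
    rintro (a | x)
    · exact key a p
    · obtain ⟨c, hc, -, -⟩ := h.exists_mem_ne p p x.2
      have h1 : (incidenceGraph 𝓛).graph.Adj (.inr x) (.inl c) := hc
      exact h1.reachable.trans (key c p)
  exact { preconnected := fun u v => (key' u).trans (key' v).symm, nonempty := ⟨.inl p⟩ }

theorem unique_two {v₀ v₁ v₂ u₁ : P ⊕ 𝓛} (h1 : (incidenceGraph 𝓛).graph.Adj v₀ v₁)
    (h2 : (incidenceGraph 𝓛).graph.Adj v₁ v₂) (h02 : v₀ ≠ v₂)
    (h3 : (incidenceGraph 𝓛).graph.Adj v₀ u₁) (h4 : (incidenceGraph 𝓛).graph.Adj u₁ v₂) :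
    u₁ = v₁ := by
  rcases v₀ with a | x
  · obtain ⟨x, rfl, hx⟩ := adj_inl_iff.1 h1
    obtain ⟨y, rfl, hy⟩ := adj_inl_iff.1 h3
    obtain ⟨b, rfl, hb⟩ := adj_inr_iff.1 h2
    congr 1
    exact Subtype.ext (h.linear y.1 y.2 x.1 x.2 a b (fun e => h02 (by rw [e])) hy h4 hx hb)
  · obtain ⟨a, rfl, ha⟩ := adj_inr_iff.1 h1
    obtain ⟨b, rfl, hb⟩ := adj_inr_iff.1 h3
    obtain ⟨y, rfl, hy⟩ := adj_inl_iff.1 h2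
    congr 1
    by_contra hab
    exact h02 (by rw [Subtype.ext (h.linear x.1 x.2 y.1 y.2 b a hab hb ha h4 hy)])

/-- An edge between the ends would give a second path of length 2 from `v₀` to `v₂`, so `v₃` would
equal `v₁`, although these are opposite at `v₂`. -/
theorem not_adj_of_straight {v₀ v₁ v₂ v₃ : P ⊕ 𝓛} (h1 : (incidenceGraph 𝓛).opp v₁ v₀ v₂)
    (h2 : (incidenceGraph 𝓛).opp v₂ v₁ v₃) : ¬ (incidenceGraph 𝓛).graph.Adj v₀ v₃ := by
  intro h3
  have hV := h.isVeldkampGraph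
  have e := h.unique_two (OppGraph.opp_adj _ h1).1.symm (OppGraph.opp_adj _ h1).2
    (fun e => by rw [e] at h1; exact hV.irrefl _ _ h1) h3 (OppGraph.opp_adj _ h2).2.symm
  rw [e] at h2
  exact hV.irrefl _ _ h2

/-- Only one point of the line `v₂`–`v₃` ends on can be collinear with `a`: any point of the last
line other than the middle point of the path is non-collinear with `a`, because the two lines on the
middle point are opposite there. -/
theorem unique_three_point {a : P} {v₁ v₂ v₃ u₁ u₂ : P ⊕ 𝓛}
    (h1 : (incidenceGraph 𝓛).opp v₁ (.inl a) v₂) (h2 : (incidenceGraph 𝓛).opp v₂ v₁ v₃)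
    (h3 : (incidenceGraph 𝓛).graph.Adj (.inl a) u₁) (h4 : (incidenceGraph 𝓛).graph.Adj u₁ u₂)
    (h5 : (incidenceGraph 𝓛).graph.Adj u₂ v₃) : u₁ = v₁ ∧ u₂ = v₂ := by
  have hV := h.isVeldkampGraph
  have h12 : u₂ = v₂ := by
    obtain ⟨x, rfl, hx⟩ := adj_inl_iff.1 (OppGraph.opp_adj _ h1).1.symm
    obtain ⟨b, rfl, hb⟩ := adj_inr_iff.1 (OppGraph.opp_adj _ h1).2
    obtain ⟨y, rfl, hy⟩ := adj_inl_iff.1 (OppGraph.opp_adj _ h2).2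
    obtain ⟨z, rfl, hz⟩ := adj_inl_iff.1 h3
    obtain ⟨c, rfl, hc⟩ := adj_inr_iff.1 h4
    congr 1
    by_contra hcb
    have hcy : c ∈ y.1 := h5
    exact (h.polar.opp_point_iff_notMem_perp hb hy hx hcy h1.2.2.symm (Ne.symm hcb)).1 h2
      (mem_perp_of_mem z.2 hz hc)
  subst h12
  refine ⟨h.unique_two (OppGraph.opp_adj _ h1).1.symm (OppGraph.opp_adj _ h1).2
    (fun e => ?_) h3 h4, rfl⟩
  rw [e] at h1
  exact hV.irrefl _ _ h1

theorem unique_three {v₀ v₁ v₂ v₃ u₁ u₂ : P ⊕ 𝓛}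
    (h1 : (incidenceGraph 𝓛).opp v₁ v₀ v₂) (h2 : (incidenceGraph 𝓛).opp v₂ v₁ v₃)
    (h3 : (incidenceGraph 𝓛).graph.Adj v₀ u₁) (h4 : (incidenceGraph 𝓛).graph.Adj u₁ u₂)
    (h5 : (incidenceGraph 𝓛).graph.Adj u₂ v₃) : u₁ = v₁ ∧ u₂ = v₂ := by
  have hV := h.isVeldkampGraph
  rcases v₀ with a | x
  · exact h.unique_three_point h1 h2 h3 h4 h5
  · obtain ⟨a, rfl, -⟩ := adj_inr_iff.1 (OppGraph.opp_adj _ h1).1.symm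
    obtain ⟨y, rfl, -⟩ := adj_inl_iff.1 (OppGraph.opp_adj _ h1).2
    obtain ⟨b, rfl, -⟩ := adj_inr_iff.1 (OppGraph.opp_adj _ h2).2
    exact (h.unique_three_point (hV.symm _ _ _ h2) (hV.symm _ _ _ h1) h5.symm h4.symm
      h3.symm).symm

theorem unique_straight (k : ℕ) (hk : 1 ≤ k) (hk4 : k + 1 ≤ 4) (x : ℕ → P ⊕ 𝓛)
    (hx : (incidenceGraph 𝓛).IsStraightPath k x) (j : ℕ) (hj : j ≤ k) (y : ℕ → P ⊕ 𝓛)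
    (hy : (incidenceGraph 𝓛).IsStraightPath j y) (h0 : y 0 = x 0) (hjk : y j = x k) :
    j = k ∧ ∀ i, i ≤ k → y i = x i := by
  -- Points and lines alternate along a path, so a shorter straight path with the same ends has
  -- length of the same parity. What remains of unequal lengths is 0 against 2 and 1 against 3.
  have hc : ∀ (s : ℕ) (x : ℕ → P ⊕ 𝓛), (incidenceGraph 𝓛).IsStraightPath s x →
      (1 ≤ s → (x 1).isLeft = !(x 0).isLeft) ∧ (2 ≤ s → (x 2).isLeft = (x 0).isLeft) ∧
      (3 ≤ s → (x 3).isLeft = !(x 0).isLeft) := by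
    intro s x hx
    have e1 : 1 ≤ s → (x 1).isLeft = !(x 0).isLeft := fun hs => isLeft_of_adj (hx.1.1 0 hs)
    have e2 : 2 ≤ s → (x 2).isLeft = (x 0).isLeft := fun hs => by
      rw [isLeft_of_adj (hx.1.1 1 hs), e1 (by omega), Bool.not_not]
    exact ⟨e1, e2, fun hs => by rw [isLeft_of_adj (hx.1.1 2 hs), e2 (by omega)]⟩
  obtain ⟨x1, x2, x3⟩ := hc k x hx
  obtain ⟨y1, y2, y3⟩ := hc j y hy
  have hne : ∀ b : Bool, b ≠ !b := by decide
  obtain rfl | rfl | rfl : k = 1 ∨ k = 2 ∨ k = 3 := by omega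
  · obtain rfl | rfl : j = 0 ∨ j = 1 := by omega
    · exact absurd (by rw [← x1 le_rfl, ← hjk, h0]) (hne (x 0).isLeft)
    · refine ⟨rfl, fun i hi => ?_⟩
      obtain rfl | rfl : i = 0 ∨ i = 1 := by omega
      exacts [h0, hjk]
  · obtain rfl | rfl | rfl : j = 0 ∨ j = 1 ∨ j = 2 := by omega
    · exact absurd (h0.symm.trans hjk) (hx.1.2 0 le_rfl)
    · exact absurd (by rw [← h0, ← y1 le_rfl, hjk, x2 le_rfl, h0]) (hne (x 0).isLeft)
    · refine ⟨rfl, fun i hi => ?_⟩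
      obtain rfl | rfl | rfl : i = 0 ∨ i = 1 ∨ i = 2 := by omega
      · exact h0
      · exact h.unique_two (hx.1.1 0 (by omega)) (hx.1.1 1 (by omega)) (hx.1.2 0 le_rfl)
          (h0 ▸ hy.1.1 0 (by omega)) (hjk ▸ hy.1.1 1 (by omega))
      · exact hjk
  · obtain rfl | rfl | rfl | rfl : j = 0 ∨ j = 1 ∨ j = 2 ∨ j = 3 := by omega
    · exact absurd (by rw [← x3 le_rfl, ← hjk, h0]) (hne (x 0).isLeft)
    · have := hy.1.1 0 le_rfl
      rw [zero_add, h0, hjk] at this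
      exact absurd this (h.not_adj_of_straight (hx.2 0 (by omega)) (hx.2 1 (by omega)))
    · exact absurd (by rw [← x3 le_rfl, ← hjk, y2 le_rfl, h0]) (hne (x 0).isLeft)
    · obtain ⟨e1, e2⟩ := h.unique_three (hx.2 0 (by omega)) (hx.2 1 (by omega))
        (h0 ▸ hy.1.1 0 (by omega)) (hy.1.1 1 (by omega)) (hjk ▸ hy.1.1 2 (by omega))
      refine ⟨rfl, fun i hi => ?_⟩
      obtain rfl | rfl | rfl | rfl : i = 0 ∨ i = 1 ∨ i = 2 ∨ i = 3 := by omega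
      exacts [h0, e1, e2, hjk]

omit h in
-- The two non-collinear diagonals give everything. If two of the points or two of the lines
-- coincided, `a`, `c` or `b`, `d` would be collinear; and at each corner opposition of the two
-- lines is tested on a diagonal.
theorem isStraightCircuit_quadCircuit (hp : IsPolarSpace 𝓛) {a b c d : P} {x y z t : 𝓛}
    (hax : a ∈ x.1) (hbx : b ∈ x.1) (hby : b ∈ y.1) (hcy : c ∈ y.1) (hcz : c ∈ z.1)
    (hdz : d ∈ z.1) (hdt : d ∈ t.1) (hat : a ∈ t.1) (hac : c ∉ perp 𝓛 a) (hbd : d ∉ perp 𝓛 b) :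
    (incidenceGraph 𝓛).IsStraightCircuit 4 (quadCircuit a b c d x y z t) := by
  have hca : a ∉ perp 𝓛 c := fun e => hac (mem_perp_comm.1 e)
  have hdb : b ∉ perp 𝓛 d := fun e => hbd (mem_perp_comm.1 e)
  have nab : a ≠ b := fun e => hac (by rw [e]; exact mem_perp_of_mem y.2 hby hcy)
  have nbc : b ≠ c := fun e => hbd (by rw [e]; exact mem_perp_of_mem z.2 hcz hdz)
  have ncd : c ≠ d := fun e => hac (by rw [e]; exact mem_perp_of_mem t.2 hat hdt)
  have nda : d ≠ a := fun e => hbd (by rw [e]; exact mem_perp_of_mem x.2 hbx hax)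
  have nac : a ≠ c := fun e => hac (by rw [e]; exact mem_perp_self _)
  have nbd : b ≠ d := fun e => hbd (by rw [e]; exact mem_perp_self _)
  have nxy : x ≠ y := fun e => hac (mem_perp_of_mem x.2 hax (e ▸ hcy))
  have nxz : x ≠ z := fun e => hac (mem_perp_of_mem x.2 hax (e ▸ hcz))
  have nxt : x ≠ t := fun e => hbd (mem_perp_of_mem x.2 hbx (e ▸ hdt))
  have nyz : y ≠ z := fun e => hbd (mem_perp_of_mem y.2 hby (e ▸ hdz))
  have nyt : y ≠ t := fun e => hac (mem_perp_of_mem y.2 (e ▸ hat) hcy)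
  have nzt : z ≠ t := fun e => hac (mem_perp_of_mem z.2 (e ▸ hat) hcz)
  refine ⟨?_, ?_, ?_⟩
  -- `ZMod (2 * 4)` unfolds to `Fin 8`, whose order makes it enough to compare i < j.
  · have key : ∀ i j : Fin 8, i < j → quadCircuit a b c d x y z t i ≠ quadCircuit a b c d x y z t j := by
      intro i j hij
      fin_cases i <;> fin_cases j <;> first | exact absurd hij (by decide) | skip
      all_goals
        intro e
        first
        | exact absurd e Sum.inl_ne_inr
        | exact absurd e Sum.inr_ne_inl
        | (have e' := Sum.inl_injective e; first | exact nab e' | exact nbc e' | exact ncd e' | exact nda e'.symm | exact nac e' | exact nbd e')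
        | (have e' := Sum.inr_injective e; first | exact nxy e' | exact nxz e' | exact nxt e' | exact nyz e' | exact nyt e' | exact nzt e')
    intro i j e
    rcases lt_trichotomy (show Fin 8 from i) j with hlt | heq | hlt
    · exact absurd e (key i j hlt)
    · exact heq
    · exact absurd e.symm (key j i hlt)
  · exact fun | 0 => hax | 1 => hbx | 2 => hby | 3 => hcy | 4 => hcz | 5 => hdz | 6 => hdt | 7 => hat
  · exact fun
      | 0 => (hp.opp_point_iff_notMem_perp hat hax hdt hbx nda.symm nab).2 hdb
      | 1 => ⟨hax, hbx, nab⟩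
      | 2 => (hp.opp_point_iff_notMem_perp hbx hby hax hcy nab.symm nbc).2 hac
      | 3 => ⟨hby, hcy, nbc⟩
      | 4 => (hp.opp_point_iff_notMem_perp hcy hcz hby hdz nbc.symm ncd).2 hbd
      | 5 => ⟨hcz, hdz, ncd⟩
      | 6 => (hp.opp_point_iff_notMem_perp hdz hdt hcz hat ncd.symm nda).2 hca
      | 7 => ⟨hdt, hat, nda⟩

theorem exists_circuit (x : ℕ → P ⊕ 𝓛) (hx : (incidenceGraph 𝓛).IsStraightPath (4 + 1) x) :
    ∃ w : ZMod (2 * 4) → P ⊕ 𝓛, (incidenceGraph 𝓛).IsStraightCircuit 4 w ∧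
      ∀ i : ℕ, i ≤ 4 + 1 → w (i : ZMod (2 * 4)) = x i := by
  have hp := h.polar
  have a0 := hx.1.1 0 (by omega)
  have a1 := hx.1.1 1 (by omega)
  have a2 := hx.1.1 2 (by omega)
  have a3 := hx.1.1 3 (by omega)
  have a4 := hx.1.1 4 (by omega)
  have o1 := hx.2 0 (by omega)
  have o2 := hx.2 1 (by omega)
  have o3 := hx.2 2 (by omega)
  have o4 := hx.2 3 (by omega)
  have key : ∀ w : ZMod (2 * 4) → P ⊕ 𝓛, w 0 = x 0 → w 1 = x 1 → w 2 = x 2 → w 3 = x 3 →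
      w 4 = x 4 → w 5 = x 5 → ∀ i : ℕ, i ≤ 4 + 1 → w (i : ZMod (2 * 4)) = x i := by
    intro w e0 e1 e2 e3 e4 e5 i hi
    obtain rfl | rfl | rfl | rfl | rfl | rfl :
      i = 0 ∨ i = 1 ∨ i = 2 ∨ i = 3 ∨ i = 4 ∨ i = 5 := by omega
    exacts [e0, e1, e2, e3, e4, e5]
  simp only [zero_add, Nat.reduceAdd] at a0 a1 a2 a3 a4 o1 o2 o3 o4
  rcases e0 : x 0 with p0 | l0
  · rw [e0] at a0
    obtain ⟨l1, e1, h01⟩ := adj_inl_iff.1 a0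
    rw [e1] at a1
    obtain ⟨p2, e2, h21⟩ := adj_inr_iff.1 a1
    rw [e2] at a2
    obtain ⟨l3, e3, h23⟩ := adj_inl_iff.1 a2
    rw [e3] at a3
    obtain ⟨p4, e4, h43⟩ := adj_inr_iff.1 a3
    rw [e4] at a4
    obtain ⟨l5, e5, h45⟩ := adj_inl_iff.1 a4
    rw [e0, e1, e2] at o1
    rw [e1, e2, e3] at o2
    rw [e2, e3, e4] at o3
    rw [e3, e4, e5] at o4
    have h04 := (hp.opp_point_iff_notMem_perp h21 h23 h01 h43 o1.2.2.symm o3.2.2).1 o2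
    -- The path starts at a point. Its projection to the last line supplies the missing corner, and
    -- the line joining the two is the missing side.
    obtain ⟨p6, h65, h06⟩ := hp.exists_mem_perp p0 l5.2
    have n06 : p0 ≠ p6 := by
      rintro rfl
      exact h04 (mem_perp_of_mem l5.2 h65 h45)
    have n46 : p4 ≠ p6 := by
      rintro rfl
      exact h04 h06
    obtain ⟨l7, hl7, h07, h67⟩ := exists_line_of_mem_perp h06 n06
    have h26 := (hp.opp_point_iff_notMem_perp h43 h45 h23 h65 o3.2.2.symm n46).1 o4
    refine ⟨quadCircuit p0 p2 p4 p6 l1 l3 l5 ⟨l7, hl7⟩,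
      isStraightCircuit_quadCircuit hp h01 h21 h23 h43 h45 h65 h67 h07 h04 h26, key _ ?_ ?_ ?_ ?_ ?_ ?_⟩
    exacts [e0.symm, e1.symm, e2.symm, e3.symm, e4.symm, e5.symm]
  · rw [e0] at a0
    obtain ⟨p1, e1, h10⟩ := adj_inr_iff.1 a0
    rw [e1] at a1
    obtain ⟨l2, e2, h12⟩ := adj_inl_iff.1 a1
    rw [e2] at a2
    obtain ⟨p3, e3, h32⟩ := adj_inr_iff.1 a2
    rw [e3] at a3
    obtain ⟨l4, e4, h34⟩ := adj_inl_iff.1 a3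
    rw [e4] at a4
    obtain ⟨p5, e5, h54⟩ := adj_inr_iff.1 a4
    rw [e0, e1, e2] at o1
    rw [e1, e2, e3] at o2
    rw [e2, e3, e4] at o3
    rw [e3, e4, e5] at o4
    have h15 := (hp.opp_point_iff_notMem_perp h32 h34 h12 h54 o2.2.2.symm o4.2.2).1 o3
    -- The path starts at a line, so here the last point is projected to the first line.
    obtain ⟨p7, h70, h57⟩ := hp.exists_mem_perp p5 l0.2
    have n57 : p5 ≠ p7 := by
      rintro rfl
      exact h15 (mem_perp_of_mem l0.2 h10 h70)
    have n17 : p1 ≠ p7 := by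
      rintro rfl
      exact h15 (mem_perp_comm.1 h57)
    obtain ⟨l6, hl6, h56, h76⟩ := exists_line_of_mem_perp h57 n57
    have h73 := (hp.opp_point_iff_notMem_perp h10 h12 h70 h32 n17 o2.2.2).1 o1
    -- `quadCircuit` has points at the even places, whereas this path begins with a line; hence the
    -- shift by one.
    refine ⟨fun i => quadCircuit p1 p3 p5 p7 l2 l4 ⟨l6, hl6⟩ l0 (i + -1),
      (isStraightCircuit_quadCircuit hp (t := l0) h12 h32 h34 h54 h56 h76 h70 h10 h15
      (fun e => h73 (mem_perp_comm.1 e)) (z := ⟨l6, hl6⟩)).rotate (-1),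
      key (fun i => quadCircuit p1 p3 p5 p7 l2 l4 ⟨l6, hl6⟩ l0 (i + -1)) ?_ ?_ ?_ ?_ ?_ ?_⟩
    exacts [e0.symm, e1.symm, e2.symm, e3.symm, e4.symm, e5.symm]

theorem isVeldkampPolygon : (incidenceGraph 𝓛).IsVeldkampPolygon 4 :=
  { h.isVeldkampGraph with
    two_le := by norm_num
    connected := h.connected
    bipartite := isBipartite_incidenceGraph
    unique_straight := h.unique_straight
    exists_circuit := h.exists_circuit }

/-! ### Opposite vertices and flatness -/

omit h in
theorem isLeft_of_opposite {u v : P ⊕ 𝓛} (huv : (incidenceGraph 𝓛).Opposite 4 u v) :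
    v.isLeft = u.isLeft := by
  obtain ⟨x, hx, rfl, rfl⟩ := huv
  rw [isLeft_of_adj (hx.1.1 3 (by omega)), isLeft_of_adj (hx.1.1 2 (by omega)),
    isLeft_of_adj (hx.1.1 1 (by omega)), isLeft_of_adj (hx.1.1 0 (by omega))]
  simp

theorem opposite_of_straight {v₀ v₁ v₂ v₃ v₄ : P ⊕ 𝓛} (o1 : (incidenceGraph 𝓛).opp v₁ v₀ v₂)
    (o2 : (incidenceGraph 𝓛).opp v₂ v₁ v₃) (o3 : (incidenceGraph 𝓛).opp v₃ v₂ v₄) :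
    (incidenceGraph 𝓛).Opposite 4 v₀ v₄ := by
  refine ⟨fun | 0 => v₀ | 1 => v₁ | 2 => v₂ | 3 => v₃ | _ => v₄,
    h.isVeldkampGraph.isStraightPath (fun i hi => ?_) (fun i hi => ?_), rfl, rfl⟩
  · obtain rfl | rfl | rfl | rfl : i = 0 ∨ i = 1 ∨ i = 2 ∨ i = 3 := by omega
    exacts [(OppGraph.opp_adj _ o1).1.symm, (OppGraph.opp_adj _ o1).2, (OppGraph.opp_adj _ o2).2,
      (OppGraph.opp_adj _ o3).2]
  · obtain rfl | rfl | rfl : i = 0 ∨ i = 1 ∨ i = 2 := by omega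
    exacts [o1, o2, o3]

theorem opposite_points_iff {a c : P} :
    (incidenceGraph 𝓛).Opposite 4 (.inl a) (.inl c) ↔ c ∉ perp 𝓛 a := by
  have hp := h.polar
  constructor
  · rintro ⟨x, hx, e0, e4⟩
    have a0 := hx.1.1 0 (by omega)
    have a1 := hx.1.1 1 (by omega)
    have a2 := hx.1.1 2 (by omega)
    have a3 := hx.1.1 3 (by omega)
    have o1 := hx.2 0 (by omega)
    have o2 := hx.2 1 (by omega)
    have o3 := hx.2 2 (by omega)
    simp only [zero_add, Nat.reduceAdd] at a0 a1 a2 a3 o1 o2 o3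
    rw [e0] at a0
    obtain ⟨l1, e1, h01⟩ := adj_inl_iff.1 a0
    rw [e1] at a1
    obtain ⟨p2, e2, h21⟩ := adj_inr_iff.1 a1
    rw [e2] at a2
    obtain ⟨l3, e3, h23⟩ := adj_inl_iff.1 a2
    rw [e3, e4] at a3
    rw [e0, e1, e2] at o1
    rw [e1, e2, e3] at o2
    rw [e2, e3, e4] at o3
    exact (hp.opp_point_iff_notMem_perp h21 h23 h01 a3 o1.2.2.symm o3.2.2).1 o2
  · intro hac
    obtain ⟨x, hx, hax⟩ := h.exists_line a
    obtain ⟨b, hbx, hcb⟩ := hp.exists_mem_perp c hx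
    have nab : a ≠ b := by
      rintro rfl
      exact hac (mem_perp_comm.1 hcb)
    have ncb : c ≠ b := by
      rintro rfl
      exact hac (mem_perp_of_mem hx hax hbx)
    obtain ⟨y, hy, hcy, hby⟩ := exists_line_of_mem_perp hcb ncb
    exact h.opposite_of_straight (v₁ := .inr ⟨x, hx⟩) (v₂ := .inl b) (v₃ := .inr ⟨y, hy⟩)
      ⟨hax, hbx, nab⟩
      ((hp.opp_point_iff_notMem_perp hbx hby hax hcy nab.symm ncb.symm).2 hac) ⟨hby, hcy, ncb.symm⟩

/-- On a root from `x` to `y` let `p1` and `p3` be the points. If `p3 = r`, opposition at `p1` makes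
`r` non-collinear with the other points of `x`; otherwise opposition at `p3` makes `r` non-collinear
with `p1`. Either contradicts the assumption on `r`. -/
theorem not_opposite_lines {x y : 𝓛} {r : P} (hr : r ∈ y.1) (hx : x.1 ⊆ perp 𝓛 r) :
    ¬ (incidenceGraph 𝓛).Opposite 4 (.inr x) (.inr y) := by
  have hp := h.polar
  rintro ⟨v, hv, e0, e4⟩
  have a0 := hv.1.1 0 (by omega)
  have a1 := hv.1.1 1 (by omega)
  have a2 := hv.1.1 2 (by omega)
  have a3 := hv.1.1 3 (by omega)
  have o1 := hv.2 0 (by omega)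
  have o2 := hv.2 1 (by omega)
  have o3 := hv.2 2 (by omega)
  simp only [zero_add, Nat.reduceAdd] at a0 a1 a2 a3 o1 o2 o3
  rw [e0] at a0
  obtain ⟨p1, e1, h10⟩ := adj_inr_iff.1 a0
  rw [e1] at a1
  obtain ⟨l2, e2, h12⟩ := adj_inl_iff.1 a1
  rw [e2] at a2
  obtain ⟨p3, e3, h32⟩ := adj_inr_iff.1 a2
  rw [e3, e4] at a3
  rw [e0, e1, e2] at o1
  rw [e1, e2, e3] at o2
  rw [e2, e3, e4] at o3
  by_cases hr3 : p3 = r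
  · subst hr3
    obtain ⟨b, hb, hb1, -⟩ := h.exists_mem_ne p1 p1 x.2
    exact (hp.opp_point_iff_notMem_perp h10 h12 hb h32 hb1.symm o2.2.2).1 o1
      (mem_perp_comm.1 (hx hb))
  · exact (hp.opp_point_iff_notMem_perp h32 a3 h12 hr o2.2.2.symm hr3).1 o3
      (mem_perp_comm.1 (hx h10))

/-- Take `r` collinear with all of `y` but not with all of `x`, project it to `a` on `x`, and choose
`z` opposite the line `r a` at `r`. Then x, a, ra, r, z is a root, while `y` is not opposite `z`
because the point `r` of `z` is collinear with all of `y`. -/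
theorem exists_opposite_line {x y : 𝓛} (hxy : x ≠ y) : ∃ z : 𝓛,
    (incidenceGraph 𝓛).Opposite 4 (.inr x) (.inr z) ∧
      ¬ (incidenceGraph 𝓛).Opposite 4 (.inr y) (.inr z) := by
  have hp := h.polar
  obtain ⟨p, hpx, r, hrp, hyr⟩ := h.separates_lines x.1 x.2 y.1 y.2 fun e => hxy (Subtype.ext e)
  obtain ⟨a, hax, har⟩ := hp.exists_mem_perp r x.2
  have nra : r ≠ a := by
    rintro rfl
    exact hrp (mem_perp_of_mem x.2 hpx hax)
  have npa : p ≠ a := by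
    rintro rfl
    exact hrp (mem_perp_comm.1 har)
  obtain ⟨k, hk, hrk, hak⟩ := exists_line_of_mem_perp har nra
  obtain ⟨z, hz, hrz, hopp, -⟩ := h.exists_opp r k hk k hk hrk hrk
  refine ⟨⟨z, hz⟩, ?_, h.not_opposite_lines hrz hyr⟩
  refine h.opposite_of_straight (v₁ := .inl a) (v₂ := .inr ⟨k, hk⟩) (v₃ := .inl r)
    ((hp.opp_point_iff_notMem_perp hax hak hpx hrk npa.symm nra.symm).2 hrp) ⟨hak, hrk, nra.symm⟩
    (h.isVeldkampGraph.symm _ _ _ (hp.opp_point_iff.2 ⟨hrz, hrk, hopp⟩))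

theorem exists_notMem_perp (a : P) : ∃ b, b ∉ perp 𝓛 a := by
  by_contra! H
  exact h.nondegenerate a (Set.eq_univ_of_forall H)

/-- Opposite vertices have the same type and every point has an opposite, so a point and a line
never share their opposites. For two points or two lines the separation properties apply. -/
theorem isFlat : (incidenceGraph 𝓛).IsFlat 4 := by
  rintro (a | x) (b | y) H
  · congr 1
    by_contra hab
    obtain ⟨r, hra, hrb⟩ := h.separates_points a b hab
    exact h.opposite_points_iff.1 ((H (.inl r)).2 (h.opposite_points_iff.2 hrb)) hra
  · obtain ⟨c, hc⟩ := h.exists_notMem_perp a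
    have h1 := h.opposite_points_iff.2 hc
    exact absurd (isLeft_of_opposite ((H _).1 h1)) (by simp)
  · obtain ⟨c, hc⟩ := h.exists_notMem_perp b
    have h1 := h.opposite_points_iff.2 hc
    exact absurd (isLeft_of_opposite ((H _).2 h1)) (by simp)
  · congr 1
    by_contra hxy
    obtain ⟨z, h1, h2⟩ := h.exists_opposite_line hxy
    exact h2 ((H _).1 h1)

end IsThickPolarSpace

end TitsQuad

namespace TitsQuad

open MulOpposite

/-! ## Polar spaces of forms -/

/-- The isotropy predicate and the orthogonality relation of a non-degenerate form. -/
structure PolarForm (R M : Type*) [DivisionRing R] [AddCommGroup M] [Module R M] where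
  iso : M → Prop
  orth : M → M → Prop
  iso_smul : ∀ (t : R) {v : M}, iso v → iso (t • v)
  iso_add : ∀ {v w : M}, iso v → iso w → orth v w → iso (v + w)
  orth_self : ∀ {v : M}, iso v → orth v v
  orth_symm : ∀ {v w : M}, orth v w → orth w v
  orth_zero : ∀ v : M, orth v 0
  orth_add : ∀ {v w w' : M}, orth v w → orth v w' → orth v (w + w')
  orth_smul : ∀ (t : R) {v w : M}, orth v w → orth v (t • w)
  exists_orth : ∀ {v e : M}, ¬ orth v e → ∀ w, ∃ t : R, orth v (w + t • e)
  exists_iso : ∀ {e w : M}, iso e → ¬ orth e w → ∃ t : R, iso (w + t • e)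
  nondeg : ∀ {v : M}, iso v → (∀ w, orth v w) → v = 0
  -- The vectors e and f span two non-collinear points in the perpendicular space of c; the
  -- condition asks for a line on c opposite both ce and cf. It excludes the hyperbolic quadric in
  -- K⁴, where each point lies on exactly two lines.
  exists_third : ∀ {c e f : M}, iso c → c ≠ 0 → iso e → iso f → orth c e → orth c f → ¬ orth e f →
    ∃ g, iso g ∧ orth c g ∧ ¬ orth e g ∧ ¬ orth f g

/-! ### Subspaces of dimension two -/

section Span

variable {R M : Type*} [DivisionRing R] [AddCommGroup M] [Module R M]

theorem finrank_span_pair {a b : M} (ha : a ≠ 0) (hb : b ∉ Submodule.span R {a}) :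
    Module.finrank R (Submodule.span R {a, b}) = 2 := by
  have h : LinearIndependent R ![a, b] := by
    rw [LinearIndependent.pair_iff' ha]
    exact fun t e => hb (Submodule.mem_span_singleton.2 ⟨t, e⟩)
  have := finrank_span_eq_card h
  rwa [Matrix.range_cons, Matrix.range_cons, Matrix.range_empty, Set.union_empty,
    Set.singleton_union, Fintype.card_fin] at this

variable {E : Submodule R M}

theorem span_pair_eq (hE : Module.finrank R E = 2) {a b : M} (ha : a ∈ E) (hb : b ∈ E) (h0 : a ≠ 0)
    (hab : b ∉ Submodule.span R {a}) : Submodule.span R {a, b} = E := by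
  have : Module.Finite R E := Module.finite_of_finrank_eq_succ hE
  refine Submodule.eq_of_le_of_finrank_eq ?_ (by rw [finrank_span_pair h0 hab, hE])
  rw [Submodule.span_le]
  rintro v (rfl | rfl)
  exacts [ha, hb]

theorem exists_notMem_span (hE : Module.finrank R E = 2) (a : M) :
    ∃ b ∈ E, b ∉ Submodule.span R {a} := by
  by_contra! H
  have h1 := Submodule.finrank_mono (show E ≤ Submodule.span R {a} from H)
  have h2 := finrank_span_le_card (R := R) ({a} : Set M)
  simp only [Set.toFinset_singleton, Finset.card_singleton] at h2
  omega

theorem exists_ne_zero_mem (hE : Module.finrank R E = 2) : ∃ b ∈ E, b ≠ 0 := by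
  obtain ⟨b, hb, h⟩ := exists_notMem_span hE 0
  exact ⟨b, hb, fun e => h (by rw [e]; exact zero_mem _)⟩

theorem notMem_span_singleton_comm {a b : M} (ha : a ≠ 0) (h : b ∉ Submodule.span R {a}) :
    a ∉ Submodule.span R {b} := by
  intro h'
  obtain ⟨t, e⟩ := Submodule.mem_span_singleton.1 h'
  have ht : t ≠ 0 := by
    rintro rfl
    exact ha (by rw [← e, zero_smul])
  exact h (Submodule.mem_span_singleton.2 ⟨t⁻¹, by rw [← e, smul_smul, inv_mul_cancel₀ ht, one_smul]⟩)

end Span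

namespace PolarForm

variable {R M : Type*} [DivisionRing R] [AddCommGroup M] [Module R M] (Λ : PolarForm R M)

def Tot (U : Submodule R M) : Prop :=
  (∀ v ∈ U, Λ.iso v) ∧ ∀ v ∈ U, ∀ w ∈ U, Λ.orth v w

variable {Λ}

theorem orth_comm {v w : M} : Λ.orth v w ↔ Λ.orth w v := ⟨Λ.orth_symm, Λ.orth_symm⟩

theorem orth_add_smul_iff {v w e : M} (t : R) (h : Λ.orth v e) :
    Λ.orth v (w + t • e) ↔ Λ.orth v w := by
  refine ⟨fun H => ?_, fun H => Λ.orth_add H (Λ.orth_smul t h)⟩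
  have := Λ.orth_add H (Λ.orth_smul (-t) h)
  rwa [neg_smul, add_neg_cancel_right] at this

theorem orth_add_smul_iff_left {v w e : M} (t : R) (h : Λ.orth e w) :
    Λ.orth (v + t • e) w ↔ Λ.orth v w := by
  rw [orth_comm, orth_add_smul_iff t (Λ.orth_symm h), orth_comm]

theorem iso_add_smul {v e : M} (t : R) (hv : Λ.iso v) (he : Λ.iso e) (h : Λ.orth v e) :
    Λ.iso (v + t • e) := Λ.iso_add hv (Λ.iso_smul t he) (Λ.orth_smul t h)

theorem ne_zero_of_not_orth {v w : M} (h : ¬ Λ.orth v w) : w ≠ 0 := by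
  rintro rfl
  exact h (Λ.orth_zero v)

/-- Non-degeneracy gives some vector not orthogonal to `v`. Adding a multiple of `v` makes it
isotropic without changing its relation to `v`, as `v` is orthogonal to itself. The same correction
recurs below. -/
theorem exists_not_orth {v : M} (hv : Λ.iso v) (h0 : v ≠ 0) : ∃ w, Λ.iso w ∧ ¬ Λ.orth v w := by
  by_contra! H
  refine h0 (Λ.nondeg hv fun w => ?_)
  by_contra hw
  obtain ⟨t, ht⟩ := Λ.exists_iso hv hw
  exact hw ((orth_add_smul_iff t (Λ.orth_self hv)).1 (H _ ht))

/-- If p^⊥ were contained in a^⊥, choose `w₀` outside p^⊥ and t with a + tp orthogonal to `w₀`. Then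
a + tp is orthogonal to p^⊥ and to `w₀`, hence to everything, and it is isotropic; so it vanishes
and a lies on ⟨p⟩. -/
theorem exists_orth_not_orth {p a : M} (hp : Λ.iso p) (ha : Λ.iso a) (hpa : Λ.orth p a)
    (h0 : p ≠ 0) (hi : a ∉ Submodule.span R {p}) :
    ∃ c, Λ.iso c ∧ Λ.orth p c ∧ ¬ Λ.orth a c := by
  obtain ⟨w, hw1, hw2⟩ : ∃ w, Λ.orth p w ∧ ¬ Λ.orth a w := by
    by_contra! H
    obtain ⟨w₀, -, hw₀⟩ := exists_not_orth hp h0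
    obtain ⟨t, ht⟩ := Λ.exists_orth (fun e => hw₀ (Λ.orth_symm e)) a
    have h1 := Λ.nondeg (iso_add_smul t ha hp (Λ.orth_symm hpa)) fun w => by
      obtain ⟨s, hs⟩ := Λ.exists_orth hw₀ w
      have h2 : Λ.orth (a + t • p) (w + s • w₀) := (orth_add_smul_iff_left t hs).2 (H _ hs)
      exact (orth_add_smul_iff s (Λ.orth_symm ht)).1 h2
    refine hi (Submodule.mem_span_singleton.2 ⟨-t, ?_⟩)
    rw [neg_smul]
    exact (eq_neg_of_add_eq_zero_left h1).symm
  obtain ⟨t, ht⟩ := Λ.exists_iso ha hw2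
  exact ⟨_, ht, (orth_add_smul_iff t hpa).2 hw1,
    fun h => hw2 ((orth_add_smul_iff t (Λ.orth_self ha)).1 h)⟩

/-- For orthogonal a and b, one vector works for a and one for b; if neither works for both, their
sum does, and a multiple of a makes it isotropic without affecting either relation. The remaining
case is `exists_third`. -/
theorem exists_orth_not_orth_pair {p a b : M} (hp : Λ.iso p) (ha : Λ.iso a) (hb : Λ.iso b)
    (hpa : Λ.orth p a) (hpb : Λ.orth p b) (h0 : p ≠ 0) (hia : a ∉ Submodule.span R {p})
    (hib : b ∉ Submodule.span R {p}) :
    ∃ c, Λ.iso c ∧ Λ.orth p c ∧ ¬ Λ.orth a c ∧ ¬ Λ.orth b c := by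
  by_cases hab : Λ.orth a b
  · obtain ⟨c, hc, hpc, hac⟩ := exists_orth_not_orth hp ha hpa h0 hia
    obtain ⟨d, hd, hpd, hbd⟩ := exists_orth_not_orth hp hb hpb h0 hib
    by_cases hbc : Λ.orth b c
    · by_cases had : Λ.orth a d
      · have h1 : ¬ Λ.orth a (c + d) := fun h =>
          hac ((orth_add_smul_iff (1 : R) had).1 (by rwa [one_smul]))
        have h2 : ¬ Λ.orth b (c + d) := fun h =>
          hbd ((orth_add_smul_iff (1 : R) hbc).1 (by rwa [one_smul, add_comm]))
        obtain ⟨t, ht⟩ := Λ.exists_iso ha h1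
        exact ⟨_, ht, (orth_add_smul_iff t hpa).2 (Λ.orth_add hpc hpd),
          fun h => h1 ((orth_add_smul_iff t (Λ.orth_self ha)).1 h),
          fun h => h2 ((orth_add_smul_iff t (Λ.orth_symm hab)).1 h)⟩
      · exact ⟨d, hd, hpd, had, hbd⟩
    · exact ⟨c, hc, hpc, hac, hbc⟩
  · obtain ⟨g, hg⟩ := Λ.exists_third hp h0 ha hb hpa hpb hab
    exact ⟨g, hg⟩

/-- This is the inclusion {a, b}^⊥⊥ ⊆ ⟨a, b⟩ for isotropic vectors. When p is orthogonal to a and b,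
the vectors `w₁`, `w₂` dual to a, b allow p to be corrected to p + sa + tb orthogonal to both; if p
were orthogonal to {a, b}^⊥, this isotropic vector would lie in the radical and vanish. -/
theorem exists_separating {a b p : M} (ha : Λ.iso a) (hb : Λ.iso b) (hp : Λ.iso p)
    (hab : Λ.orth a b) (h0 : a ≠ 0) (hi : b ∉ Submodule.span R {a})
    (hn : p ∉ Submodule.span R {a, b}) :
    ∃ r, Λ.iso r ∧ Λ.orth r a ∧ Λ.orth r b ∧ ¬ Λ.orth r p := by
  by_cases hap : Λ.orth a p
  swap
  · exact ⟨a, ha, Λ.orth_self ha, hab, hap⟩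
  by_cases hbp : Λ.orth b p
  swap
  · exact ⟨b, hb, Λ.orth_symm hab, Λ.orth_self hb, hbp⟩
  obtain ⟨w, hwa, hwb, hwp⟩ : ∃ w, Λ.orth a w ∧ Λ.orth b w ∧ ¬ Λ.orth p w := by
    by_contra! H
    have hb0 : b ≠ 0 := fun e => hi (by rw [e]; exact zero_mem _)
    obtain ⟨w₁, -, hbw₁, haw₁⟩ := exists_orth_not_orth hb ha (Λ.orth_symm hab) hb0
      (notMem_span_singleton_comm h0 hi)
    obtain ⟨w₂, -, haw₂, hbw₂⟩ := exists_orth_not_orth ha hb hab h0 hi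
    obtain ⟨s, hs⟩ := Λ.exists_orth (fun e => haw₁ (Λ.orth_symm e)) p
    obtain ⟨t, ht⟩ := Λ.exists_orth (fun e => hbw₂ (Λ.orth_symm e)) (p + s • a)
    have hbs : Λ.orth (p + s • a) b := (orth_add_smul_iff_left s hab).2 (Λ.orth_symm hbp)
    have h1 : Λ.orth w₁ (p + s • a + t • b) := (orth_add_smul_iff t (Λ.orth_symm hbw₁)).2 hs
    have h2 := Λ.nondeg (iso_add_smul t (iso_add_smul s hp ha (Λ.orth_symm hap)) hb hbs) fun w => by
      obtain ⟨s', hs'⟩ := Λ.exists_orth haw₁ w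
      obtain ⟨t', ht'⟩ := Λ.exists_orth hbw₂ (w + s' • w₁)
      have hs'' : Λ.orth a (w + s' • w₁ + t' • w₂) := (orth_add_smul_iff t' haw₂).2 hs'
      have h3 : Λ.orth (p + s • a + t • b) (w + s' • w₁ + t' • w₂) :=
        (orth_add_smul_iff_left t ht').2 ((orth_add_smul_iff_left s hs'').2 (H _ hs'' ht'))
      exact (orth_add_smul_iff s' (Λ.orth_symm h1)).1
        ((orth_add_smul_iff t' (Λ.orth_symm ht)).1 h3)
    refine hn (Submodule.mem_span_pair.2 ⟨-s, -t, ?_⟩)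
    rw [neg_smul, neg_smul, ← sub_eq_zero, ← neg_eq_zero, ← h2]
    abel
  obtain ⟨t, ht⟩ := Λ.exists_iso hp hwp
  exact ⟨_, ht, Λ.orth_symm ((orth_add_smul_iff t hap).2 hwa),
    Λ.orth_symm ((orth_add_smul_iff t hbp).2 hwb),
    fun h => hwp ((orth_add_smul_iff t (Λ.orth_self hp)).1 (Λ.orth_symm h))⟩

/-! ### Points and lines -/

theorem tot_sup {U W : Submodule R M} (hU : Λ.Tot U) (hW : Λ.Tot W)
    (h : ∀ v ∈ U, ∀ w ∈ W, Λ.orth v w) : Λ.Tot (U ⊔ W) := by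
  constructor
  · intro v hv
    obtain ⟨a, ha, b, hb, rfl⟩ := Submodule.mem_sup.1 hv
    exact Λ.iso_add (hU.1 a ha) (hW.1 b hb) (h a ha b hb)
  · intro v hv w hw
    obtain ⟨a, ha, b, hb, rfl⟩ := Submodule.mem_sup.1 hv
    obtain ⟨a', ha', b', hb', rfl⟩ := Submodule.mem_sup.1 hw
    exact Λ.orth_add
      (Λ.orth_symm (Λ.orth_add (hU.2 a' ha' a ha) (h a' ha' b hb)))
      (Λ.orth_symm (Λ.orth_add (Λ.orth_symm (h a ha b' hb')) (hW.2 b' hb' b hb)))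

theorem tot_span_singleton {v : M} (hv : Λ.iso v) : Λ.Tot (Submodule.span R {v}) := by
  constructor
  · intro a ha
    obtain ⟨t, rfl⟩ := Submodule.mem_span_singleton.1 ha
    exact Λ.iso_smul t hv
  · intro a ha b hb
    obtain ⟨t, rfl⟩ := Submodule.mem_span_singleton.1 ha
    obtain ⟨s, rfl⟩ := Submodule.mem_span_singleton.1 hb
    exact Λ.orth_smul s (Λ.orth_symm (Λ.orth_smul t (Λ.orth_self hv)))

theorem orth_span_singleton {v w : M} (h : Λ.orth v w) :
    ∀ a ∈ Submodule.span R {v}, ∀ b ∈ Submodule.span R {w}, Λ.orth a b := by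
  intro a ha b hb
  obtain ⟨t, rfl⟩ := Submodule.mem_span_singleton.1 ha
  obtain ⟨s, rfl⟩ := Submodule.mem_span_singleton.1 hb
  exact Λ.orth_smul s (Λ.orth_symm (Λ.orth_smul t (Λ.orth_symm h)))

theorem tot_span_pair {v w : M} (hv : Λ.iso v) (hw : Λ.iso w) (h : Λ.orth v w) :
    Λ.Tot (Submodule.span R {v, w}) := by
  rw [Submodule.span_insert]
  exact tot_sup (tot_span_singleton hv) (tot_span_singleton hw) (orth_span_singleton h)

variable (Λ) in
/-- The point spanned by a non-zero isotropic vector. -/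
def mkPoint (v : M) (hv : Λ.iso v) (h0 : v ≠ 0) : Points Λ.Tot :=
  ⟨Submodule.span R {v}, finrank_span_singleton h0, tot_span_singleton hv⟩

theorem exists_eq_mkPoint (p : Points Λ.Tot) : ∃ v hv h0, p = Λ.mkPoint v hv h0 := by
  obtain ⟨U, hU, hT⟩ := p
  obtain ⟨⟨v, hvU⟩, h0, h⟩ := finrank_eq_one_iff'.1 hU
  refine ⟨v, hT.1 v hvU, fun e => h0 (Subtype.ext e), Subtype.ext (le_antisymm ?_ ?_)⟩
  · intro w hw
    obtain ⟨c, hc⟩ := h ⟨w, hw⟩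
    exact Submodule.mem_span_singleton.2 ⟨c, congrArg Subtype.val hc⟩
  · exact (Submodule.span_singleton_le_iff_mem v U).2 hvU

variable (Λ) in
/-- The line spanned by a totally isotropic subspace of dimension `2`. -/
def mkLine (E : Submodule R M) (hE : Module.finrank R E = 2) (hT : Λ.Tot E) : isoLines Λ.Tot :=
  ⟨{p | p.1 ≤ E}, E, hE, hT, rfl⟩

theorem exists_eq_mkLine (x : isoLines Λ.Tot) : ∃ E hE hT, x = Λ.mkLine E hE hT := by
  obtain ⟨x, E, hE, hT, rfl⟩ := x
  exact ⟨E, hE, hT, rfl⟩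

theorem mkPoint_mem_mkLine {v : M} {hv : Λ.iso v} {h0 : v ≠ 0} {E : Submodule R M}
    {hE : Module.finrank R E = 2} {hT : Λ.Tot E} :
    Λ.mkPoint v hv h0 ∈ (Λ.mkLine E hE hT).1 ↔ v ∈ E :=
  Submodule.span_singleton_le_iff_mem v E

theorem mkPoint_eq_iff {v w : M} {hv : Λ.iso v} {hv0 : v ≠ 0} {hw : Λ.iso w} {hw0 : w ≠ 0} :
    Λ.mkPoint v hv hv0 = Λ.mkPoint w hw hw0 ↔ w ∈ Submodule.span R {v} := by
  constructor
  · intro e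
    have : Submodule.span R {v} = Submodule.span R {w} := congrArg Subtype.val e
    rw [this]
    exact Submodule.mem_span_singleton_self w
  · intro h
    apply Subtype.ext
    obtain ⟨t, rfl⟩ := Submodule.mem_span_singleton.1 h
    have ht : t ≠ 0 := fun e => hw0 (by rw [e, zero_smul])
    exact (Submodule.span_singleton_smul_eq (IsUnit.mk0 t ht) v).symm

theorem mkPoint_mem_perp_iff {v w : M} {hv : Λ.iso v} {hv0 : v ≠ 0} {hw : Λ.iso w} {hw0 : w ≠ 0} :
    Λ.mkPoint w hw hw0 ∈ perp (isoLines Λ.Tot) (Λ.mkPoint v hv hv0) ↔ Λ.orth v w := by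
  constructor
  · rintro (e | ⟨x, hx, h1, h2⟩)
    · obtain ⟨t, rfl⟩ := Submodule.mem_span_singleton.1 (mkPoint_eq_iff.1 e.symm)
      exact Λ.orth_smul t (Λ.orth_self hv)
    · obtain ⟨E, hE, hT, e⟩ := exists_eq_mkLine ⟨x, hx⟩
      obtain rfl : x = _ := congrArg Subtype.val e
      exact hT.2 v (mkPoint_mem_mkLine.1 h1) w (mkPoint_mem_mkLine.1 h2)
  · intro h
    by_cases hs : w ∈ Submodule.span R {v}
    · exact .inl (mkPoint_eq_iff.2 hs).symm
    · refine .inr ⟨_, (Λ.mkLine _ (finrank_span_pair hv0 hs) (tot_span_pair hv hw h)).2,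
        mkPoint_mem_mkLine.2 ?_, mkPoint_mem_mkLine.2 ?_⟩
      · exact Submodule.subset_span (.inl rfl)
      · exact Submodule.subset_span (.inr rfl)

/-- Isotropic vectors `a`, `b`, `c`, `d` that form a quadrangle. -/
structure IsFrame (Λ : PolarForm R M) (a b c d : M) : Prop where
  iso_a : Λ.iso a
  iso_b : Λ.iso b
  iso_c : Λ.iso c
  iso_d : Λ.iso d
  orth_ab : Λ.orth a b
  orth_bc : Λ.orth b c
  orth_cd : Λ.orth c d
  orth_da : Λ.orth d a
  not_orth_ac : ¬ Λ.orth a c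
  not_orth_bd : ¬ Λ.orth b d

theorem isThick : IsThick (isoLines Λ.Tot) := by
  intro x hx
  obtain ⟨E, hE, hT, e⟩ := exists_eq_mkLine ⟨x, hx⟩
  obtain rfl : x = _ := congrArg Subtype.val e
  obtain ⟨a, ha, ha0⟩ := exists_ne_zero_mem hE
  obtain ⟨b, hb, hab⟩ := exists_notMem_span hE a
  have hb0 : b ≠ 0 := fun e => hab (by rw [e]; exact zero_mem _)
  have hab' : a + b ∉ Submodule.span R {a} := fun h => hab
    ((Submodule.add_mem_iff_right _ (Submodule.mem_span_singleton_self a)).1 h)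
  have hba' : a + b ∉ Submodule.span R {b} := fun h => notMem_span_singleton_comm ha0 hab
    ((Submodule.add_mem_iff_left _ (Submodule.mem_span_singleton_self b)).1 h)
  have hs0 : a + b ≠ 0 := fun e => hab' (by rw [e]; exact zero_mem _)
  let A := Λ.mkPoint a (hT.1 a ha) ha0
  let B := Λ.mkPoint b (hT.1 b hb) hb0
  let C := Λ.mkPoint (a + b) (hT.1 _ (add_mem ha hb)) hs0
  have h3 : ({A, B, C} : Set (Points Λ.Tot)).encard = 3 := Set.encard_eq_three.2
    ⟨A, B, C, fun e => hab (mkPoint_eq_iff.1 e), fun e => hab' (mkPoint_eq_iff.1 e),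
      fun e => hba' (mkPoint_eq_iff.1 e), rfl⟩
  rw [← h3]
  apply Set.encard_le_encard
  rintro p (rfl | rfl | rfl)
  exacts [mkPoint_mem_mkLine.2 ha, mkPoint_mem_mkLine.2 hb, mkPoint_mem_mkLine.2 (add_mem ha hb)]

/-- For v not orthogonal to all of E, v^⊥ cuts E in a hyperplane. It contains f + te, and a second
independent vector would make all of E orthogonal to v. -/
theorem isPolarSpace : IsPolarSpace (isoLines Λ.Tot) := by
  refine ⟨fun x hx => le_trans (by norm_num) (isThick x hx), fun p x hx => ?_⟩
  obtain ⟨E, hE, hT, e⟩ := exists_eq_mkLine ⟨x, hx⟩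
  obtain rfl : x = _ := congrArg Subtype.val e
  obtain ⟨v, hv, h0, rfl⟩ := exists_eq_mkPoint p
  by_cases H : ∀ w ∈ E, Λ.orth v w
  · right
    intro q hq
    obtain ⟨w, hw, hw0, rfl⟩ := exists_eq_mkPoint q
    exact mkPoint_mem_perp_iff.2 (H w (mkPoint_mem_mkLine.1 hq))
  · left
    push Not at H
    obtain ⟨e, heE, he⟩ := H
    obtain ⟨f, hfE, hf⟩ := exists_notMem_span hE e
    obtain ⟨t, ht⟩ := Λ.exists_orth he f
    have hrE : f + t • e ∈ E := add_mem hfE (E.smul_mem t heE)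
    have hr0 : f + t • e ≠ 0 := by
      intro h
      refine hf (Submodule.mem_span_singleton.2 ⟨-t, ?_⟩)
      rw [neg_smul]
      exact (eq_neg_of_add_eq_zero_left h).symm
    rw [Set.encard_eq_one]
    refine ⟨Λ.mkPoint _ (hT.1 _ hrE) hr0, Set.eq_singleton_iff_unique_mem.2
      ⟨⟨mkPoint_mem_perp_iff.2 ht, mkPoint_mem_mkLine.2 hrE⟩, ?_⟩⟩
    rintro q ⟨hq1, hq2⟩
    obtain ⟨w, hw, hw0, rfl⟩ := exists_eq_mkPoint q
    rw [mkPoint_mem_perp_iff] at hq1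
    rw [mkPoint_mem_mkLine] at hq2
    refine (mkPoint_eq_iff.2 ?_).symm
    by_contra hs
    have h1 := span_pair_eq hE hrE hq2 hr0 hs
    rw [← h1] at heE
    obtain ⟨s, s', hs'⟩ := Submodule.mem_span_pair.1 heE
    rw [← hs'] at he
    exact he (Λ.orth_add (Λ.orth_smul s ht) (Λ.orth_smul s' hq1))

theorem exists_line_frame {a b c d : M} (hf : Λ.IsFrame a b c d) (p : Points Λ.Tot) :
    ∃ x ∈ isoLines Λ.Tot, p ∈ x := by
  have ha0 : a ≠ 0 := ne_zero_of_not_orth fun h => hf.not_orth_ac (Λ.orth_symm h)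
  have hb0 : b ≠ 0 := ne_zero_of_not_orth fun h => hf.not_orth_bd (Λ.orth_symm h)
  have hi : b ∉ Submodule.span R {a} := by
    intro h
    obtain ⟨t, rfl⟩ := Submodule.mem_span_singleton.1 h
    exact hf.not_orth_bd (Λ.orth_symm (Λ.orth_smul t hf.orth_da))
  let x := Λ.mkLine _ (finrank_span_pair ha0 hi) (tot_span_pair hf.iso_a hf.iso_b hf.orth_ab)
  obtain ⟨q, hq, hqp⟩ := isPolarSpace.exists_mem_perp p x.2
  by_cases e : p = q
  · exact ⟨x, x.2, by rwa [e]⟩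
  · obtain ⟨y, hy, hpy, -⟩ := exists_line_of_mem_perp hqp e
    exact ⟨y, hy, hpy⟩

/-- The polar space of a non-degenerate form of Witt index at least `2`. -/
theorem isThickPolarSpace {a b c d : M} (hf : Λ.IsFrame a b c d) :
    IsThickPolarSpace (isoLines Λ.Tot) where
  nonempty := ⟨Λ.mkPoint a hf.iso_a
    (ne_zero_of_not_orth fun h => hf.not_orth_ac (Λ.orth_symm h))⟩
  polar := isPolarSpace
  thick := isThick
  nondegenerate := by
    intro p H
    obtain ⟨v, hv, h0, rfl⟩ := exists_eq_mkPoint p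
    obtain ⟨w, hw, hn⟩ := exists_not_orth hv h0
    have : Λ.mkPoint w hw (ne_zero_of_not_orth hn) ∈ perp (isoLines Λ.Tot) (Λ.mkPoint v hv h0) := by
      rw [H]
      trivial
    exact hn (mkPoint_mem_perp_iff.1 this)
  linear := by
    intro x hx y hy p q hpq hpx hqx hpy hqy
    obtain ⟨E, hE, hT, e⟩ := exists_eq_mkLine ⟨x, hx⟩
    obtain rfl : x = _ := congrArg Subtype.val e
    obtain ⟨E', hE', hT', e'⟩ := exists_eq_mkLine ⟨y, hy⟩
    obtain rfl : y = _ := congrArg Subtype.val e'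
    obtain ⟨v, hv, hv0, rfl⟩ := exists_eq_mkPoint p
    obtain ⟨w, hw, hw0, rfl⟩ := exists_eq_mkPoint q
    rw [mkPoint_mem_mkLine] at hpx hqx hpy hqy
    rw [Ne, mkPoint_eq_iff] at hpq
    have : E = E' := by
      rw [← span_pair_eq hE hpx hqx hv0 hpq, ← span_pair_eq hE' hpy hqy hv0 hpq]
    subst this
    rfl
  exists_line := exists_line_frame hf
  exists_opp := by
    intro p x hx y hy hpx hpy
    obtain ⟨E, hE, hT, e⟩ := exists_eq_mkLine ⟨x, hx⟩
    obtain rfl : x = _ := congrArg Subtype.val e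
    obtain ⟨E', hE', hT', e'⟩ := exists_eq_mkLine ⟨y, hy⟩
    obtain rfl : y = _ := congrArg Subtype.val e'
    obtain ⟨v, hv, hv0, rfl⟩ := exists_eq_mkPoint p
    rw [mkPoint_mem_mkLine] at hpx hpy
    obtain ⟨a, ha, hia⟩ := exists_notMem_span hE v
    obtain ⟨b, hb, hib⟩ := exists_notMem_span hE' v
    have ha0 : a ≠ 0 := fun e => hia (by rw [e]; exact zero_mem _)
    have hb0 : b ≠ 0 := fun e => hib (by rw [e]; exact zero_mem _)
    obtain ⟨c, hc, hvc, hac, hbc⟩ := exists_orth_not_orth_pair hv (hT.1 a ha) (hT'.1 b hb)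
      (hT.2 v hpx a ha) (hT'.2 v hpy b hb) hv0 hia hib
    have hic : c ∉ Submodule.span R {v} := by
      intro h
      obtain ⟨t, rfl⟩ := Submodule.mem_span_singleton.1 h
      exact hac (Λ.orth_smul t (hT.2 a ha v hpx))
    have hc0 := ne_zero_of_not_orth hac
    have hcE : c ∈ Submodule.span R {v, c} := Submodule.subset_span (.inr rfl)
    refine ⟨_, (Λ.mkLine _ (finrank_span_pair hv0 hic) (tot_span_pair hv hc hvc)).2,
      mkPoint_mem_mkLine.2 (Submodule.subset_span (.inl rfl)), ?_, ?_⟩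
    · exact ⟨Λ.mkPoint c hc hc0, mkPoint_mem_mkLine.2 hcE, Λ.mkPoint a (hT.1 a ha) ha0,
        mkPoint_mem_mkLine.2 ha, fun h => hac (Λ.orth_symm (mkPoint_mem_perp_iff.1 h))⟩
    · exact ⟨Λ.mkPoint c hc hc0, mkPoint_mem_mkLine.2 hcE, Λ.mkPoint b (hT'.1 b hb) hb0,
        mkPoint_mem_mkLine.2 hb, fun h => hbc (Λ.orth_symm (mkPoint_mem_perp_iff.1 h))⟩
  separates_points := by
    intro p q hpq
    obtain ⟨v, hv, hv0, rfl⟩ := exists_eq_mkPoint p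
    obtain ⟨w, hw, hw0, rfl⟩ := exists_eq_mkPoint q
    rw [Ne, mkPoint_eq_iff] at hpq
    by_cases h : Λ.orth v w
    · obtain ⟨c, hc, hvc, hwc⟩ := exists_orth_not_orth hv hw h hv0 hpq
      exact ⟨Λ.mkPoint c hc (ne_zero_of_not_orth hwc), mkPoint_mem_perp_iff.2 hvc,
        fun h => hwc (mkPoint_mem_perp_iff.1 h)⟩
    · exact ⟨_, mem_perp_self _, fun h' => h (Λ.orth_symm (mkPoint_mem_perp_iff.1 h'))⟩
  separates_lines := by
    intro x hx y hy hxy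
    obtain ⟨E, hE, hT, e⟩ := exists_eq_mkLine ⟨x, hx⟩
    obtain rfl : x = _ := congrArg Subtype.val e
    obtain ⟨E', hE', hT', e'⟩ := exists_eq_mkLine ⟨y, hy⟩
    obtain rfl : y = _ := congrArg Subtype.val e'
    obtain ⟨a, ha, ha0⟩ := exists_ne_zero_mem hE'
    obtain ⟨b, hb, hab⟩ := exists_notMem_span hE' a
    obtain ⟨p, hpE, hpE'⟩ : ∃ p ∈ E, p ∉ E' := by
      by_contra! H
      have : Module.Finite R E' := Module.finite_of_finrank_eq_succ hE'
      have := Submodule.eq_of_le_of_finrank_eq (show E ≤ E' from H) (hE.trans hE'.symm)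
      subst this
      exact hxy rfl
    have hp0 : p ≠ 0 := fun e => hpE' (by rw [e]; exact zero_mem _)
    obtain ⟨r, hr, hra, hrb, hrp⟩ := exists_separating (hT'.1 a ha) (hT'.1 b hb) (hT.1 p hpE)
      (hT'.2 a ha b hb) ha0 hab (by rwa [span_pair_eq hE' ha hb ha0 hab])
    have hr0 : r ≠ 0 := ne_zero_of_not_orth fun h => hrp (Λ.orth_symm h)
    refine ⟨Λ.mkPoint p (hT.1 p hpE) hp0, mkPoint_mem_mkLine.2 hpE, Λ.mkPoint r hr hr0,
      fun h => hrp (Λ.orth_symm (mkPoint_mem_perp_iff.1 h)), fun q hq => ?_⟩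
    obtain ⟨w, hw, hw0, rfl⟩ := exists_eq_mkPoint q
    rw [mkPoint_mem_mkLine, ← span_pair_eq hE' ha hb ha0 hab] at hq
    obtain ⟨s, t, rfl⟩ := Submodule.mem_span_pair.1 hq
    exact mkPoint_mem_perp_iff.2 (Λ.orth_add (Λ.orth_smul s hra) (Λ.orth_smul t hrb))

end PolarForm

end TitsQuad

namespace TitsQuad

open MulOpposite

namespace PolarForm

variable {R M : Type*} [DivisionRing R] [AddCommGroup M] [Module R M] {Λ : PolarForm R M}

/-! ### Automorphisms induced by isometries -/

theorem vertexSpace_mkPoint {v : M} (hv : Λ.iso v) (h0 : v ≠ 0) :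
    vertexSpace Λ.Tot (.inl (Λ.mkPoint v hv h0)) = Submodule.span R {v} := rfl

theorem vertexSpace_mkLine {E : Submodule R M} (hE : Module.finrank R E = 2) (hT : Λ.Tot E) :
    vertexSpace Λ.Tot (.inr (Λ.mkLine E hE hT)) = E := by
  refine le_antisymm (iSup₂_le fun p hp => hp) fun v hv => ?_
  by_cases h0 : v = 0
  · rw [h0]
    exact zero_mem _
  · have h1 : Λ.mkPoint v (hT.1 v hv) h0 ∈ (Λ.mkLine E hE hT).1 := mkPoint_mem_mkLine.2 hv
    exact (le_iSup₂_of_le (f := fun (p : Points Λ.Tot) (_ : p ∈ (Λ.mkLine E hE hT).1) => p.1)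
      _ h1 le_rfl) (Submodule.mem_span_singleton_self v)

theorem finrank_vertexSpace_inl (p : Points Λ.Tot) :
    Module.finrank R (vertexSpace Λ.Tot (.inl p)) = 1 := p.2.1

theorem finrank_vertexSpace_inr (x : isoLines Λ.Tot) :
    Module.finrank R (vertexSpace Λ.Tot (.inr x)) = 2 := by
  obtain ⟨E, hE, hT, rfl⟩ := exists_eq_mkLine x
  rwa [vertexSpace_mkLine]

theorem tot_vertexSpace (v : Points Λ.Tot ⊕ isoLines Λ.Tot) : Λ.Tot (vertexSpace Λ.Tot v) := by
  rcases v with p | x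
  · exact p.2.2
  · obtain ⟨E, hE, hT, rfl⟩ := exists_eq_mkLine x
    rwa [vertexSpace_mkLine]

theorem eq_mkPoint_of_vertexSpace {u : Points Λ.Tot ⊕ isoLines Λ.Tot} {e : M} (h0 : e ≠ 0)
    (h : vertexSpace Λ.Tot u = Submodule.span R {e}) : ∃ he, u = .inl (Λ.mkPoint e he h0) := by
  have he : Λ.iso e := (tot_vertexSpace u).1 e (by
    rw [h]
    exact Submodule.mem_span_singleton_self e)
  refine ⟨he, ?_⟩
  rcases u with p | x
  · exact congrArg Sum.inl (Subtype.ext h)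
  · have := finrank_vertexSpace_inr x
    rw [h, finrank_span_singleton h0] at this
    omega

theorem eq_mkLine_of_vertexSpace {u : Points Λ.Tot ⊕ isoLines Λ.Tot} {E : Submodule R M}
    (hE : Module.finrank R E = 2) (h : vertexSpace Λ.Tot u = E) :
    ∃ hT, u = .inr (Λ.mkLine E hE hT) := by
  refine ⟨h ▸ tot_vertexSpace u, ?_⟩
  rcases u with p | x
  · have := finrank_vertexSpace_inl p
    rw [h] at this
    omega
  · obtain ⟨E', hE', hT', rfl⟩ := exists_eq_mkLine x
    rw [vertexSpace_mkLine] at h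
    subst h
    rfl

theorem vertexSpace_injective : Function.Injective (vertexSpace Λ.Tot) := by
  intro u u' h
  rcases u with p | x
  · obtain ⟨v, hv, h0, rfl⟩ := exists_eq_mkPoint p
    obtain ⟨_, h'⟩ := eq_mkPoint_of_vertexSpace h0 h.symm
    exact h'.symm
  · obtain ⟨E, hE, hT, rfl⟩ := exists_eq_mkLine x
    rw [vertexSpace_mkLine] at h
    obtain ⟨_, h'⟩ := eq_mkLine_of_vertexSpace hE h.symm
    exact h'.symm

theorem mem_line_iff {p : Points Λ.Tot} {x : isoLines Λ.Tot} :
    p ∈ x.1 ↔ vertexSpace Λ.Tot (.inl p) ≤ vertexSpace Λ.Tot (.inr x) := by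
  obtain ⟨E, hE, hT, rfl⟩ := exists_eq_mkLine x
  rw [vertexSpace_mkLine]
  rfl

theorem opp_point_iff {p : Points Λ.Tot} {x y : isoLines Λ.Tot} :
    (incidenceGraph (isoLines Λ.Tot)).opp (.inl p) (.inr x) (.inr y) ↔ p ∈ x.1 ∧ p ∈ y.1 ∧
      ¬ ∀ v ∈ vertexSpace Λ.Tot (.inr x), ∀ w ∈ vertexSpace Λ.Tot (.inr y), Λ.orth v w := by
  rw [isPolarSpace.opp_point_iff]
  obtain ⟨E, hE, hT, rfl⟩ := exists_eq_mkLine x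
  obtain ⟨E', hE', hT', rfl⟩ := exists_eq_mkLine y
  rw [vertexSpace_mkLine, vertexSpace_mkLine]
  refine and_congr_right fun _ => and_congr_right fun _ => ⟨?_, fun H => ?_⟩
  · rintro ⟨b, hb, c, hc, hn⟩ H
    obtain ⟨v, hv, hv0, rfl⟩ := exists_eq_mkPoint b
    obtain ⟨w, hw, hw0, rfl⟩ := exists_eq_mkPoint c
    exact hn (mkPoint_mem_perp_iff.2 (H v (mkPoint_mem_mkLine.1 hb) w (mkPoint_mem_mkLine.1 hc)))
  · push Not at H
    obtain ⟨v, hv, w, hw, hn⟩ := H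
    exact ⟨Λ.mkPoint v (hT.1 v hv) (ne_zero_of_not_orth fun h => hn (Λ.orth_symm h)),
      mkPoint_mem_mkLine.2 hv, Λ.mkPoint w (hT'.1 w hw) (ne_zero_of_not_orth hn),
      mkPoint_mem_mkLine.2 hw, fun h => hn (mkPoint_mem_perp_iff.1 h)⟩

/-- Linear automorphisms that preserve isotropy and orthogonality. -/
structure IsIsom (Λ : PolarForm R M) (φ : M ≃ₗ[R] M) : Prop where
  iso_iff : ∀ v, Λ.iso (φ v) ↔ Λ.iso v
  orth_iff : ∀ v w, Λ.orth (φ v) (φ w) ↔ Λ.orth v w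

variable {φ ψ : M ≃ₗ[R] M}

theorem IsIsom.symm (hφ : Λ.IsIsom φ) : Λ.IsIsom φ.symm :=
  ⟨fun v => by rw [← hφ.iso_iff, φ.apply_symm_apply],
    fun v w => by rw [← hφ.orth_iff, φ.apply_symm_apply, φ.apply_symm_apply]⟩

theorem IsIsom.trans (hφ : Λ.IsIsom φ) (hψ : Λ.IsIsom ψ) : Λ.IsIsom (φ.trans ψ) :=
  ⟨fun v => (hψ.iso_iff _).trans (hφ.iso_iff v), fun v w => (hψ.orth_iff _ _).trans (hφ.orth_iff v w)⟩

theorem IsIsom.tot_map (hφ : Λ.IsIsom φ) {U : Submodule R M} (hU : Λ.Tot U) :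
    Λ.Tot (U.map (φ : M →ₗ[R] M)) := by
  constructor
  · rintro _ ⟨v, hv, rfl⟩
    exact (hφ.iso_iff v).2 (hU.1 v hv)
  · rintro _ ⟨v, hv, rfl⟩ _ ⟨w, hw, rfl⟩
    exact (hφ.orth_iff v w).2 (hU.2 v hv w hw)

/-- The action of an isometry on points and lines. -/
def mapVertex (hφ : Λ.IsIsom φ) :
    Points Λ.Tot ⊕ isoLines Λ.Tot → Points Λ.Tot ⊕ isoLines Λ.Tot
  | .inl p => .inl ⟨p.1.map (φ : M →ₗ[R] M), (φ.finrank_map_eq p.1).trans p.2.1,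
      hφ.tot_map p.2.2⟩
  | .inr x => .inr (Λ.mkLine ((vertexSpace Λ.Tot (.inr x)).map (φ : M →ₗ[R] M))
      ((φ.finrank_map_eq _).trans (finrank_vertexSpace_inr x)) (hφ.tot_map (tot_vertexSpace _)))

theorem vertexSpace_mapVertex (hφ : Λ.IsIsom φ) (v : Points Λ.Tot ⊕ isoLines Λ.Tot) :
    vertexSpace Λ.Tot (mapVertex hφ v) = (vertexSpace Λ.Tot v).map (φ : M →ₗ[R] M) := by
  rcases v with p | x
  · rfl
  · exact vertexSpace_mkLine _ _

/-- The permutation of the set of points and lines that is induced by an isometry. -/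
def induced (hφ : Λ.IsIsom φ) : (Equiv.Perm (Points Λ.Tot ⊕ isoLines Λ.Tot))ᵐᵒᵖ :=
  op
    { toFun := mapVertex hφ
      invFun := mapVertex hφ.symm
      left_inv := fun v => vertexSpace_injective (by
        rw [vertexSpace_mapVertex, vertexSpace_mapVertex, ← Submodule.map_comp]
        convert Submodule.map_id _
        ext v
        simp)
      right_inv := fun v => vertexSpace_injective (by
        rw [vertexSpace_mapVertex, vertexSpace_mapVertex, ← Submodule.map_comp]
        convert Submodule.map_id _
        ext v
        simp) }

theorem induces_induced (hφ : Λ.IsIsom φ) : Induces Λ.Tot φ (induced hφ) :=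
  vertexSpace_mapVertex hφ

theorem unop_induced_eq_iff (hφ : Λ.IsIsom φ) {u v : Points Λ.Tot ⊕ isoLines Λ.Tot} :
    unop (induced hφ) u = v ↔
      (vertexSpace Λ.Tot u).map (φ : M →ₗ[R] M) = vertexSpace Λ.Tot v := by
  rw [← vertexSpace_injective.eq_iff, induces_induced]

/-- The group is opposite to `Equiv.Perm`, so the left factor acts first, in agreement with
`LinearEquiv.trans`. -/
theorem induced_mul (hφ : Λ.IsIsom φ) (hψ : Λ.IsIsom ψ) :
    induced hφ * induced hψ = induced (hφ.trans hψ) := by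
  apply unop_injective
  ext v
  apply vertexSpace_injective
  rw [induces_induced]
  change vertexSpace Λ.Tot (unop (induced hψ) (unop (induced hφ) v)) = _
  rw [induces_induced, induces_induced, ← Submodule.map_comp]
  rfl

theorem induced_congr (hφ : Λ.IsIsom φ) (hψ : Λ.IsIsom ψ) (h : ∀ v, φ v = ψ v) :
    induced hφ = induced hψ := by
  obtain rfl : φ = ψ := LinearEquiv.ext h
  rfl

theorem map_le_map_iff (U W : Submodule R M) :
    U.map (φ : M →ₗ[R] M) ≤ W.map (φ : M →ₗ[R] M) ↔ U ≤ W :=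
  Submodule.map_le_map_iff_of_injective φ.injective U W

theorem mapVertex_mem_iff (hφ : Λ.IsIsom φ) {p p' : Points Λ.Tot} {x x' : isoLines Λ.Tot}
    (hp : mapVertex hφ (.inl p) = .inl p') (hx : mapVertex hφ (.inr x) = .inr x') :
    p' ∈ x'.1 ↔ p ∈ x.1 := by
  rw [mem_line_iff, mem_line_iff, ← hp, ← hx, vertexSpace_mapVertex, vertexSpace_mapVertex,
    map_le_map_iff]

theorem induced_mem_aut (hφ : Λ.IsIsom φ) :
    induced hφ ∈ (incidenceGraph (isoLines Λ.Tot)).Aut := by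
  constructor
  · rintro (p | x) (q | y)
    · exact Iff.rfl
    · exact mapVertex_mem_iff hφ rfl rfl
    · exact mapVertex_mem_iff hφ rfl rfl
    · exact Iff.rfl
  · rintro (p | x) (q | y) (r | z)
    · exact Iff.rfl
    · exact Iff.rfl
    · exact Iff.rfl
    · change (incidenceGraph (isoLines Λ.Tot)).opp (.inl _) (.inr _) (.inr _) ↔ _
      rw [opp_point_iff, opp_point_iff, mapVertex_mem_iff hφ (x := y) (p := p) rfl rfl,
        mapVertex_mem_iff hφ (x := z) (p := p) rfl rfl, vertexSpace_mkLine, vertexSpace_mkLine]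
      refine and_congr_right fun _ => and_congr_right fun _ => not_congr ⟨?_, ?_⟩
      · intro H v hv w hw
        exact (hφ.orth_iff v w).1 (H _ ⟨v, hv, rfl⟩ _ ⟨w, hw, rfl⟩)
      · rintro H _ ⟨v, hv, rfl⟩ _ ⟨w, hw, rfl⟩
        exact (hφ.orth_iff v w).2 (H v hv w hw)
    · refine and_congr (mapVertex_mem_iff hφ rfl rfl) (and_congr (mapVertex_mem_iff hφ rfl rfl) ?_)
      have := (unop (induced hφ)).injective.ne_iff (x := .inl q) (y := .inl r)
      rw [Sum.inl_injective.ne_iff] at this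
      rw [← this]
      exact Sum.inl_injective.ne_iff.symm
    · exact Iff.rfl
    · exact Iff.rfl
    · exact Iff.rfl

/-! ### Root groups -/

theorem map_span_singleton_eq {e f : M} (h : φ e = f) :
    (Submodule.span R {e}).map (φ : M →ₗ[R] M) = Submodule.span R {f} := by
  rw [Submodule.map_span, Set.image_singleton]
  exact congrArg _ (congrArg _ h)

theorem map_span_pair_eq {a b c d : M} (h : φ a = c) (h' : φ b = d) :
    (Submodule.span R {a, b}).map (φ : M →ₗ[R] M) = Submodule.span R {c, d} := by
  rw [Submodule.map_span, Set.image_pair]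
  change Submodule.span R {φ a, φ b} = _
  rw [h, h']

/-- Lines on the point ⟨e⟩ are subspaces between ⟨e⟩ and e^⊥, and the condition says that φ induces
the identity on e^⊥/⟨e⟩. -/
theorem fixesNeighbours_point (hφ : Λ.IsIsom φ) {u : Points Λ.Tot ⊕ isoLines Λ.Tot} {e : M}
    (h0 : e ≠ 0) (hu : vertexSpace Λ.Tot u = Submodule.span R {e})
    (h : ∀ v, Λ.orth e v → φ v - v ∈ Submodule.span R {e}) :
    (incidenceGraph (isoLines Λ.Tot)).FixesNeighbours (induced hφ) u := by
  obtain ⟨hi, rfl⟩ := eq_mkPoint_of_vertexSpace h0 hu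
  intro y hy
  obtain ⟨y, rfl, hy'⟩ := adj_inl_iff.1 hy
  obtain ⟨E, hE, hT, rfl⟩ := exists_eq_mkLine y
  rw [mkPoint_mem_mkLine] at hy'
  rw [unop_induced_eq_iff, vertexSpace_mkLine]
  have : Module.Finite R E := Module.finite_of_finrank_eq_succ hE
  refine Submodule.eq_of_le_of_finrank_eq ?_ (φ.finrank_map_eq E)
  rintro _ ⟨v, hv, rfl⟩
  have h1 := E.add_mem ((Submodule.span_singleton_le_iff_mem e E).2 hy'
    (h v (hT.2 e hy' v hv))) hv
  rwa [sub_add_cancel] at h1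

theorem fixesNeighbours_line (hφ : Λ.IsIsom φ) {u : Points Λ.Tot ⊕ isoLines Λ.Tot} {a b : M}
    (hE : Module.finrank R (Submodule.span R {a, b}) = 2)
    (hu : vertexSpace Λ.Tot u = Submodule.span R {a, b}) (ha : φ a = a) (hb : φ b = b) :
    (incidenceGraph (isoLines Λ.Tot)).FixesNeighbours (induced hφ) u := by
  obtain ⟨hT, rfl⟩ := eq_mkLine_of_vertexSpace hE hu
  intro p hp
  obtain ⟨p, rfl, hp'⟩ := adj_inr_iff.1 hp
  obtain ⟨v, hv, h0, rfl⟩ := exists_eq_mkPoint p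
  rw [mkPoint_mem_mkLine] at hp'
  rw [unop_induced_eq_iff, vertexSpace_mkPoint]
  refine map_span_singleton_eq ?_
  obtain ⟨s, t, rfl⟩ := Submodule.mem_span_pair.1 hp'
  rw [map_add, map_smul, map_smul, ha, hb]

variable {A : Type*} [Group A]

/-- A family of isometries, parametrized by a group, gives a group of permutations. -/
def inducedHom (φ : A → M ≃ₗ[R] M) (hφ : ∀ a, Λ.IsIsom (φ a))
    (hmul : ∀ a b v, φ (a * b) v = φ b (φ a v)) :
    A →* (Equiv.Perm (Points Λ.Tot ⊕ isoLines Λ.Tot))ᵐᵒᵖ :=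
  MonoidHom.mk' (fun a => induced (hφ a)) fun a b => by
    rw [induced_mul]
    exact induced_congr _ _ (hmul a b)

/-- The root group of a root from a line to a line. -/
theorem exists_mulEquiv_line
    (hΓ : (incidenceGraph (isoLines Λ.Tot)).IsVeldkampPolygon 4)
    {w : ZMod (2 * 4) → Points Λ.Tot ⊕ isoLines Λ.Tot}
    (hw : (incidenceGraph (isoLines Λ.Tot)).IsStraightCircuit 4 w) (i : ZMod (2 * 4)) {b c d : M}
    (hb0 : b ≠ 0) (hc0 : c ≠ 0)
    (h1 : vertexSpace Λ.Tot (w (i + 1)) = Submodule.span R {b})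
    (h2 : vertexSpace Λ.Tot (w (i + 2)) = Submodule.span R {b, c})
    (h3 : vertexSpace Λ.Tot (w (i + 3)) = Submodule.span R {c})
    (h4 : vertexSpace Λ.Tot (w (i + 4)) = Submodule.span R {c, d})
    (h5 : vertexSpace Λ.Tot (w (i + 5)) = Submodule.span R {d})
    (hbc : c ∉ Submodule.span R {b}) (hcd : d ∉ Submodule.span R {c})
    (φ : A → M ≃ₗ[R] M) (hφ : ∀ a, Λ.IsIsom (φ a)) (hmul : ∀ a b v, φ (a * b) v = φ b (φ a v))
    (hb : ∀ a, φ a b = b) (hc : ∀ a, φ a c = c)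
    (hb' : ∀ a v, Λ.orth b v → φ a v - v ∈ Submodule.span R {b})
    (hc' : ∀ a v, Λ.orth c v → φ a v - v ∈ Submodule.span R {c})
    (hinj : ∀ a, φ a d ∈ Submodule.span R {d} → a = 1)
    (hsurj : ∀ s : R, ∃ a, φ a d = d + s • c) :
    (∃ e : A ≃* (incidenceGraph (isoLines Λ.Tot)).labelling 4 w i,
      ∀ a, (e a : (Equiv.Perm (Points Λ.Tot ⊕ isoLines Λ.Tot))ᵐᵒᵖ) = induced (hφ a)) ∧
    (incidenceGraph (isoLines Λ.Tot)).RootTransitive fun j => w (j + i) := by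
  have hmem : ∀ a, inducedHom φ hφ hmul a ∈ (incidenceGraph (isoLines Λ.Tot)).labelling 4 w i :=
    fun a => OppGraph.mem_labelling.2 ⟨induced_mem_aut _,
      fixesNeighbours_point (hφ a) hb0 h1 (hb' a),
      fixesNeighbours_line (hφ a) (finrank_span_pair hb0 hbc) h2 (hb a) (hc a),
      fixesNeighbours_point (hφ a) hc0 h3 (hc' a)⟩
  have htrans : ∀ u, (incidenceGraph (isoLines Λ.Tot)).opp (w (i + 4)) (w (i + 3)) u →
      ∃ a, unop (inducedHom φ hφ hmul a) (w (i + 5)) = u := by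
    intro u hu
    obtain ⟨hT, e4⟩ := eq_mkLine_of_vertexSpace (finrank_span_pair hc0 hcd) h4
    obtain ⟨hc3, e3⟩ := eq_mkPoint_of_vertexSpace hc0 h3
    rw [e3, e4] at hu
    obtain ⟨p, rfl, hp⟩ := adj_inr_iff.1 (OppGraph.opp_adj _ hu).2
    obtain ⟨v, hv, hv0, rfl⟩ := exists_eq_mkPoint p
    have hne := hu.2.2
    rw [mkPoint_mem_mkLine] at hp
    rw [Ne, mkPoint_eq_iff] at hne
    -- A point of the line cd other than ⟨c⟩ has t ≠ 0 and is spanned by d + s c for a scalar s,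
    -- which is the image of d under a suitable member of the family.
    obtain ⟨s, t, rfl⟩ := Submodule.mem_span_pair.1 hp
    have ht : t ≠ 0 := by
      rintro rfl
      exact hne (Submodule.mem_span_singleton.2 ⟨s, by simp⟩)
    obtain ⟨a, ha⟩ := hsurj (t⁻¹ * s)
    refine ⟨a, (unop_induced_eq_iff (hφ a)).2 ?_⟩
    rw [h5, map_span_singleton_eq ha, vertexSpace_mkPoint]
    have e : s • c + t • d = t • (d + (t⁻¹ * s) • c) := by
      rw [smul_add, smul_smul, mul_inv_cancel_left₀ ht, add_comm]
    rw [e, Submodule.span_singleton_smul_eq (IsUnit.mk0 t ht)]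
  refine ⟨hΓ.exists_mulEquiv hw i (inducedHom φ hφ hmul) hmem ?_ htrans,
    OppGraph.rootTransitive_of_mulEquiv hmem htrans⟩
  intro a ha
  refine hinj a ?_
  have := (unop_induced_eq_iff (hφ a)).1 ha
  rw [h5] at this
  rw [← this]
  exact ⟨d, Submodule.mem_span_singleton_self d, rfl⟩

/-- The root group of a root from a point to a point. -/
theorem exists_mulEquiv_point
    (hΓ : (incidenceGraph (isoLines Λ.Tot)).IsVeldkampPolygon 4)
    {w : ZMod (2 * 4) → Points Λ.Tot ⊕ isoLines Λ.Tot}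
    (hw : (incidenceGraph (isoLines Λ.Tot)).IsStraightCircuit 4 w) (i : ZMod (2 * 4)) {b c d a : M}
    (hb0 : b ≠ 0) (hc0 : c ≠ 0) (hd0 : d ≠ 0)
    (h1 : vertexSpace Λ.Tot (w (i + 1)) = Submodule.span R {b, c})
    (h2 : vertexSpace Λ.Tot (w (i + 2)) = Submodule.span R {c})
    (h3 : vertexSpace Λ.Tot (w (i + 3)) = Submodule.span R {c, d})
    (h4 : vertexSpace Λ.Tot (w (i + 4)) = Submodule.span R {d})
    (h5 : vertexSpace Λ.Tot (w (i + 5)) = Submodule.span R {d, a})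
    (hbc : c ∉ Submodule.span R {b}) (hcd : d ∉ Submodule.span R {c})
    (hda : a ∉ Submodule.span R {d}) (hbd : ¬ Λ.orth b d)
    (φ : A → M ≃ₗ[R] M) (hφ : ∀ x, Λ.IsIsom (φ x)) (hmul : ∀ x y v, φ (x * y) v = φ y (φ x v))
    (hb : ∀ x, φ x b = b) (hc : ∀ x, φ x c = c) (hd : ∀ x, φ x d = d)
    (hc' : ∀ x v, Λ.orth c v → φ x v - v ∈ Submodule.span R {c})
    (hinj : ∀ x, φ x a ∈ Submodule.span R {d, a} → x = 1)
    (hsurj : ∀ v, Λ.iso v → Λ.orth d v → Λ.orth b v → ¬ Λ.orth c v →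
      ∃ x, φ x a ∈ Submodule.span R {v}) :
    (∃ e : A ≃* (incidenceGraph (isoLines Λ.Tot)).labelling 4 w i,
      ∀ x, (e x : (Equiv.Perm (Points Λ.Tot ⊕ isoLines Λ.Tot))ᵐᵒᵖ) = induced (hφ x)) ∧
    (incidenceGraph (isoLines Λ.Tot)).RootTransitive fun j => w (j + i) := by
  have hmem : ∀ x, inducedHom φ hφ hmul x ∈ (incidenceGraph (isoLines Λ.Tot)).labelling 4 w i :=
    fun x => OppGraph.mem_labelling.2 ⟨induced_mem_aut _,
      fixesNeighbours_line (hφ x) (finrank_span_pair hb0 hbc) h1 (hb x) (hc x),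
      fixesNeighbours_point (hφ x) hc0 h2 (hc' x),
      fixesNeighbours_line (hφ x) (finrank_span_pair hc0 hcd) h3 (hc x) (hd x)⟩
  have htrans : ∀ u, (incidenceGraph (isoLines Λ.Tot)).opp (w (i + 4)) (w (i + 3)) u →
      ∃ x, unop (inducedHom φ hφ hmul x) (w (i + 5)) = u := by
    intro u hu
    obtain ⟨hT, e3⟩ := eq_mkLine_of_vertexSpace (finrank_span_pair hc0 hcd) h3
    obtain ⟨hd4, e4⟩ := eq_mkPoint_of_vertexSpace hd0 h4
    rw [e3, e4] at hu
    obtain ⟨y, rfl, hy⟩ := adj_inl_iff.1 (OppGraph.opp_adj _ hu).2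
    have hn := (opp_point_iff.1 hu).2.2
    obtain ⟨E, hE, hT', rfl⟩ := exists_eq_mkLine y
    rw [mkPoint_mem_mkLine] at hy
    rw [vertexSpace_mkLine, vertexSpace_mkLine] at hn
    -- Since d is not orthogonal to b, the line E on d is spanned by d and a vector orthogonal to b.
    -- If that vector were also orthogonal to c, then E would be orthogonal to cd, contrary to
    -- opposition at d.
    obtain ⟨v₀, hv₀, hi₀⟩ := exists_notMem_span hE d
    obtain ⟨t, ht⟩ := Λ.exists_orth hbd v₀
    have hvE : v₀ + t • d ∈ E := add_mem hv₀ (E.smul_mem t hy)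
    have hi : v₀ + t • d ∉ Submodule.span R {d} := fun h => hi₀
      ((Submodule.add_mem_iff_left _ (Submodule.smul_mem _ t
        (Submodule.mem_span_singleton_self d))).1 h)
    have hE' := span_pair_eq hE hy hvE hd0 hi
    obtain ⟨x, hx⟩ := hsurj _ (hT'.1 _ hvE) (hT'.2 d hy _ hvE) ht fun hcv => hn <| by
      intro v hv w hw
      rw [← hE'] at hw
      obtain ⟨s, s', rfl⟩ := Submodule.mem_span_pair.1 hv
      obtain ⟨r, r', rfl⟩ := Submodule.mem_span_pair.1 hw
      have hcT : c ∈ Submodule.span R {c, d} := Submodule.subset_span (.inl rfl)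
      have hdT : d ∈ Submodule.span R {c, d} := Submodule.subset_span (.inr rfl)
      have h1 : Λ.orth c (r • d + r' • (v₀ + t • d)) :=
        Λ.orth_add (Λ.orth_smul r (hT.2 c hcT d hdT)) (Λ.orth_smul r' hcv)
      have h2 : Λ.orth d (r • d + r' • (v₀ + t • d)) :=
        Λ.orth_add (Λ.orth_smul r (Λ.orth_self hd4)) (Λ.orth_smul r' (hT'.2 d hy _ hvE))
      exact Λ.orth_symm (Λ.orth_add (Λ.orth_smul s (Λ.orth_symm h1))
        (Λ.orth_smul s' (Λ.orth_symm h2)))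
    refine ⟨x, (unop_induced_eq_iff (hφ x)).2 ?_⟩
    rw [h5, map_span_pair_eq (hd x) rfl, vertexSpace_mkLine]
    refine span_pair_eq hE hy ((Submodule.span_singleton_le_iff_mem _ E).2 hvE hx) hd0 fun h => ?_
    rw [← map_span_singleton_eq (φ := φ x) (hd x)] at h
    obtain ⟨a', ha', e⟩ := h
    obtain rfl := (φ x).injective e
    exact hda ha'
  refine ⟨hΓ.exists_mulEquiv hw i (inducedHom φ hφ hmul) hmem ?_ htrans,
    OppGraph.rootTransitive_of_mulEquiv hmem htrans⟩
  intro x hx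
  refine hinj x ?_
  have := (unop_induced_eq_iff (hφ x)).1 hx
  rw [h5] at this
  rw [← this]
  exact ⟨a, Submodule.subset_span (.inr rfl), rfl⟩

/-! ### The circuit of a frame -/

section Frame

variable {a b c d : M}

theorem IsFrame.rotate (hf : Λ.IsFrame a b c d) : Λ.IsFrame b c d a :=
  ⟨hf.iso_b, hf.iso_c, hf.iso_d, hf.iso_a, hf.orth_bc, hf.orth_cd, hf.orth_da, hf.orth_ab,
    hf.not_orth_bd, fun h => hf.not_orth_ac (Λ.orth_symm h)⟩

theorem IsFrame.ne_zero (hf : Λ.IsFrame a b c d) : a ≠ 0 :=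
  ne_zero_of_not_orth fun h => hf.not_orth_ac (Λ.orth_symm h)

theorem IsFrame.notMem_span (hf : Λ.IsFrame a b c d) : b ∉ Submodule.span R {a} := by
  intro h
  obtain ⟨t, rfl⟩ := Submodule.mem_span_singleton.1 h
  exact hf.not_orth_bd (Λ.orth_symm (Λ.orth_smul t hf.orth_da))

theorem IsFrame.finrank_span (hf : Λ.IsFrame a b c d) :
    Module.finrank R (Submodule.span R {a, b}) = 2 :=
  finrank_span_pair hf.ne_zero hf.notMem_span

theorem IsFrame.tot_span (hf : Λ.IsFrame a b c d) : Λ.Tot (Submodule.span R {a, b}) :=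
  tot_span_pair hf.iso_a hf.iso_b hf.orth_ab

/-- The circuit `a, ab, b, bc, c, cd, d, da`. -/
def frameCircuit (hf : Λ.IsFrame a b c d) : ZMod (2 * 4) → Points Λ.Tot ⊕ isoLines Λ.Tot :=
  quadCircuit (Λ.mkPoint a hf.iso_a hf.ne_zero) (Λ.mkPoint b hf.iso_b hf.rotate.ne_zero)
    (Λ.mkPoint c hf.iso_c hf.rotate.rotate.ne_zero)
    (Λ.mkPoint d hf.iso_d hf.rotate.rotate.rotate.ne_zero)
    (Λ.mkLine _ hf.finrank_span hf.tot_span) (Λ.mkLine _ hf.rotate.finrank_span hf.rotate.tot_span)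
    (Λ.mkLine _ hf.rotate.rotate.finrank_span hf.rotate.rotate.tot_span)
    (Λ.mkLine _ hf.rotate.rotate.rotate.finrank_span hf.rotate.rotate.rotate.tot_span)

variable (hf : Λ.IsFrame a b c d)

theorem isStraightCircuit_frameCircuit :
    (incidenceGraph (isoLines Λ.Tot)).IsStraightCircuit 4 (frameCircuit hf) := by
  refine IsThickPolarSpace.isStraightCircuit_quadCircuit isPolarSpace ?_ ?_ ?_ ?_ ?_ ?_ ?_ ?_
    (fun h => hf.not_orth_ac (mkPoint_mem_perp_iff.1 h))
    (fun h => hf.not_orth_bd (mkPoint_mem_perp_iff.1 h)) <;>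
  refine mkPoint_mem_mkLine.2 (Submodule.subset_span ?_)
  exacts [.inl rfl, .inr rfl, .inl rfl, .inr rfl, .inl rfl, .inr rfl, .inl rfl, .inr rfl]

theorem vertexSpace_frameCircuit_zero :
    vertexSpace Λ.Tot (frameCircuit hf 0) = Submodule.span R {a} := rfl

theorem vertexSpace_frameCircuit_one :
    vertexSpace Λ.Tot (frameCircuit hf 1) = Submodule.span R {a, b} := vertexSpace_mkLine _ _

theorem vertexSpace_frameCircuit_two :
    vertexSpace Λ.Tot (frameCircuit hf 2) = Submodule.span R {b} := rfl

theorem vertexSpace_frameCircuit_three :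
    vertexSpace Λ.Tot (frameCircuit hf 3) = Submodule.span R {b, c} := vertexSpace_mkLine _ _

theorem vertexSpace_frameCircuit_four :
    vertexSpace Λ.Tot (frameCircuit hf 4) = Submodule.span R {c} := rfl

theorem vertexSpace_frameCircuit_five :
    vertexSpace Λ.Tot (frameCircuit hf 5) = Submodule.span R {c, d} := vertexSpace_mkLine _ _

theorem vertexSpace_frameCircuit_six :
    vertexSpace Λ.Tot (frameCircuit hf 6) = Submodule.span R {d} := rfl

theorem vertexSpace_frameCircuit_seven :
    vertexSpace Λ.Tot (frameCircuit hf 7) = Submodule.span R {d, a} := vertexSpace_mkLine _ _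

theorem span_smul_singleton {t : R} (ht : t ≠ 0) (a : M) :
    Submodule.span R {t • a} = Submodule.span R {a} :=
  Submodule.span_singleton_smul_eq (IsUnit.mk0 t ht) a

theorem span_smul_pair {s t : R} (hs : s ≠ 0) (ht : t ≠ 0) (a b : M) :
    Submodule.span R {s • a, t • b} = Submodule.span R {a, b} := by
  rw [Submodule.span_insert, Submodule.span_insert, span_smul_singleton hs, span_smul_singleton ht]

/-- Scalars are allowed because in the skew-hermitian case a cyclic permutation of the basis is an
isometry only after a change of sign. -/
theorem unop_induced_rotate (hφ : Λ.IsIsom φ) {s₁ s₂ s₃ s₄ : R} (h₁ : s₁ ≠ 0) (h₂ : s₂ ≠ 0)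
    (h₃ : s₃ ≠ 0) (h₄ : s₄ ≠ 0) (ha : φ a = s₁ • b) (hb : φ b = s₂ • c) (hc : φ c = s₃ • d)
    (hd : φ d = s₄ • a) (i : ZMod (2 * 4)) :
    unop (induced hφ) (frameCircuit hf i) = frameCircuit hf (i + 2) := by
  rw [unop_induced_eq_iff]
  revert i
  exact fun
    | 0 => (map_span_singleton_eq ha).trans (span_smul_singleton h₁ b)
    | 1 => by
      rw [vertexSpace_frameCircuit_one, map_span_pair_eq ha hb, span_smul_pair h₁ h₂]
      exact (vertexSpace_frameCircuit_three hf).symm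
    | 2 => (map_span_singleton_eq hb).trans (span_smul_singleton h₂ c)
    | 3 => by
      rw [vertexSpace_frameCircuit_three, map_span_pair_eq hb hc, span_smul_pair h₂ h₃]
      exact (vertexSpace_frameCircuit_five hf).symm
    | 4 => (map_span_singleton_eq hc).trans (span_smul_singleton h₃ d)
    | 5 => by
      rw [vertexSpace_frameCircuit_five, map_span_pair_eq hc hd, span_smul_pair h₃ h₄]
      exact (vertexSpace_frameCircuit_seven hf).symm
    | 6 => (map_span_singleton_eq hd).trans (span_smul_singleton h₄ a)
    | 7 => by
      rw [vertexSpace_frameCircuit_seven, map_span_pair_eq hd ha, span_smul_pair h₄ h₁]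
      exact (vertexSpace_frameCircuit_one hf).symm

theorem unop_induced_reflect (hφ : Λ.IsIsom φ) {s₁ s₂ s₃ s₄ : R} (h₁ : s₁ ≠ 0) (h₂ : s₂ ≠ 0)
    (h₃ : s₃ ≠ 0) (h₄ : s₄ ≠ 0) (ha : φ a = s₁ • a) (hb : φ b = s₂ • d) (hc : φ c = s₃ • c)
    (hd : φ d = s₄ • b) (i : ZMod (2 * 4)) :
    unop (induced hφ) (frameCircuit hf i) = frameCircuit hf (-i) := by
  rw [unop_induced_eq_iff]
  revert i
  exact fun
    | 0 => (map_span_singleton_eq ha).trans (span_smul_singleton h₁ a)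
    | 1 => by
      rw [vertexSpace_frameCircuit_one, map_span_pair_eq ha hb, span_smul_pair h₁ h₂, Set.pair_comm]
      exact (vertexSpace_frameCircuit_seven hf).symm
    | 2 => (map_span_singleton_eq hb).trans (span_smul_singleton h₂ d)
    | 3 => by
      rw [vertexSpace_frameCircuit_three, map_span_pair_eq hb hc, span_smul_pair h₂ h₃,
        Set.pair_comm]
      exact (vertexSpace_frameCircuit_five hf).symm
    | 4 => (map_span_singleton_eq hc).trans (span_smul_singleton h₃ c)
    | 5 => by
      rw [vertexSpace_frameCircuit_five, map_span_pair_eq hc hd, span_smul_pair h₃ h₄,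
        Set.pair_comm]
      exact (vertexSpace_frameCircuit_three hf).symm
    | 6 => (map_span_singleton_eq hd).trans (span_smul_singleton h₄ b)
    | 7 => by
      rw [vertexSpace_frameCircuit_seven, map_span_pair_eq hd ha, span_smul_pair h₄ h₁,
        Set.pair_comm]
      exact (vertexSpace_frameCircuit_one hf).symm

end Frame

end PolarForm

/-- `[x, y⁻¹] = z` in terms of products. -/
theorem comm_inv_eq {G : Type*} [Group G] {x y z : G} (h : y * x = x * z * y) :
    comm x y⁻¹ = z := by
  rw [comm, inv_inv, mul_assoc x⁻¹, h]
  group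

end TitsQuad

namespace TitsQuad

open MulOpposite

/-! ## The polar space of a quadratic space -/

section Quadratic

variable {K L : Type*} [Field K] [AddCommGroup L] [Module K L] (q : QuadraticForm K L)

theorem bigQ_mk (t1 t1' t2 t2' : K) (a : L) :
    bigQ q (t1, t1', t2, t2', a) = t1 * t1' + t2 * t2' + q a := rfl

theorem bigF_mk (s1 s1' s2 s2' t1 t1' t2 t2' : K) (b a : L) :
    bigF q (s1, s1', s2, s2', b) (t1, t1', t2, t2', a) =
      s1 * t1' + t1 * s1' + s2 * t2' + t2 * s2' + QuadraticMap.polar q a b := rfl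

theorem bigF_comm (v w : HypSum K L) : bigF q v w = bigF q w v := by
  obtain ⟨s1, s1', s2, s2', b⟩ := v
  obtain ⟨t1, t1', t2, t2', a⟩ := w
  rw [bigF_mk, bigF_mk, QuadraticMap.polar_comm]
  ring

theorem bigF_add_right (v w w' : HypSum K L) : bigF q v (w + w') = bigF q v w + bigF q v w' := by
  obtain ⟨s1, s1', s2, s2', b⟩ := v
  obtain ⟨t1, t1', t2, t2', a⟩ := w
  obtain ⟨r1, r1', r2, r2', c⟩ := w'
  simp only [Prod.mk_add_mk, bigF_mk, QuadraticMap.polar_add_left]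
  ring

theorem bigF_smul_right (t : K) (v w : HypSum K L) : bigF q v (t • w) = t * bigF q v w := by
  obtain ⟨s1, s1', s2, s2', b⟩ := v
  obtain ⟨t1, t1', t2, t2', a⟩ := w
  simp only [Prod.smul_mk, smul_eq_mul, bigF_mk, QuadraticMap.polar_smul_left]
  ring

theorem bigF_add_left (v v' w : HypSum K L) : bigF q (v + v') w = bigF q v w + bigF q v' w := by
  rw [bigF_comm, bigF_add_right, bigF_comm q w, bigF_comm q w]

theorem bigF_smul_left (t : K) (v w : HypSum K L) : bigF q (t • v) w = t * bigF q v w := by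
  rw [bigF_comm, bigF_smul_right, bigF_comm]

theorem bigF_zero_right (v : HypSum K L) : bigF q v 0 = 0 := by
  simpa using bigF_smul_right q 0 v 0

theorem bigQ_add (v w : HypSum K L) : bigQ q (v + w) = bigQ q v + bigQ q w + bigF q v w := by
  obtain ⟨s1, s1', s2, s2', b⟩ := v
  obtain ⟨t1, t1', t2, t2', a⟩ := w
  simp only [Prod.mk_add_mk, bigF_mk, bigQ_mk, QuadraticMap.map_add q]
  rw [QuadraticMap.polar_comm q b a]
  ring

theorem bigQ_smul (t : K) (v : HypSum K L) : bigQ q (t • v) = t * t * bigQ q v := by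
  obtain ⟨s1, s1', s2, s2', b⟩ := v
  simp only [Prod.smul_mk, smul_eq_mul, bigQ_mk, QuadraticMap.map_smul]
  ring

theorem bigF_self (v : HypSum K L) : bigF q v v = 2 * bigQ q v := by
  obtain ⟨s1, s1', s2, s2', b⟩ := v
  simp only [bigF_mk, bigQ_mk, QuadraticMap.polar_self]
  rw [two_smul]
  ring

variable {q}

theorem eq_zero_of_bigF (hq : QNondegenerate q) {v : HypSum K L} (hv : bigQ q v = 0)
    (h : ∀ w, bigF q v w = 0) : v = 0 := by
  obtain ⟨s1, s1', s2, s2', b⟩ := v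
  have h1 := h (1, 0, 0, 0, 0)
  have h2 := h (0, 1, 0, 0, 0)
  have h3 := h (0, 0, 1, 0, 0)
  have h4 := h (0, 0, 0, 1, 0)
  have h5 : ∀ a, QuadraticMap.polar q a b = 0 := fun a => by simpa [bigF_mk] using h (0, 0, 0, 0, a)
  simp only [bigF_mk, QuadraticMap.polar_zero_left, mul_zero, mul_one, one_mul, zero_mul, add_zero,
    zero_add] at h1 h2 h3 h4
  subst h1 h2 h3 h4
  simp only [bigQ_mk, mul_zero, add_zero, zero_add] at hv
  rw [hq b hv fun a => by rw [QuadraticMap.polar_comm, h5]]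
  rfl

/-- The dimension of V is 4 + dim L. This is where L ≠ 0 enters in Case I. -/
theorem span_ne_top [Nontrivial L] (a b c d : HypSum K L) :
    Submodule.span K {a, b, c, d} ≠ ⊤ := by
  classical
  intro h
  have hV : Module.Finite K (HypSum K L) := ⟨⟨{a, b, c, d}, by simpa using h⟩⟩
  have hL : Module.Finite K L := Module.Finite.of_surjective
    ((LinearMap.snd K K L).comp ((LinearMap.snd K K _).comp ((LinearMap.snd K K _).comp
      (LinearMap.snd K K _)))) fun u => ⟨(0, 0, 0, 0, u), rfl⟩
  have h1 := finrank_span_finset_le_card (R := K) ({a, b, c, d} : Finset (HypSum K L))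
  have h2 : ((({a, b, c, d} : Finset (HypSum K L)) : Set (HypSum K L))) = {a, b, c, d} := by simp
  rw [Set.finrank, h2, h, finrank_top] at h1
  have h3 : ({a, b, c, d} : Finset (HypSum K L)).card ≤ 4 := Finset.card_le_four
  have h4 : Module.finrank K (HypSum K L) = 4 + Module.finrank K L := by
    simp only [Module.finrank_prod, Module.finrank_self]
    ring
  have h5 : 0 < Module.finrank K L := Module.finrank_pos
  omega

/-- The orthogonal complement of two orthogonal hyperbolic planes contains anisotropic vectors. -/
theorem exists_anisotropic [Nontrivial L] (hq : QNondegenerate q) {c d e f : HypSum K L}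
    (hc : bigF q c c = 0) (hd : bigF q d d = 0) (he : bigF q e e = 0) (hf : bigF q f f = 0)
    (hcd : bigF q c d = 1) (hef : bigF q e f = 1) (hce : bigF q c e = 0) (hcf : bigF q c f = 0)
    (hde : bigF q d e = 0) (hdf : bigF q d f = 0) :
    ∃ l, bigQ q l ≠ 0 ∧ bigF q c l = 0 ∧ bigF q e l = 0 ∧ bigF q f l = 0 := by
  -- The orthogonal projection to the complement of the hyperbolic planes ⟨c, d⟩ and ⟨e, f⟩.
  let pr : HypSum K L → HypSum K L := fun v =>
    v + (-bigF q v d) • c + (-bigF q v c) • d + (-bigF q v f) • e + (-bigF q v e) • f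
  have hdc : bigF q d c = 1 := by rw [bigF_comm, hcd]
  have hfe : bigF q f e = 1 := by rw [bigF_comm, hef]
  have hec : bigF q e c = 0 := by rw [bigF_comm, hce]
  have hfc : bigF q f c = 0 := by rw [bigF_comm, hcf]
  have hed : bigF q e d = 0 := by rw [bigF_comm, hde]
  have hfd : bigF q f d = 0 := by rw [bigF_comm, hdf]
  have pc : ∀ v, bigF q c (pr v) = 0 := fun v => by
    simp only [pr, bigF_add_right, bigF_smul_right, hc, hcd, hce, hcf, bigF_comm q v]
    ring
  have pd : ∀ v, bigF q d (pr v) = 0 := fun v => by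
    simp only [pr, bigF_add_right, bigF_smul_right, hdc, hd, hde, hdf, bigF_comm q v]
    ring
  have pe : ∀ v, bigF q e (pr v) = 0 := fun v => by
    simp only [pr, bigF_add_right, bigF_smul_right, hec, hed, he, hef, bigF_comm q v]
    ring
  have pf : ∀ v, bigF q f (pr v) = 0 := fun v => by
    simp only [pr, bigF_add_right, bigF_smul_right, hfc, hfd, hfe, hf, bigF_comm q v]
    ring
  obtain ⟨v, hv⟩ : ∃ v, v ∉ Submodule.span K {c, d, e, f} := by
    by_contra! H
    exact span_ne_top c d e f (Submodule.eq_top_iff'.2 H)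
  have hl : pr v ≠ 0 := by
    intro h
    apply hv
    have : v = bigF q v d • c + bigF q v c • d + bigF q v f • e + bigF q v e • f := by
      rw [← sub_eq_zero, ← h]
      simp only [pr, neg_smul]
      abel
    rw [this]
    have hs : ∀ x ∈ ({c, d, e, f} : Set (HypSum K L)), ∀ t : K,
        t • x ∈ Submodule.span K {c, d, e, f} :=
      fun x hx t => Submodule.smul_mem _ t (Submodule.subset_span hx)
    exact add_mem (add_mem (add_mem (hs c (by simp) _) (hs d (by simp) _)) (hs e (by simp) _))
      (hs f (by simp) _)
  -- If `pr v` is isotropic, non-degeneracy gives `m` with F(pr v, m) ≠ 0, and projecting `m` keeps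
  -- this value. Then `pr m` or `pr v + pr m` is anisotropic.
  by_cases h1 : bigQ q (pr v) = 0
  · obtain ⟨m, hm⟩ : ∃ m, bigF q (pr v) m ≠ 0 := by
      by_contra! H
      exact hl (eq_zero_of_bigF hq h1 H)
    have hm' : bigF q (pr v) (pr m) = bigF q (pr v) m := by
      change bigF q (pr v) (m + _ + _ + _ + _) = _
      simp only [bigF_add_right, bigF_smul_right]
      rw [bigF_comm q (pr v) c, bigF_comm q (pr v) d, bigF_comm q (pr v) e, bigF_comm q (pr v) f,
        pc, pd, pe, pf]
      ring
    by_cases h2 : bigQ q (pr m) = 0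
    · refine ⟨pr v + pr m, ?_, ?_, ?_, ?_⟩
      · rwa [bigQ_add, h1, h2, hm', zero_add, zero_add]
      · rw [bigF_add_right, pc, pc, add_zero]
      · rw [bigF_add_right, pe, pe, add_zero]
      · rw [bigF_add_right, pf, pf, add_zero]
    · exact ⟨_, h2, pc m, pe m, pf m⟩
  · exact ⟨_, h1, pc v, pe v, pf v⟩

/-- Scale f to f' with F(e, f') = 1, complete c to a hyperbolic pair c, d orthogonal to e and f',
and take an anisotropic l orthogonal to c, e, f'. Then g = e + l - Q(l) f' is isotropic and
orthogonal to c, with F(e, g) = -Q(l) ≠ 0 and F(f, g) = F(f, e) ≠ 0. -/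
theorem quad_exists_third [Nontrivial L] (hq : QNondegenerate q) {c e f : HypSum K L}
    (hc : bigQ q c = 0) (h0 : c ≠ 0) (he : bigQ q e = 0) (hf : bigQ q f = 0)
    (hce : bigF q c e = 0) (hcf : bigF q c f = 0) (hef : bigF q e f ≠ 0) :
    ∃ g, bigQ q g = 0 ∧ bigF q c g = 0 ∧ bigF q e g ≠ 0 ∧ bigF q f g ≠ 0 := by
  have self : ∀ {v}, bigQ q v = 0 → bigF q v v = 0 := fun h => by rw [bigF_self, h, mul_zero]
  obtain ⟨f', hf', hef', hcf', hff', e1⟩ : ∃ f', bigQ q f' = 0 ∧ bigF q e f' = 1 ∧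
      bigF q c f' = 0 ∧ bigF q f f' = 0 ∧ bigF q e f • f' = f := by
    refine ⟨(bigF q e f)⁻¹ • f, ?_, ?_, ?_, ?_, smul_inv_smul₀ hef f⟩
    · rw [bigQ_smul, hf, mul_zero]
    · rw [bigF_smul_right, inv_mul_cancel₀ hef]
    · rw [bigF_smul_right, hcf, mul_zero]
    · rw [bigF_smul_right, self hf, mul_zero]
  obtain ⟨w, hw⟩ : ∃ w, bigF q c w ≠ 0 := by
    by_contra! H
    exact h0 (eq_zero_of_bigF hq hc H)
  obtain ⟨w', hcw, hew, hfw⟩ : ∃ w', bigF q c w' = 1 ∧ bigF q e w' = 0 ∧ bigF q f' w' = 0 := by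
    refine ⟨(bigF q c w)⁻¹ • (w + (-bigF q w f') • e + (-bigF q w e) • f'), ?_, ?_, ?_⟩ <;>
    simp only [bigF_smul_right, bigF_add_right]
    · rw [hce, hcf', mul_zero, mul_zero, add_zero, add_zero, inv_mul_cancel₀ hw]
    · rw [self he, hef', bigF_comm q w e]
      ring
    · rw [self hf', bigF_comm q f' e, hef', bigF_comm q w f']
      ring
  obtain ⟨d, hd, hcd, hed, hfd⟩ : ∃ d, bigQ q d = 0 ∧ bigF q c d = 1 ∧ bigF q e d = 0 ∧
      bigF q f' d = 0 := by
    refine ⟨w' + (-bigQ q w') • c, ?_, ?_, ?_, ?_⟩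
    · rw [bigQ_add, bigQ_smul, hc, bigF_smul_right, bigF_comm, hcw]
      ring
    · rw [bigF_add_right, bigF_smul_right, hcw, self hc, mul_zero, add_zero]
    · rw [bigF_add_right, bigF_smul_right, hew, bigF_comm, hce, mul_zero, add_zero]
    · rw [bigF_add_right, bigF_smul_right, hfw, bigF_comm, hcf', mul_zero, add_zero]
  obtain ⟨l, hl, hcl, hel, hfl⟩ := exists_anisotropic hq (self hc) (self hd) (self he) (self hf')
    hcd hef' hce hcf' (by rw [bigF_comm, hed]) (by rw [bigF_comm, hfd])
  have hfl' : bigF q f l = 0 := by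
    rw [← e1, bigF_smul_left, hfl, mul_zero]
  refine ⟨e + l + (-bigQ q l) • f', ?_, ?_, ?_, ?_⟩
  · rw [bigQ_add, bigQ_add, bigQ_smul, he, hf', bigF_smul_right, bigF_add_left, hel, hef',
      bigF_comm q l, hfl]
    ring
  · rw [bigF_add_right, bigF_add_right, bigF_smul_right, hce, hcl, hcf']
    ring
  · rw [bigF_add_right, bigF_add_right, bigF_smul_right, self he, hel, hef']
    simpa using hl
  · rw [bigF_add_right, bigF_add_right, bigF_smul_right, hff', hfl', bigF_comm]
    simpa using hef

variable [Nontrivial L]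

variable (q) in
/-- Isotropy and orthogonality in `K⁴ ⊕ L`. -/
def quadPolarForm (hq : QNondegenerate q) : PolarForm K (HypSum K L) where
  iso v := bigQ q v = 0
  orth v w := bigF q v w = 0
  iso_smul t v hv := by rw [bigQ_smul, hv, mul_zero]
  iso_add hv hw h := by rw [bigQ_add, hv, hw, h, add_zero, add_zero]
  orth_self hv := by rw [bigF_self, hv, mul_zero]
  orth_symm h := by rw [bigF_comm, h]
  orth_zero v := bigF_zero_right q v
  orth_add h h' := by rw [bigF_add_right, h, h', add_zero]
  orth_smul t v w h := by rw [bigF_smul_right, h, mul_zero]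
  exists_orth {v e} h w := ⟨-bigF q v w / bigF q v e, by
    rw [bigF_add_right, bigF_smul_right, div_mul_cancel₀ _ h, add_neg_cancel]⟩
  exists_iso {e w} he h := ⟨-bigQ q w / bigF q e w, by
    rw [bigQ_add, bigQ_smul, he, mul_zero, add_zero, bigF_smul_right, bigF_comm q w,
      div_mul_cancel₀ _ h, add_neg_cancel]⟩
  nondeg := eq_zero_of_bigF hq
  exists_third := quad_exists_third hq

end Quadratic

end TitsQuad

namespace TitsQuad

theorem mem_span_of_eq_smul {R M : Type*} [Semiring R] [AddCommMonoid M] [Module R M] {e v : M}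
    (t : R) (h : v = t • e) : v ∈ Submodule.span R {e} :=
  Submodule.mem_span_singleton.2 ⟨t, h.symm⟩

open MulOpposite

section Quadratic

variable {K L : Type*} [Field K] [AddCommGroup L] [Module K L] (q : QuadraticForm K L)

/-! ### Isometries of quadratic spaces -/

/-- The Siegel transformation with centre x₁. Its inverse belongs to -a, so only the terms linear in
a change sign. -/
def qAlpha (a : L) : HypSum K L ≃ₗ[K] HypSum K L where
  toFun v := (v.1 - v.2.1 * q a - QuadraticMap.polar q v.2.2.2.2 a, v.2.1, v.2.2.1, v.2.2.2.1,
    v.2.2.2.2 + v.2.1 • a)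
  invFun v := (v.1 - v.2.1 * q a + QuadraticMap.polar q v.2.2.2.2 a, v.2.1, v.2.2.1, v.2.2.2.1,
    v.2.2.2.2 - v.2.1 • a)
  map_add' v w := by
    ext <;> simp only [Prod.fst_add, Prod.snd_add, QuadraticMap.polar_add_left, add_smul]
    · ring
    · abel
  map_smul' t v := by
    ext <;> simp only [Prod.smul_fst, Prod.smul_snd, smul_eq_mul, QuadraticMap.polar_smul_left,
      RingHom.id_apply, smul_add, smul_smul]
    ring
  left_inv v := by
    ext <;> simp only [QuadraticMap.polar_add_left, QuadraticMap.polar_smul_left,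
      QuadraticMap.polar_self, add_sub_cancel_right, smul_eq_mul]
    ring
  right_inv v := by
    ext <;> simp only [QuadraticMap.polar_sub_left, QuadraticMap.polar_smul_left,
      QuadraticMap.polar_self, sub_add_cancel, smul_eq_mul]
    ring

def qBeta (b : L) : HypSum K L ≃ₗ[K] HypSum K L where
  toFun v := (v.1, v.2.1, v.2.2.1, v.2.2.2.1 - v.2.2.1 * q b - QuadraticMap.polar q v.2.2.2.2 b,
    v.2.2.2.2 + v.2.2.1 • b)
  invFun v := (v.1, v.2.1, v.2.2.1, v.2.2.2.1 - v.2.2.1 * q b + QuadraticMap.polar q v.2.2.2.2 b,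
    v.2.2.2.2 - v.2.2.1 • b)
  map_add' v w := by
    ext <;> simp only [Prod.fst_add, Prod.snd_add, QuadraticMap.polar_add_left, add_smul]
    · ring
    · abel
  map_smul' t v := by
    ext <;> simp only [Prod.smul_fst, Prod.smul_snd, smul_eq_mul, QuadraticMap.polar_smul_left,
      RingHom.id_apply, smul_add, smul_smul]
    ring
  left_inv v := by
    ext <;> simp only [QuadraticMap.polar_add_left, QuadraticMap.polar_smul_left,
      QuadraticMap.polar_self, add_sub_cancel_right, smul_eq_mul]
    ring
  right_inv v := by
    ext <;> simp only [QuadraticMap.polar_sub_left, QuadraticMap.polar_smul_left,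
      QuadraticMap.polar_self, sub_add_cancel, smul_eq_mul]
    ring

variable (L) in
-- A root element of the totally singular line ⟨x₁, x₂'⟩: it is the identity on the orthogonal space
-- of that line and moves every vector by an element of the line.
def qGamma (t : K) : HypSum K L ≃ₗ[K] HypSum K L where
  toFun v := (v.1 + v.2.2.1 * t, v.2.1, v.2.2.1, v.2.2.2.1 - v.2.1 * t, v.2.2.2.2)
  invFun v := (v.1 - v.2.2.1 * t, v.2.1, v.2.2.1, v.2.2.2.1 + v.2.1 * t, v.2.2.2.2)
  map_add' v w := by
    ext <;> simp only [Prod.fst_add, Prod.snd_add] <;> ring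
  map_smul' t v := by
    ext <;> simp only [Prod.smul_fst, Prod.smul_snd, smul_eq_mul, RingHom.id_apply] <;> ring
  left_inv v := by ext <;> simp
  right_inv v := by ext <;> simp

variable (L) in
def qDelta (s : K) : HypSum K L ≃ₗ[K] HypSum K L where
  toFun v := (v.1, v.2.1 - v.2.2.1 * s, v.2.2.1, v.2.2.2.1 + v.1 * s, v.2.2.2.2)
  invFun v := (v.1, v.2.1 + v.2.2.1 * s, v.2.2.1, v.2.2.2.1 - v.1 * s, v.2.2.2.2)
  map_add' v w := by
    ext <;> simp only [Prod.fst_add, Prod.snd_add] <;> ring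
  map_smul' t v := by
    ext <;> simp only [Prod.smul_fst, Prod.smul_snd, smul_eq_mul, RingHom.id_apply] <;> ring
  left_inv v := by ext <;> simp
  right_inv v := by ext <;> simp

variable (K L) in
/-- The cyclic permutation `x₂ ↦ x₁' ↦ x₂' ↦ x₁ ↦ x₂` of the basis of `K⁴`. -/
def qRotation : HypSum K L ≃ₗ[K] HypSum K L where
  toFun v := (v.2.2.2.1, v.2.2.1, v.1, v.2.1, v.2.2.2.2)
  invFun v := (v.2.2.1, v.2.2.2.1, v.2.1, v.1, v.2.2.2.2)
  map_add' _ _ := rfl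
  map_smul' _ _ := rfl
  left_inv _ := rfl
  right_inv _ := rfl

variable (K L) in
/-- The transposition of `x₁` and `x₁'`. -/
def qReflection : HypSum K L ≃ₗ[K] HypSum K L where
  toFun v := (v.2.1, v.1, v.2.2.1, v.2.2.2.1, v.2.2.2.2)
  invFun v := (v.2.1, v.1, v.2.2.1, v.2.2.2.1, v.2.2.2.2)
  map_add' _ _ := rfl
  map_smul' _ _ := rfl
  left_inv _ := rfl
  right_inv _ := rfl

variable {q}

/-- F is the polarization of Q. -/
theorem QIsometry.of_bigQ {φ : HypSum K L ≃ₗ[K] HypSum K L} (h : ∀ v, bigQ q (φ v) = bigQ q v) :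
    QIsometry q φ := by
  refine ⟨h, fun v w => ?_⟩
  have e := h (v + w)
  rw [map_add, bigQ_add, bigQ_add, h, h] at e
  exact add_left_cancel e

variable (q)

theorem qIsometry_qAlpha (a : L) : QIsometry q (qAlpha q a) := .of_bigQ fun ⟨t1, t1', t2, t2', u⟩ => by
  simp only [qAlpha, LinearEquiv.coe_mk, LinearMap.coe_mk, AddHom.coe_mk, bigQ_mk,
    QuadraticMap.map_add q u, QuadraticMap.map_smul, QuadraticMap.polar_smul_right, smul_eq_mul]
  ring

theorem qIsometry_qBeta (a : L) : QIsometry q (qBeta q a) := .of_bigQ fun ⟨t1, t1', t2, t2', u⟩ => by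
  simp only [qBeta, LinearEquiv.coe_mk, LinearMap.coe_mk, AddHom.coe_mk, bigQ_mk,
    QuadraticMap.map_add q u, QuadraticMap.map_smul, QuadraticMap.polar_smul_right, smul_eq_mul]
  ring

theorem qIsometry_qGamma (t : K) : QIsometry q (qGamma L t) := .of_bigQ fun ⟨t1, t1', t2, t2', u⟩ => by
  simp only [qGamma, LinearEquiv.coe_mk, LinearMap.coe_mk, AddHom.coe_mk, bigQ_mk]
  ring

theorem qIsometry_qDelta (t : K) : QIsometry q (qDelta L t) := .of_bigQ fun ⟨t1, t1', t2, t2', u⟩ => by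
  simp only [qDelta, LinearEquiv.coe_mk, LinearMap.coe_mk, AddHom.coe_mk, bigQ_mk]
  ring

theorem qIsometry_qRotation : QIsometry q (qRotation K L) := .of_bigQ fun ⟨t1, t1', t2, t2', u⟩ => by
  simp only [qRotation, LinearEquiv.coe_mk, LinearMap.coe_mk, AddHom.coe_mk, bigQ_mk]
  ring

theorem qIsometry_qReflection : QIsometry q (qReflection K L) :=
  .of_bigQ fun ⟨t1, t1', t2, t2', u⟩ => by
  simp only [qReflection, LinearEquiv.coe_mk, LinearMap.coe_mk, AddHom.coe_mk, bigQ_mk]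
  ring

theorem isQAlpha_qAlpha (a : L) : IsQAlpha q a (qAlpha q a) := by
  refine ⟨?_, ?_, ?_, ?_, fun u => ?_⟩ <;>
  ext <;> simp [qAlpha, vx1, vx2, vy1, vy2, vL]

theorem isQBeta_qBeta (a : L) : IsQBeta q a (qBeta q a) := by
  refine ⟨?_, ?_, ?_, ?_, fun u => ?_⟩ <;>
  ext <;> simp [qBeta, vx1, vx2, vy1, vy2, vL]

theorem isQGamma_qGamma (t : K) : IsQGamma t (qGamma L t) := by
  refine ⟨?_, ?_, fun u => ?_, ?_, ?_⟩ <;>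
  ext <;> simp [qGamma, vx1, vx2, vy1, vy2, vL]

theorem isQDelta_qDelta (t : K) : IsQDelta t (qDelta L t) := by
  refine ⟨?_, ?_, fun u => ?_, ?_, ?_⟩ <;>
  ext <;> simp [qDelta, vx1, vx2, vy1, vy2, vL]

variable {q}

variable [Nontrivial L] (hq : QNondegenerate q)

theorem QIsometry.isIsom {φ : HypSum K L ≃ₗ[K] HypSum K L} (h : QIsometry q φ) :
    (quadPolarForm q hq).IsIsom φ :=
  ⟨fun v => by change bigQ q _ = 0 ↔ bigQ q _ = 0; rw [h.1],
    fun v w => by change bigF q _ _ = 0 ↔ bigF q _ _ = 0; rw [h.2]⟩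

theorem isFrame_quad : (quadPolarForm q hq).IsFrame (vx2 K) (vy1 K) (vy2 K) (vx1 K) := by
  constructor <;> simp [quadPolarForm, vx1, vx2, vy1, vy2, bigQ_mk, bigF_mk]

open PolarForm

/-- The standard coordinate system in the quadratic case. -/
noncomputable def quadCoord : ZMod (2 * 4) → Points (QTot q) ⊕ isoLines (QTot q) :=
  frameCircuit (isFrame_quad hq)

theorem isQStandard_quadCoord : IsQStandard q (quadCoord hq) := by
  have hf := isFrame_quad hq
  refine ⟨?_, rfl, ?_, rfl, ?_, rfl, ?_, rfl⟩
  · exact (vertexSpace_frameCircuit_one hf).trans (by rw [Set.pair_comm])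
  · exact vertexSpace_frameCircuit_three hf
  · exact (vertexSpace_frameCircuit_five hf).trans (by rw [Set.pair_comm])
  · exact vertexSpace_frameCircuit_seven hf

include hq in
theorem quad_isThickPolarSpace : IsThickPolarSpace (isoLines (QTot q)) :=
  isThickPolarSpace (isFrame_quad hq)

theorem isStraightCircuit_quadCoord : (quadGraph q).IsStraightCircuit 4 (quadCoord hq) :=
  isStraightCircuit_frameCircuit (isFrame_quad hq)

/-- The root w₁, …, w₅ runs through the points x₁' and x₂', and δ acts trivially on the quotient of
the orthogonal space of each of them. It moves x₁ to x₁ + s x₂', that is, once to each point of the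
line x₁x₂' other than x₂'. -/
theorem quad_exists_delta :
    (∃ x₁ : Multiplicative K ≃* (quadGraph q).labelling 4 (quadCoord hq) 1,
      ∀ t, (x₁ t : (Equiv.Perm (Points (QTot q) ⊕ isoLines (QTot q)))ᵐᵒᵖ) =
        induced ((qIsometry_qDelta q t.toAdd).isIsom hq)) ∧
    (quadGraph q).RootTransitive fun j => quadCoord hq (j + 1) := by
  have hf := isFrame_quad hq
  refine exists_mulEquiv_line (Λ := quadPolarForm q hq) (b := vy1 K) (c := vy2 K) (d := vx1 K)
    (quad_isThickPolarSpace hq).isVeldkampPolygon (isStraightCircuit_quadCoord hq) 1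
    hf.rotate.ne_zero hf.rotate.rotate.ne_zero (vertexSpace_frameCircuit_two hf)
    (vertexSpace_frameCircuit_three hf) (vertexSpace_frameCircuit_four hf)
    (vertexSpace_frameCircuit_five hf) (vertexSpace_frameCircuit_six hf)
    hf.rotate.notMem_span hf.rotate.rotate.notMem_span
    (fun t : Multiplicative K => qDelta L t.toAdd)
    (fun t => (qIsometry_qDelta q t.toAdd).isIsom hq) ?_ ?_ ?_ ?_ ?_ ?_ ?_
  · rintro a b ⟨t1, t1', t2, t2', u⟩
    ext <;> simp [qDelta] <;> ring
  · intro a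
    exact (isQDelta_qDelta a.toAdd).1
  · intro a
    exact (isQDelta_qDelta a.toAdd).2.1
  · rintro a ⟨t1, t1', t2, t2', u⟩ h
    have h' : t1 = 0 := by simpa [quadPolarForm, bigF_mk, vy1] using h
    refine mem_span_of_eq_smul (-(t2 * a.toAdd)) ?_
    ext <;> simp [qDelta, vy1, h']
  · rintro a ⟨t1, t1', t2, t2', u⟩ h
    have h' : t2 = 0 := by simpa [quadPolarForm, bigF_mk, vy2] using h
    refine mem_span_of_eq_smul (t1 * a.toAdd) ?_
    ext <;> simp [qDelta, vy2, h']
  · intro a h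
    obtain ⟨t, ht⟩ := Submodule.mem_span_singleton.1 h
    have := congrArg (fun v : HypSum K L => v.2.2.2.1) ht
    have h0 : (0 : K) = a.toAdd := by simpa [qDelta, vx1] using this
    exact Multiplicative.toAdd.injective h0.symm
  · intro s
    refine ⟨.ofAdd s, ?_⟩
    exact (isQDelta_qDelta s).2.2.2.1

/-- Only the parametrization is recorded here, since transitivity for the odd roots already comes
from δ and the rotation; likewise for α after β. -/
theorem quad_exists_gamma :
    (∃ x₃ : Multiplicative K ≃* (quadGraph q).labelling 4 (quadCoord hq) 3,
      ∀ t, (x₃ t : (Equiv.Perm (Points (QTot q) ⊕ isoLines (QTot q)))ᵐᵒᵖ) =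
        induced ((qIsometry_qGamma q t.toAdd).isIsom hq)) := by
  have hf := isFrame_quad hq
  refine (exists_mulEquiv_line (Λ := quadPolarForm q hq) (b := vy2 K) (c := vx1 K) (d := vx2 K)
    (quad_isThickPolarSpace hq).isVeldkampPolygon (isStraightCircuit_quadCoord hq) 3
    hf.rotate.rotate.ne_zero hf.rotate.rotate.rotate.ne_zero (vertexSpace_frameCircuit_four hf)
    (vertexSpace_frameCircuit_five hf) (vertexSpace_frameCircuit_six hf)
    (vertexSpace_frameCircuit_seven hf) (vertexSpace_frameCircuit_zero hf)
    hf.rotate.rotate.notMem_span hf.rotate.rotate.rotate.notMem_span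
    (fun t : Multiplicative K => qGamma L t.toAdd)
    (fun t => (qIsometry_qGamma q t.toAdd).isIsom hq) ?_ ?_ ?_ ?_ ?_ ?_ ?_).1
  · rintro a b ⟨t1, t1', t2, t2', u⟩
    ext <;> simp [qGamma] <;> ring
  · intro a
    exact (isQGamma_qGamma a.toAdd).2.1
  · intro a
    exact (isQGamma_qGamma a.toAdd).1
  · rintro a ⟨t1, t1', t2, t2', u⟩ h
    have h' : t2 = 0 := by simpa [quadPolarForm, bigF_mk, vy2] using h
    refine mem_span_of_eq_smul (-(t1' * a.toAdd)) ?_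
    ext <;> simp [qGamma, vy2, h']
  · rintro a ⟨t1, t1', t2, t2', u⟩ h
    have h' : t1' = 0 := by simpa [quadPolarForm, bigF_mk, vx1] using h
    refine mem_span_of_eq_smul (t2 * a.toAdd) ?_
    ext <;> simp [qGamma, vx1, h']
  · intro a h
    obtain ⟨t, ht⟩ := Submodule.mem_span_singleton.1 h
    have := congrArg (fun v : HypSum K L => v.1) ht
    have h0 : (0 : K) = a.toAdd := by simpa [qGamma, vx2] using this
    exact Multiplicative.toAdd.injective h0.symm
  · intro s
    refine ⟨.ofAdd s, ?_⟩
    exact (isQGamma_qGamma s).2.2.2.2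

theorem quad_exists_beta :
    (∃ x₂ : Multiplicative L ≃* (quadGraph q).labelling 4 (quadCoord hq) 2,
      ∀ a, (x₂ a : (Equiv.Perm (Points (QTot q) ⊕ isoLines (QTot q)))ᵐᵒᵖ) =
        induced ((qIsometry_qBeta q a.toAdd).isIsom hq)) ∧
    (quadGraph q).RootTransitive fun j => quadCoord hq (j + 2) := by
  have hf := isFrame_quad hq
  refine exists_mulEquiv_point (Λ := quadPolarForm q hq) (b := vy1 K) (c := vy2 K) (d := vx1 K)
    (a := vx2 K) (quad_isThickPolarSpace hq).isVeldkampPolygon (isStraightCircuit_quadCoord hq) 2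
    hf.rotate.ne_zero hf.rotate.rotate.ne_zero hf.rotate.rotate.rotate.ne_zero
    (vertexSpace_frameCircuit_three hf)
    (vertexSpace_frameCircuit_four hf) (vertexSpace_frameCircuit_five hf)
    (vertexSpace_frameCircuit_six hf) (vertexSpace_frameCircuit_seven hf)
    hf.rotate.notMem_span hf.rotate.rotate.notMem_span hf.rotate.rotate.rotate.notMem_span
    hf.not_orth_bd
    (fun a : Multiplicative L => qBeta q a.toAdd)
    (fun a => (qIsometry_qBeta q a.toAdd).isIsom hq) ?_ ?_ ?_ ?_ ?_ ?_ ?_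
  · rintro a b ⟨t1, t1', t2, t2', u⟩
    ext <;> simp [qBeta, QuadraticMap.map_add q, QuadraticMap.polar_add_left,
      QuadraticMap.polar_add_right, QuadraticMap.polar_smul_left, add_assoc]
    ring
  · exact fun a => (isQBeta_qBeta q a.toAdd).2.1
  · exact fun a => (isQBeta_qBeta q a.toAdd).2.2.1
  · exact fun a => (isQBeta_qBeta q a.toAdd).1
  · rintro a ⟨t1, t1', t2, t2', u⟩ h
    have h' : t2 = 0 := by simpa [quadPolarForm, bigF_mk, vy2] using h
    refine mem_span_of_eq_smul (-QuadraticMap.polar q u a.toAdd) ?_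
    ext <;> simp [qBeta, vy2, h']
  · intro a h
    obtain ⟨s, t, ht⟩ := Submodule.mem_span_pair.1 h
    have := congrArg (fun v : HypSum K L => v.2.2.2.2) ht
    have h0 : (0 : L) = a.toAdd := by simpa [qBeta, vx1, vx2] using this
    exact Multiplicative.toAdd.injective h0.symm
  · rintro ⟨t1, t1', t2, t2', u⟩ hi h1 h2 h3
    have h1' : t1' = 0 := by simpa [quadPolarForm, bigF_mk, vx1] using h1
    have h2' : t1 = 0 := by simpa [quadPolarForm, bigF_mk, vy1] using h2
    have h3' : t2 ≠ 0 := by simpa [quadPolarForm, bigF_mk, vy2] using h3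
    have hi' : t2 * t2' + q u = 0 := by simpa [quadPolarForm, bigQ_mk, h1', h2'] using hi
    -- Scaled so that its x₂-coordinate is 1, the vector is x₂ + r x₂' + b with b = t₂⁻¹u, and
    -- isotropy forces r = -q(b). So it is the image of x₂ under β_b.
    refine ⟨.ofAdd (t2⁻¹ • u), mem_span_of_eq_smul t2⁻¹ ?_⟩
    ext <;> simp [qBeta, vx2, h1', h2', h3', QuadraticMap.map_smul]
    field_simp
    linear_combination -hi'

theorem quad_exists_alpha :
    (∃ x₄ : Multiplicative L ≃* (quadGraph q).labelling 4 (quadCoord hq) 4,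
      ∀ a, (x₄ a : (Equiv.Perm (Points (QTot q) ⊕ isoLines (QTot q)))ᵐᵒᵖ) =
        induced ((qIsometry_qAlpha q a.toAdd).isIsom hq)) := by
  have hf := isFrame_quad hq
  refine (exists_mulEquiv_point (Λ := quadPolarForm q hq) (b := vy2 K) (c := vx1 K) (d := vx2 K)
    (a := vy1 K) (quad_isThickPolarSpace hq).isVeldkampPolygon (isStraightCircuit_quadCoord hq) 4
    hf.rotate.rotate.ne_zero hf.rotate.rotate.rotate.ne_zero hf.ne_zero
    (vertexSpace_frameCircuit_five hf)
    (vertexSpace_frameCircuit_six hf) (vertexSpace_frameCircuit_seven hf)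
    (vertexSpace_frameCircuit_zero hf) (vertexSpace_frameCircuit_one hf)
    hf.rotate.rotate.notMem_span hf.rotate.rotate.rotate.notMem_span hf.notMem_span
    hf.rotate.not_orth_bd
    (fun a : Multiplicative L => qAlpha q a.toAdd)
    (fun a => (qIsometry_qAlpha q a.toAdd).isIsom hq) ?_ ?_ ?_ ?_ ?_ ?_ ?_).1
  · rintro a b ⟨t1, t1', t2, t2', u⟩
    ext <;> simp [qAlpha, QuadraticMap.map_add q, QuadraticMap.polar_add_left,
      QuadraticMap.polar_add_right, QuadraticMap.polar_smul_left, add_assoc]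
    ring
  · exact fun a => (isQAlpha_qAlpha q a.toAdd).2.2.1
  · exact fun a => (isQAlpha_qAlpha q a.toAdd).1
  · exact fun a => (isQAlpha_qAlpha q a.toAdd).2.1
  · rintro a ⟨t1, t1', t2, t2', u⟩ h
    have h' : t1' = 0 := by simpa [quadPolarForm, bigF_mk, vx1] using h
    refine mem_span_of_eq_smul (-QuadraticMap.polar q u a.toAdd) ?_
    ext <;> simp [qAlpha, vx1, h']
  · intro a h
    obtain ⟨s, t, ht⟩ := Submodule.mem_span_pair.1 h
    have := congrArg (fun v : HypSum K L => v.2.2.2.2) ht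
    have h0 : (0 : L) = a.toAdd := by simpa [qAlpha, vy1, vx2] using this
    exact Multiplicative.toAdd.injective h0.symm
  · rintro ⟨t1, t1', t2, t2', u⟩ hi h1 h2 h3
    have h1' : t2' = 0 := by simpa [quadPolarForm, bigF_mk, vx2] using h1
    have h2' : t2 = 0 := by simpa [quadPolarForm, bigF_mk, vy2] using h2
    have h3' : t1' ≠ 0 := by simpa [quadPolarForm, bigF_mk, vx1] using h3
    have hi' : t1 * t1' + q u = 0 := by simpa [quadPolarForm, bigQ_mk, h1', h2'] using hi
    refine ⟨.ofAdd (t1'⁻¹ • u), mem_span_of_eq_smul t1'⁻¹ ?_⟩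
    ext <;> simp [qAlpha, vy1, h1', h2', h3', QuadraticMap.map_smul]
    field_simp
    linear_combination -hi'

end Quadratic

end TitsQuad

namespace TitsQuad

open MulOpposite

/-! ### Transport of commutator relations by isomorphisms -/

theorem exists_subgroup_mulEquiv {ι G : Type*} [Group G] {U U' : ι → Subgroup G} {e : G ≃* G}
    (hU : ∀ i, U' i = (U i).map e.toMonoidHom) (i : ι) :
    ∃ E : U i ≃* U' i, ∀ u, (E u : G) = e u :=
  ⟨(e.subgroupMap (U i)).trans (MulEquiv.subgroupCongr (hU i).symm), fun _ => rfl⟩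

theorem map_comm {G H : Type*} [Group G] [Group H] (e : G ≃* H) (x y : G) :
    e (comm x y) = comm (e x) (e y) := by
  simp [comm]

theorem comm_eq_one_of_mul_comm {G : Type*} [Group G] {x y : G} (h : x * y = y * x) :
    comm x y = 1 := by
  rw [comm, mul_assoc, h]
  group

theorem comm_eq_one_of_map {ι G : Type*} [Group G] {U U' : ι → Subgroup G} {e : G ≃* G}
    (hU : ∀ i, U' i = (U i).map e.toMonoidHom) {i j : ι}
    (h : ∀ g ∈ U i, ∀ h ∈ U j, comm g h = 1) : ∀ g ∈ U' i, ∀ h ∈ U' j, comm g h = 1 := by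
  intro g hg k hk
  rw [hU] at hg hk
  obtain ⟨g, hg, rfl⟩ := hg
  obtain ⟨k, hk, rfl⟩ := hk
  exact (map_comm e g k).symm.trans (by rw [h g hg k hk, map_one])

/-! ### Commutator relations and type in the quadratic case -/

section Quadratic

variable {K L : Type*} [Field K] [AddCommGroup L] [Module K L] {q : QuadraticForm K L}

theorem OrthRel.map {G : Type*} [Group G] {U U' : ZMod (2 * 4) → Subgroup G} {e : G ≃* G}
    (hU : ∀ i, U' i = (U i).map e.toMonoidHom) {x₁ x₂ x₃ x₄} (h : OrthRel q U x₁ x₂ x₃ x₄) :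
    ∃ x₁ x₂ x₃ x₄, OrthRel q U' x₁ x₂ x₃ x₄ := by
  obtain ⟨E₁, h₁⟩ := exists_subgroup_mulEquiv hU 1
  obtain ⟨E₂, h₂⟩ := exists_subgroup_mulEquiv hU 2
  obtain ⟨E₃, h₃⟩ := exists_subgroup_mulEquiv hU 3
  obtain ⟨E₄, h₄⟩ := exists_subgroup_mulEquiv hU 4
  refine ⟨x₁.trans E₁, x₂.trans E₂, x₃.trans E₃, x₄.trans E₄,
    fun i => comm_eq_one_of_map hU (h.1 i), comm_eq_one_of_map hU h.2.1, fun a b => ?_,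
    fun t a => ?_⟩ <;>
  simp only [MulEquiv.trans_apply, h₁, h₂, h₃, h₄]
  · rw [← h.2.2.1, map_comm, map_inv]
  · rw [← map_mul, ← h.2.2.2, map_comm, map_inv]

open PolarForm

variable [Nontrivial L] (hq : QNondegenerate q)

/-- By `comm_inv_eq` a relation [x, y⁻¹] = z reads yx = xzy. Both sides are induced by composites of
explicit isometries, so it suffices to compare coordinates in V. -/
theorem quad_exists_orthRel :
    ∃ x₁ x₂ x₃ x₄, OrthRel q ((quadGraph q).labelling 4 (quadCoord hq)) x₁ x₂ x₃ x₄ ∧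
      (∀ t : K, ∃ φ, IsQDelta t φ ∧ QIsometry q φ ∧ Induces (QTot q) φ (x₁ (.ofAdd t))) ∧
      (∀ a : L, ∃ φ, IsQBeta q a φ ∧ QIsometry q φ ∧ Induces (QTot q) φ (x₂ (.ofAdd a))) ∧
      (∀ t : K, ∃ φ, IsQGamma t φ ∧ QIsometry q φ ∧ Induces (QTot q) φ (x₃ (.ofAdd t))) ∧
      (∀ a : L, ∃ φ, IsQAlpha q a φ ∧ QIsometry q φ ∧ Induces (QTot q) φ (x₄ (.ofAdd a))) := by
  obtain ⟨x₁, h₁⟩ := (quad_exists_delta hq).1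
  obtain ⟨x₂, h₂⟩ := (quad_exists_beta hq).1
  obtain ⟨x₃, h₃⟩ := quad_exists_gamma hq
  obtain ⟨x₄, h₄⟩ := quad_exists_alpha hq
  have hΓ : (quadGraph q).IsVeldkampPolygon 4 := (quad_isThickPolarSpace hq).isVeldkampPolygon
  refine ⟨x₁, x₂, x₃, x₄, ⟨hΓ.comm_eq_one (isStraightCircuit_quadCoord hq), ?_, ?_, ?_⟩, ?_, ?_, ?_, ?_⟩
  · intro g hg h hh
    obtain ⟨t, ht⟩ := x₁.surjective ⟨g, hg⟩
    obtain ⟨s, hs⟩ := x₃.surjective ⟨h, hh⟩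
    refine comm_eq_one_of_mul_comm ?_
    have eg : g = induced ((qIsometry_qDelta q t.toAdd).isIsom hq) := by rw [← h₁, ht]
    have eh : h = induced ((qIsometry_qGamma q s.toAdd).isIsom hq) := by rw [← h₃, hs]
    rw [eg, eh]
    refine (induced_mul _ _).trans ((induced_congr _ _ ?_).trans (induced_mul _ _).symm)
    rintro ⟨t1, t1', t2, t2', u⟩
    ext <;> simp [qDelta, qGamma]
    ring
  · intro a b
    refine comm_inv_eq ?_
    rw [h₂, h₃, h₄]
    refine (induced_mul _ _).trans ((induced_congr _ _ ?_).trans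
      ((congrArg (· * _) (induced_mul _ _)).trans (induced_mul _ _)).symm)
    rintro ⟨t1, t1', t2, t2', u⟩
    ext <;> simp [qAlpha, qBeta, qGamma, QuadraticMap.polar_add_left, QuadraticMap.polar_smul_left,
      QuadraticMap.polar_comm q b a]
    · ring
    · ring
    · abel
  · intro t a
    refine comm_inv_eq ?_
    rw [h₁, h₂, h₃, h₄]
    refine (induced_mul _ _).trans ((induced_congr _ _ ?_).trans
      ((congrArg (· * _) ((congrArg (_ * ·) (induced_mul _ _)).trans (induced_mul _ _))).trans
        (induced_mul _ _)).symm)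
    rintro ⟨t1, t1', t2, t2', u⟩
    ext <;> simp [qAlpha, qBeta, qGamma, qDelta, QuadraticMap.polar_add_left,
      QuadraticMap.polar_smul_left, QuadraticMap.polar_smul_right, QuadraticMap.map_smul]
    · ring
    · ring
    · module
  · intro t
    refine ⟨_, isQDelta_qDelta t, qIsometry_qDelta q t, ?_⟩
    rw [h₁]
    exact induces_induced ((qIsometry_qDelta q t).isIsom hq)
  · intro t
    refine ⟨_, isQBeta_qBeta q t, qIsometry_qBeta q t, ?_⟩
    rw [h₂]
    exact induces_induced ((qIsometry_qBeta q t).isIsom hq)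
  · intro t
    refine ⟨_, isQGamma_qGamma t, qIsometry_qGamma q t, ?_⟩
    rw [h₃]
    exact induces_induced ((qIsometry_qGamma q t).isIsom hq)
  · intro t
    refine ⟨_, isQAlpha_qAlpha q t, qIsometry_qAlpha q t, ?_⟩
    rw [h₄]
    exact induces_induced ((qIsometry_qAlpha q t).isIsom hq)

theorem unop_induced_qRotation (i : ZMod (2 * 4)) :
    unop (induced ((qIsometry_qRotation q).isIsom hq)) (quadCoord hq i) = quadCoord hq (i + 2) :=
  unop_induced_rotate (isFrame_quad hq) _ one_ne_zero one_ne_zero one_ne_zero one_ne_zero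
    (one_smul K _).symm (one_smul K _).symm (one_smul K _).symm (one_smul K _).symm i

theorem unop_induced_qReflection (i : ZMod (2 * 4)) :
    unop (induced ((qIsometry_qReflection q).isIsom hq)) (quadCoord hq i) = quadCoord hq (-i) :=
  unop_induced_reflect (isFrame_quad hq) _ one_ne_zero one_ne_zero one_ne_zero one_ne_zero
    (one_smul K _).symm (one_smul K _).symm (one_smul K _).symm (one_smul K _).symm i

include hq

theorem quad_isMoufang : (quadGraph q).IsMoufang 4 :=
  (quad_isThickPolarSpace hq).isVeldkampPolygon.isMoufang
    (induced_mem_aut ((qIsometry_qRotation q).isIsom hq)) (unop_induced_qRotation hq)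
    (induced_mem_aut ((qIsometry_qReflection q).isIsom hq)) (unop_induced_qReflection hq)
    (isStraightCircuit_quadCoord hq) (quad_exists_delta hq).2 (quad_exists_beta hq).2

/-- Any coordinate system or its opposite is the image of the standard one under an automorphism,
and conjugation by that automorphism transports the root groups with their relations. -/
theorem quad_isOrthogonalOfType : IsOrthogonalOfType q (quadGraph q) := by
  have hΓ : (quadGraph q).IsVeldkampPolygon 4 := (quad_isThickPolarSpace hq).isVeldkampPolygon
  obtain ⟨x₁, x₂, x₃, x₄, hx, -⟩ := quad_exists_orthRel hq
  refine ⟨⟨by norm_num, hΓ, quad_isMoufang hq⟩, fun c hc => ?_⟩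
  refine (hΓ.exists_aut
    (induced_mem_aut ((qIsometry_qRotation q).isIsom hq)) (unop_induced_qRotation hq)
    (induced_mem_aut ((qIsometry_qReflection q).isIsom hq)) (unop_induced_qReflection hq)
    (isStraightCircuit_quadCoord hq) (quad_exists_delta hq).2 (quad_exists_beta hq).2 hc).imp ?_ ?_
  · rintro ⟨g, hg, rfl⟩
    exact hx.map (OppGraph.labelling_map hg _)
  · rintro ⟨g, hg, e⟩
    have e' : oppositeCoord 4 c = fun i => unop g (quadCoord hq i) := e
    rw [e']
    exact hx.map (OppGraph.labelling_map hg _)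

end Quadratic

end TitsQuad

namespace TitsQuad

open MulOpposite

namespace PQSpace

/-! ## The polar space of a pseudo-quadratic space -/

variable {K L : Type*} [DivisionRing K] [StarRing K] [AddCommGroup L] [Module Kᵐᵒᵖ L]
  (Λ : PQSpace K L)

theorem f_smul_right' (a b : L) (r : Kᵐᵒᵖ) : Λ.f a (r • b) = Λ.f a b * unop r :=
  Λ.f_smul_right a b (unop r)

theorem f_smul_left' (a b : L) (r : Kᵐᵒᵖ) : Λ.f (r • a) b = star (unop r) * Λ.f a b := by
  rw [← neg_inj, ← Λ.f_skew, f_smul_right', star_mul, Λ.f_skew, mul_neg]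

theorem f_sub_left (a b c : L) : Λ.f (a - b) c = Λ.f a c - Λ.f b c := by
  rw [sub_eq_add_neg, f_add_left, f_neg_left, sub_eq_add_neg]

theorem f_sub_right (a b c : L) : Λ.f a (b - c) = Λ.f a b - Λ.f a c := by
  rw [sub_eq_add_neg, f_add_right, f_neg_right, sub_eq_add_neg]

theorem q_neg (a : L) : Λ.q (-a) - Λ.q a ∈ Λ.K₀ := by
  have h := Λ.q_smul a (-1)
  rw [op_neg, op_one, neg_smul, one_smul] at h
  simpa using h

/-- In a pseudo-quadratic space `f(a, a) = q(a) - q(a)^σ`, unless `K₀ = K` has characteristic two. -/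
theorem f_self (hK : Λ.K₀ = ⊤ → ringChar K ≠ 2) (a : L) :
    Λ.f a a = Λ.q a - star (Λ.q a) := by
  by_cases h : Λ.K₀ = ⊤
  · have hs : ∀ t : K, star t = t := fun t => Λ.star_eq t (by rw [h]; trivial)
    have h1 := Λ.f_skew a a
    rw [hs] at h1
    rw [hs, sub_self]
    have h2 : (2 : K) ≠ 0 := Ring.two_ne_zero (hK h)
    have h3 : 2 * Λ.f a a = 0 := by rw [two_mul]; nth_rewrite 1 [h1]; simp
    exact (mul_eq_zero.1 h3).resolve_left h2
  · by_contra hne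
    apply h
    have hc : Λ.f a a - (Λ.q a - star (Λ.q a)) ≠ 0 := sub_ne_zero.2 hne
    -- Comparing the two expansions of q(a(1 + t)) gives ct ∈ K₀ for the defect c of the claimed
    -- identity and every t. As c is invertible, K₀ would be all of K.
    have key : ∀ t, (Λ.f a a - (Λ.q a - star (Λ.q a))) * t ∈ Λ.K₀ := by
      intro t
      have h1 := Λ.q_smul a (1 + t)
      have h2 := Λ.q_add a (op t • a)
      have h3 := Λ.q_smul a t
      have h4 := Λ.trace_mem (star t * Λ.q a)
      have e : op (1 + t) • a = a + op t • a := by rw [op_add, add_smul, op_one, one_smul]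
      rw [e] at h1
      rw [f_smul_right] at h2
      rw [star_mul, star_star] at h4
      have h5 := add_mem (sub_mem (sub_mem h1 h2) h3) h4
      convert h5 using 1
      rw [star_add, star_one]
      noncomm_ring
    rw [eq_top_iff]
    intro t _
    have := key ((Λ.f a a - (Λ.q a - star (Λ.q a)))⁻¹ * t)
    rwa [mul_inv_cancel_left₀ hc] at this

/-- The elements q(a) and t differ by an element of K₀, which σ fixes, so q(a) - q(a)^σ = t - t^σ.
-/
theorem T.f_self (hK : Λ.K₀ = ⊤ → ringChar K ≠ 2) (z : Λ.T) :
    Λ.f z.1.1 z.1.1 = z.1.2 - star z.1.2 := by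
  have h := Λ.star_eq _ z.2
  rw [star_sub] at h
  rw [Λ.f_self hK, sub_eq_sub_iff_sub_eq_sub]
  rw [← sub_eq_zero, ← neg_eq_zero] at h
  rw [← sub_eq_zero, ← h]
  abel

theorem bigQ_mk (t1 t1' t2 t2' : K) (a : L) :
    Λ.bigQ (t1, t1', t2, t2', a) = star t1 * t1' + star t2 * t2' + Λ.q a := rfl

theorem bigF_mk (s1 s1' s2 s2' t1 t1' t2 t2' : K) (b a : L) :
    Λ.bigF (s1, s1', s2, s2', b) (t1, t1', t2, t2', a) =
      star s1 * t1' - star s1' * t1 + star s2 * t2' - star s2' * t2 + Λ.f b a := rfl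

theorem star_bigF (v w : HypSum K L) : star (Λ.bigF v w) = -Λ.bigF w v := by
  obtain ⟨s1, s1', s2, s2', b⟩ := v
  obtain ⟨t1, t1', t2, t2', a⟩ := w
  simp only [bigF_mk, star_add, star_sub, star_mul, star_star, Λ.f_skew]
  abel

theorem bigF_add_right (v w w' : HypSum K L) :
    Λ.bigF v (w + w') = Λ.bigF v w + Λ.bigF v w' := by
  obtain ⟨s1, s1', s2, s2', b⟩ := v
  obtain ⟨t1, t1', t2, t2', a⟩ := w
  obtain ⟨r1, r1', r2, r2', c⟩ := w'
  simp only [Prod.mk_add_mk, bigF_mk, Λ.f_add_right, mul_add]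
  abel

theorem bigF_smul_right (t : Kᵐᵒᵖ) (v w : HypSum K L) :
    Λ.bigF v (t • w) = Λ.bigF v w * unop t := by
  obtain ⟨s1, s1', s2, s2', b⟩ := v
  obtain ⟨t1, t1', t2, t2', a⟩ := w
  simp only [Prod.smul_mk, smul_eq_mul_unop, bigF_mk, Λ.f_smul_right', add_mul, sub_mul, mul_assoc]

theorem bigF_eq_zero_comm {v w : HypSum K L} : Λ.bigF v w = 0 ↔ Λ.bigF w v = 0 := by
  rw [← neg_eq_zero, ← star_bigF, star_eq_zero]

/-- On the hyperbolic part the error terms are traces t + t^σ, which lie in K₀. -/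
theorem bigQ_add (v w : HypSum K L) :
    Λ.bigQ (v + w) - (Λ.bigQ v + Λ.bigQ w + Λ.bigF v w) ∈ Λ.K₀ := by
  obtain ⟨s1, s1', s2, s2', b⟩ := v
  obtain ⟨t1, t1', t2, t2', a⟩ := w
  have h1 := Λ.trace_mem (star t1 * s1')
  have h2 := Λ.trace_mem (star t2 * s2')
  have h3 := Λ.q_add b a
  rw [star_mul, star_star] at h1 h2
  convert add_mem (add_mem h1 h2) h3 using 1
  simp only [Prod.mk_add_mk, bigF_mk, bigQ_mk, star_add, mul_add, add_mul]
  abel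

theorem bigQ_smul (t : Kᵐᵒᵖ) (v : HypSum K L) :
    Λ.bigQ (t • v) - star (unop t) * Λ.bigQ v * unop t ∈ Λ.K₀ := by
  obtain ⟨s1, s1', s2, s2', b⟩ := v
  convert Λ.q_smul b (unop t) using 1
  simp only [Prod.smul_mk, smul_eq_mul_unop, bigQ_mk, star_mul, mul_add, add_mul, mul_assoc, op_unop]
  abel

theorem bigF_self (hK : Λ.K₀ = ⊤ → ringChar K ≠ 2) (v : HypSum K L) :
    Λ.bigF v v = Λ.bigQ v - star (Λ.bigQ v) := by
  obtain ⟨s1, s1', s2, s2', b⟩ := v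
  simp only [bigF_mk, bigQ_mk, star_add, star_mul, star_star, Λ.f_self hK]
  abel

variable {Λ}

theorem bigQ_add_mem_iff {v w : HypSum K L} :
    Λ.bigQ (v + w) ∈ Λ.K₀ ↔ Λ.bigQ v + Λ.bigQ w + Λ.bigF v w ∈ Λ.K₀ := by
  have h := Λ.bigQ_add v w
  refine ⟨fun h' => ?_, fun h' => ?_⟩
  · have := sub_mem h' h
    rwa [sub_sub_cancel] at this
  · have := add_mem h h'
    rwa [sub_add_cancel] at this

theorem bigQ_smul_mem {v : HypSum K L} (t : Kᵐᵒᵖ) (hv : Λ.bigQ v ∈ Λ.K₀) :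
    Λ.bigQ (t • v) ∈ Λ.K₀ := by
  have := add_mem (Λ.bigQ_smul t v) (Λ.conj_mem (unop t) _ hv)
  rwa [sub_add_cancel] at this

theorem eq_zero_of_bigF (hΛ : Λ.Nondegenerate) {v : HypSum K L} (hv : Λ.bigQ v ∈ Λ.K₀)
    (h : ∀ w, Λ.bigF v w = 0) : v = 0 := by
  obtain ⟨s1, s1', s2, s2', b⟩ := v
  have h1 := h (1, 0, 0, 0, 0)
  have h2 := h (0, 1, 0, 0, 0)
  have h3 := h (0, 0, 1, 0, 0)
  have h4 := h (0, 0, 0, 1, 0)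
  have h5 : ∀ a, Λ.f b a = 0 := fun a => by simpa [bigF_mk] using h (0, 0, 0, 0, a)
  simp only [bigF_mk, Λ.f_zero_right, mul_zero, mul_one, add_zero, zero_add, sub_zero, zero_sub,
    neg_eq_zero, star_eq_zero] at h1 h2 h3 h4
  subst h1 h2 h3 h4
  simp only [bigQ_mk, mul_zero, add_zero, zero_add] at hv
  rw [hΛ b h5 hv]
  rfl

/-- Isotropy and orthogonality in `K⁴ ⊕ L`. -/
def polarForm (hΛ : Λ.Nondegenerate) (hK : Λ.K₀ = ⊤ → ringChar K ≠ 2) :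
    PolarForm Kᵐᵒᵖ (HypSum K L) where
  iso v := Λ.bigQ v ∈ Λ.K₀
  orth v w := Λ.bigF v w = 0
  iso_smul t v hv := bigQ_smul_mem t hv
  iso_add hv hw h := by
    rw [bigQ_add_mem_iff, h, add_zero]
    exact add_mem hv hw
  orth_self hv := by rw [Λ.bigF_self hK, Λ.star_eq _ hv, sub_self]
  orth_symm h := Λ.bigF_eq_zero_comm.1 h
  orth_zero v := by simpa using Λ.bigF_smul_right 0 v 0
  orth_add h h' := by rw [bigF_add_right, h, h', add_zero]
  orth_smul t v w h := by rw [bigF_smul_right, h, zero_mul]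
  exists_orth {v e} h w := ⟨op (-((Λ.bigF v e)⁻¹ * Λ.bigF v w)), by
    rw [bigF_add_right, bigF_smul_right, unop_op, mul_neg, mul_inv_cancel_left₀ h, add_neg_cancel]⟩
  exists_iso {e w} he h := by
    rw [bigF_eq_zero_comm] at h
    refine ⟨op (-((Λ.bigF w e)⁻¹ * Λ.bigQ w)), ?_⟩
    rw [bigQ_add_mem_iff, bigF_smul_right, unop_op, mul_neg, mul_inv_cancel_left₀ h,
      add_neg_cancel_comm]
    exact bigQ_smul_mem _ he
  nondeg := eq_zero_of_bigF hΛ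
  exists_third {c e f} hc h0 he hf hce hcf hef := by
    -- Modulo K₀, Q takes the value F(e, f) F(e, f)⁻¹ = 1 on this vector, and 1 ∈ K₀. So the
    -- hyperbolic line ef contains a third isotropic point, whatever L is.
    refine ⟨e + op (Λ.bigF e f)⁻¹ • f, ?_, ?_, ?_, ?_⟩
    · rw [bigQ_add_mem_iff, bigF_smul_right, unop_op, mul_inv_cancel₀ hef]
      exact add_mem (add_mem he (bigQ_smul_mem _ hf)) Λ.one_mem
    · rw [bigF_add_right, bigF_smul_right, hce, hcf, zero_mul, add_zero]
    · rw [bigF_add_right, bigF_smul_right, unop_op, mul_inv_cancel₀ hef, Λ.bigF_self hK,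
        Λ.star_eq _ he, sub_self, zero_add]
      exact one_ne_zero
    · rw [bigF_add_right, bigF_smul_right, Λ.bigF_self hK f, Λ.star_eq _ hf, sub_self, zero_mul,
        add_zero]
      exact fun h => hef (Λ.bigF_eq_zero_comm.1 h)

/-! ### Isometries of pseudo-quadratic spaces -/

/-- The inverse is formed with z⁻¹ in T; its extra term f(a, a) cancels the contribution of the
L-component that has moved. -/
def alpha (z : Λ.T) : HypSum K L ≃ₗ[Kᵐᵒᵖ] HypSum K L where
  toFun v := (v.1 + z.1.2 * v.2.1 + Λ.f z.1.1 v.2.2.2.2, v.2.1, v.2.2.1, v.2.2.2.1,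
    v.2.2.2.2 + op v.2.1 • z.1.1)
  invFun v := (v.1 + (z⁻¹).1.2 * v.2.1 + Λ.f (z⁻¹).1.1 v.2.2.2.2, v.2.1, v.2.2.1, v.2.2.2.1,
    v.2.2.2.2 + op v.2.1 • (z⁻¹).1.1)
  map_add' v w := by
    ext <;> simp only [Prod.fst_add, Prod.snd_add, Λ.f_add_right, op_add, add_smul, mul_add] <;> abel
  map_smul' t v := by
    ext <;> simp only [Prod.smul_fst, Prod.smul_snd, smul_eq_mul_unop, Λ.f_smul_right',
      RingHom.id_apply, smul_add, smul_smul, mul_assoc, op_mul, op_unop]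
  left_inv v := by
    ext <;> simp only [T.inv_fst, T.inv_snd, Λ.f_add_right, Λ.f_neg_left, Λ.f_smul_right, add_mul,
      smul_neg, neg_mul] <;> abel
  right_inv v := by
    ext <;> simp only [T.inv_fst, T.inv_snd, Λ.f_add_right, Λ.f_neg_left, Λ.f_neg_right,
      Λ.f_smul_right, add_mul, smul_neg, neg_mul] <;> abel

def beta (z : Λ.T) : HypSum K L ≃ₗ[Kᵐᵒᵖ] HypSum K L where
  toFun v := (v.1, v.2.1, v.2.2.1, v.2.2.2.1 - z.1.2 * v.2.2.1 + Λ.f z.1.1 v.2.2.2.2,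
    v.2.2.2.2 - op v.2.2.1 • z.1.1)
  invFun v := (v.1, v.2.1, v.2.2.1, v.2.2.2.1 - (z⁻¹).1.2 * v.2.2.1 + Λ.f (z⁻¹).1.1 v.2.2.2.2,
    v.2.2.2.2 - op v.2.2.1 • (z⁻¹).1.1)
  map_add' v w := by
    ext <;> simp only [Prod.fst_add, Prod.snd_add, Λ.f_add_right, op_add, add_smul, mul_add] <;> abel
  map_smul' t v := by
    ext <;> simp only [Prod.smul_fst, Prod.smul_snd, smul_eq_mul_unop, Λ.f_smul_right', add_mul,
      sub_mul, RingHom.id_apply, smul_sub, smul_smul, mul_assoc, op_mul, op_unop]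
  left_inv v := by
    ext <;> simp only [T.inv_fst, T.inv_snd, Λ.f_sub_right, Λ.f_neg_left, Λ.f_smul_right, add_mul,
      smul_neg, neg_mul] <;> abel
  right_inv v := by
    ext <;> simp only [T.inv_fst, T.inv_snd, Λ.f_sub_right, Λ.f_neg_left, Λ.f_neg_right,
      Λ.f_smul_right, add_mul, smul_neg, neg_mul] <;> abel

variable (L) in
def gamma (t : K) : HypSum K L ≃ₗ[Kᵐᵒᵖ] HypSum K L where
  toFun v := (v.1 - t * v.2.2.1, v.2.1, v.2.2.1, v.2.2.2.1 + star t * v.2.1, v.2.2.2.2)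
  invFun v := (v.1 + t * v.2.2.1, v.2.1, v.2.2.1, v.2.2.2.1 - star t * v.2.1, v.2.2.2.2)
  map_add' v w := by
    ext <;> simp only [Prod.fst_add, Prod.snd_add, mul_add] <;> abel
  map_smul' t v := by
    ext <;> simp only [Prod.smul_fst, Prod.smul_snd, smul_eq_mul_unop, add_mul, sub_mul,
      RingHom.id_apply, mul_assoc]
  left_inv v := by ext <;> simp
  right_inv v := by ext <;> simp

variable (L) in
def delta (s : K) : HypSum K L ≃ₗ[Kᵐᵒᵖ] HypSum K L where
  toFun v := (v.1, v.2.1 - s * v.2.2.1, v.2.2.1, v.2.2.2.1 - star s * v.1, v.2.2.2.2)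
  invFun v := (v.1, v.2.1 + s * v.2.2.1, v.2.2.1, v.2.2.2.1 + star s * v.1, v.2.2.2.2)
  map_add' v w := by
    ext <;> simp only [Prod.fst_add, Prod.snd_add, mul_add] <;> abel
  map_smul' t v := by
    ext <;> simp only [Prod.smul_fst, Prod.smul_snd, smul_eq_mul_unop, sub_mul,
      RingHom.id_apply, mul_assoc]
  left_inv v := by ext <;> simp
  right_inv v := by ext <;> simp

variable (K L) in
/-- The map `x₂ ↦ x₁ ↦ x₂' ↦ x₁' ↦ -x₂`. -/
def rotation : HypSum K L ≃ₗ[Kᵐᵒᵖ] HypSum K L where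
  toFun v := (v.2.2.1, v.2.2.2.1, -v.2.1, v.1, v.2.2.2.2)
  invFun v := (v.2.2.2.1, -v.2.2.1, v.1, v.2.1, v.2.2.2.2)
  map_add' v w := by ext <;> simp [add_comm]
  map_smul' t v := by ext <;> simp
  left_inv v := by ext <;> simp
  right_inv v := by ext <;> simp

variable (K L) in
/-- The map `x₁ ↦ x₁' ↦ -x₁`. -/
def reflection : HypSum K L ≃ₗ[Kᵐᵒᵖ] HypSum K L where
  toFun v := (-v.2.1, v.1, v.2.2.1, v.2.2.2.1, v.2.2.2.2)
  invFun v := (v.2.1, -v.1, v.2.2.1, v.2.2.2.1, v.2.2.2.2)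
  map_add' v w := by ext <;> simp [add_comm]
  map_smul' t v := by ext <;> simp
  left_inv v := by ext <;> simp
  right_inv v := by ext <;> simp

theorem isAlpha_alpha (z : Λ.T) : IsAlpha z (alpha z) := by
  refine ⟨?_, ?_, ?_, ?_, fun u => ?_⟩ <;>
  ext <;> simp [alpha, vx1, vx2, vy1, vy2, vL, Λ.f_zero_right]

theorem isBeta_beta (z : Λ.T) : IsBeta z (beta z) := by
  refine ⟨?_, ?_, ?_, ?_, fun u => ?_⟩ <;>
  ext <;> simp [beta, vx1, vx2, vy1, vy2, vL, Λ.f_zero_right]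

theorem isGamma_gamma (t : K) : IsGamma t (gamma L t) := by
  refine ⟨?_, ?_, fun u => ?_, ?_, ?_⟩ <;>
  ext <;> simp [gamma, vx1, vx2, vy1, vy2, vL]

theorem isDelta_delta (t : K) : IsDelta t (delta L t) := by
  refine ⟨?_, ?_, fun u => ?_, ?_, ?_⟩ <;>
  ext <;> simp [delta, vx1, vx2, vy1, vy2, vL]

/-- Invariance of Q is a congruence, whose corrections are values of q, a conjugate of q(a) - t and
a conjugate of a trace. Invariance of F is an exact identity and rests on f(a, a) = t - t^σ. -/
theorem isometry_alpha (hK : Λ.K₀ = ⊤ → ringChar K ≠ 2) (z : Λ.T) : Λ.Isometry (alpha z) := by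
  constructor
  · rintro ⟨t1, t1', t2, t2', u⟩
    have h1 := Λ.q_add u (op t1' • z.1.1)
    have h2 := Λ.q_smul z.1.1 t1'
    have h3 := Λ.conj_mem t1' _ z.2
    have h4 := Λ.conj_mem t1' _ (Λ.trace_mem z.1.2)
    convert add_mem (add_mem (add_mem h1 h2) h3) h4 using 1
    simp only [alpha, LinearEquiv.coe_mk, LinearMap.coe_mk, AddHom.coe_mk, bigQ_mk, star_add,
      star_mul, Λ.f_skew, Λ.f_smul_right]
    noncomm_ring
  · rintro ⟨t1, t1', t2, t2', u⟩ ⟨s1, s1', s2, s2', b⟩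
    simp only [alpha, LinearEquiv.coe_mk, LinearMap.coe_mk, AddHom.coe_mk, bigF_mk, star_add,
      star_mul, Λ.f_skew, Λ.f_smul_right', Λ.f_smul_left', unop_op, Λ.f_add_left, Λ.f_add_right,
      T.f_self Λ hK]
    noncomm_ring

theorem isometry_beta (hK : Λ.K₀ = ⊤ → ringChar K ≠ 2) (z : Λ.T) : Λ.Isometry (beta z) := by
  constructor
  · rintro ⟨t1, t1', t2, t2', u⟩
    have h0 := Λ.q_neg (op t2 • z.1.1)
    have h1 := Λ.q_add u (-(op t2 • z.1.1))
    have h2 := Λ.q_smul z.1.1 t2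
    have h3 := Λ.conj_mem t2 _ z.2
    have h4 := Λ.trace_mem (star t2 * Λ.f z.1.1 u)
    rw [← sub_eq_add_neg] at h1
    convert add_mem (add_mem (add_mem (add_mem h0 h1) h2) h3) h4 using 1
    simp only [beta, LinearEquiv.coe_mk, LinearMap.coe_mk, AddHom.coe_mk, bigQ_mk,
      star_mul, star_star, Λ.f_skew, Λ.f_smul_right, Λ.f_neg_right]
    noncomm_ring
  · rintro ⟨t1, t1', t2, t2', u⟩ ⟨s1, s1', s2, s2', b⟩
    simp only [beta, LinearEquiv.coe_mk, LinearMap.coe_mk, AddHom.coe_mk, bigF_mk, star_add,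
      star_sub, star_mul, Λ.f_skew, Λ.f_smul_right', Λ.f_smul_left', unop_op, Λ.f_sub_left,
      Λ.f_sub_right, T.f_self Λ hK]
    noncomm_ring

variable (Λ)

theorem isometry_gamma (t : K) : Λ.Isometry (gamma L t) := by
  constructor
  · rintro ⟨t1, t1', t2, t2', u⟩
    convert Λ.K₀.zero_mem using 1
    simp only [gamma, LinearEquiv.coe_mk, LinearMap.coe_mk, AddHom.coe_mk, bigQ_mk, star_sub,
      star_mul]
    noncomm_ring
  · rintro ⟨t1, t1', t2, t2', u⟩ ⟨s1, s1', s2, s2', b⟩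
    simp only [gamma, LinearEquiv.coe_mk, LinearMap.coe_mk, AddHom.coe_mk, bigF_mk, star_add,
      star_sub, star_mul, star_star]
    noncomm_ring

theorem isometry_delta (t : K) : Λ.Isometry (delta L t) := by
  constructor
  · rintro ⟨t1, t1', t2, t2', u⟩
    convert neg_mem (Λ.trace_mem (star t1 * t * t2)) using 1
    simp only [delta, LinearEquiv.coe_mk, LinearMap.coe_mk, AddHom.coe_mk, bigQ_mk,
      star_mul, star_star]
    noncomm_ring
  · rintro ⟨t1, t1', t2, t2', u⟩ ⟨s1, s1', s2, s2', b⟩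
    simp only [delta, LinearEquiv.coe_mk, LinearMap.coe_mk, AddHom.coe_mk, bigF_mk,
      star_sub, star_mul, star_star]
    noncomm_ring

theorem isometry_rotation : Λ.Isometry (rotation K L) := by
  constructor
  · rintro ⟨t1, t1', t2, t2', u⟩
    convert neg_mem (Λ.trace_mem (star t1 * t1')) using 1
    simp only [rotation, LinearEquiv.coe_mk, LinearMap.coe_mk, AddHom.coe_mk, bigQ_mk,
      star_mul, star_star, star_neg]
    noncomm_ring
  · rintro ⟨t1, t1', t2, t2', u⟩ ⟨s1, s1', s2, s2', b⟩
    simp only [rotation, LinearEquiv.coe_mk, LinearMap.coe_mk, AddHom.coe_mk, bigF_mk, star_neg]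
    noncomm_ring

theorem isometry_reflection : Λ.Isometry (reflection K L) := by
  constructor
  · rintro ⟨t1, t1', t2, t2', u⟩
    convert neg_mem (Λ.trace_mem (star t1 * t1')) using 1
    simp only [reflection, LinearEquiv.coe_mk, LinearMap.coe_mk, AddHom.coe_mk, bigQ_mk,
      star_mul, star_star, star_neg]
    noncomm_ring
  · rintro ⟨t1, t1', t2, t2', u⟩ ⟨s1, s1', s2, s2', b⟩
    simp only [reflection, LinearEquiv.coe_mk, LinearMap.coe_mk, AddHom.coe_mk, bigF_mk, star_neg]
    noncomm_ring

end PQSpace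

end TitsQuad

namespace TitsQuad

open MulOpposite

namespace PQSpace

open PolarForm

variable {K L : Type*} [DivisionRing K] [StarRing K] [AddCommGroup L] [Module Kᵐᵒᵖ L]
  {Λ : PQSpace K L}

/-! ### The standard coordinate system and its root groups in the pseudo-quadratic case -/

section Coordinates

variable (hΛ : Λ.Nondegenerate) (hK : Λ.K₀ = ⊤ → ringChar K ≠ 2)

theorem Isometry.isIsom {φ : HypSum K L ≃ₗ[Kᵐᵒᵖ] HypSum K L} (h : Λ.Isometry φ) :
    (polarForm hΛ hK).IsIsom φ := by
  refine ⟨fun v => ?_, fun v w => ?_⟩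
  · change Λ.bigQ _ ∈ Λ.K₀ ↔ Λ.bigQ _ ∈ Λ.K₀
    refine ⟨fun h' => ?_, fun h' => ?_⟩
    · simpa using sub_mem h' (h.1 v)
    · simpa using add_mem (h.1 v) h'
  · change Λ.bigF _ _ = 0 ↔ Λ.bigF _ _ = 0
    rw [h.2]

theorem isFrame : (polarForm hΛ hK).IsFrame (vx2 K) (vx1 K) (vy2 K) (vy1 K) := by
  have h := Λ.q_zero_mem
  constructor <;> simp [polarForm, vx1, vx2, vy1, vy2, bigQ_mk, bigF_mk, f_zero_left, h]

/-- The standard coordinate system in the pseudo-quadratic case. -/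
noncomputable def coord : ZMod (2 * 4) → Points Λ.Tot ⊕ isoLines Λ.Tot :=
  -- The circuit of the frame has x₂ at place 0, while the standard numbering has it at place 1.
  fun i => frameCircuit (isFrame hΛ hK) (i - 1)

theorem isStandard_coord : Λ.IsStandard (coord hΛ hK) := by
  have hf := isFrame hΛ hK
  refine ⟨rfl, ?_, rfl, ?_, rfl, ?_, rfl, ?_⟩
  · exact (vertexSpace_frameCircuit_one hf).trans (by rw [Set.pair_comm])
  · exact vertexSpace_frameCircuit_three hf
  · exact (vertexSpace_frameCircuit_five hf).trans (by rw [Set.pair_comm])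
  · exact vertexSpace_frameCircuit_seven hf

include hΛ hK in
theorem isThickPolarSpace : IsThickPolarSpace (isoLines Λ.Tot) :=
  PolarForm.isThickPolarSpace (isFrame hΛ hK)

theorem isStraightCircuit_coord : Λ.graph.IsStraightCircuit 4 (coord hΛ hK) := by
  obtain ⟨h1, h2, h3⟩ := isStraightCircuit_frameCircuit (isFrame hΛ hK)
  refine ⟨fun i j h => sub_left_injective (h1 h), fun i => ?_, fun i => ?_⟩
  · have := h2 (i - 1)
    rwa [sub_add_eq_add_sub] at this
  · have := h3 (i - 1)
    rwa [sub_right_comm, sub_add_eq_add_sub] at this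

theorem exists_alpha :
    (∃ x₁ : Λ.T ≃* Λ.graph.labelling 4 (coord hΛ hK) 1,
      ∀ z, (x₁ z : (Equiv.Perm (Points Λ.Tot ⊕ isoLines Λ.Tot))ᵐᵒᵖ) =
        induced ((isometry_alpha hK z).isIsom hΛ hK)) ∧
    Λ.graph.RootTransitive fun j => coord hΛ hK (j + 1) := by
  have hf := isFrame hΛ hK
  refine exists_mulEquiv_point (Λ := polarForm hΛ hK) (b := vx2 K) (c := vx1 K) (d := vy2 K)
    (a := vy1 K) (isThickPolarSpace hΛ hK).isVeldkampPolygon (isStraightCircuit_coord hΛ hK) 1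
    hf.ne_zero hf.rotate.ne_zero hf.rotate.rotate.ne_zero
    (vertexSpace_frameCircuit_one hf)
    (vertexSpace_frameCircuit_two hf) (vertexSpace_frameCircuit_three hf)
    (vertexSpace_frameCircuit_four hf) (vertexSpace_frameCircuit_five hf)
    hf.notMem_span hf.rotate.notMem_span hf.rotate.rotate.notMem_span
    hf.not_orth_ac alpha
    (fun z => (isometry_alpha hK z).isIsom hΛ hK) ?_ ?_ ?_ ?_ ?_ ?_ ?_
  · rintro y z ⟨t1, t1', t2, t2', u⟩
    ext <;> simp [alpha, T.mul_fst, T.mul_snd, f_add_left, f_add_right, f_smul_right, add_mul,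
      add_assoc]
    abel
  · exact fun z => (isAlpha_alpha z).2.1
  · exact fun z => (isAlpha_alpha z).1
  · exact fun z => (isAlpha_alpha z).2.2.1
  · rintro z ⟨t1, t1', t2, t2', u⟩ h
    have h' : t1' = 0 := by simpa [polarForm, bigF_mk, vx1, f_zero_left] using h
    refine mem_span_of_eq_smul (op (Λ.f z.1.1 u)) ?_
    ext <;> simp [alpha, vx1, h']
  · intro z h
    obtain ⟨s, t, ht⟩ := Submodule.mem_span_pair.1 h
    have h1 := congrArg (fun v : HypSum K L => v.2.2.2.2) ht
    have h2 := congrArg (fun v : HypSum K L => v.1) ht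
    have h1' : (0 : L) = z.1.1 := by simpa [alpha, vy1, vy2] using h1
    have h2' : (0 : K) = z.1.2 := by simpa [alpha, vy1, vy2, f_zero_right] using h2
    exact T.ext h1'.symm h2'.symm
  · rintro ⟨t1, t1', t2, t2', u⟩ hi h1 h2 h3
    have h1' : t2 = 0 := by simpa [polarForm, bigF_mk, vy2, f_zero_left] using h1
    have h2' : t2' = 0 := by simpa [polarForm, bigF_mk, vx2, f_zero_left] using h2
    have h3' : t1' ≠ 0 := by simpa [polarForm, bigF_mk, vx1, f_zero_left] using h3
    have hi' := bigQ_smul_mem (op t1'⁻¹) hi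
    -- With x₁'-coordinate 1 and x₁-coordinate t, isotropy says t^σ + q(u) ∈ K₀, whereas membership
    -- in T asks for q(u) - t. The difference is the trace t + t^σ.
    have e := Λ.trace_mem (t1 * t1'⁻¹)
    have hm : Λ.q (op t1'⁻¹ • u) - t1 * t1'⁻¹ ∈ Λ.K₀ := by
      convert sub_mem hi' e using 1
      simp [bigQ_mk, h1', h2', h3']
      abel
    refine ⟨⟨(op t1'⁻¹ • u, t1 * t1'⁻¹), hm⟩, mem_span_of_eq_smul (op t1'⁻¹) ?_⟩
    ext <;> simp [alpha, vy1, h1', h2', h3', f_zero_right]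

theorem exists_beta :
    ∃ x₃ : Λ.T ≃* Λ.graph.labelling 4 (coord hΛ hK) 3,
      ∀ z, (x₃ z : (Equiv.Perm (Points Λ.Tot ⊕ isoLines Λ.Tot))ᵐᵒᵖ) =
        induced ((isometry_beta hK z).isIsom hΛ hK) := by
  have hf := isFrame hΛ hK
  refine (exists_mulEquiv_point (Λ := polarForm hΛ hK) (b := vx1 K) (c := vy2 K) (d := vy1 K)
    (a := vx2 K) (isThickPolarSpace hΛ hK).isVeldkampPolygon (isStraightCircuit_coord hΛ hK) 3
    hf.rotate.ne_zero hf.rotate.rotate.ne_zero hf.rotate.rotate.rotate.ne_zero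
    (vertexSpace_frameCircuit_three hf)
    (vertexSpace_frameCircuit_four hf) (vertexSpace_frameCircuit_five hf)
    (vertexSpace_frameCircuit_six hf) (vertexSpace_frameCircuit_seven hf)
    hf.rotate.notMem_span hf.rotate.rotate.notMem_span hf.rotate.rotate.rotate.notMem_span
    hf.not_orth_bd beta
    (fun z => (isometry_beta hK z).isIsom hΛ hK) ?_ ?_ ?_ ?_ ?_ ?_ ?_).1
  · rintro y z ⟨t1, t1', t2, t2', u⟩
    ext <;> simp [beta, T.mul_fst, T.mul_snd, f_add_left, f_sub_right, f_smul_right, add_mul] <;>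
    abel
  · exact fun z => (isBeta_beta z).1
  · exact fun z => (isBeta_beta z).2.2.1
  · exact fun z => (isBeta_beta z).2.1
  · rintro z ⟨t1, t1', t2, t2', u⟩ h
    have h' : t2 = 0 := by simpa [polarForm, bigF_mk, vy2, f_zero_left] using h
    refine mem_span_of_eq_smul (op (Λ.f z.1.1 u)) ?_
    ext <;> simp [beta, vy2, h']
  · intro z h
    obtain ⟨s, t, ht⟩ := Submodule.mem_span_pair.1 h
    have h1 := congrArg (fun v : HypSum K L => v.2.2.2.2) ht
    have h2 := congrArg (fun v : HypSum K L => v.2.2.2.1) ht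
    have h1' : (0 : L) = -z.1.1 := by simpa [beta, vx2, vy1] using h1
    have h2' : (0 : K) = -z.1.2 := by simpa [beta, vx2, vy1, f_zero_right] using h2
    exact T.ext (neg_eq_zero.1 h1'.symm) (neg_eq_zero.1 h2'.symm)
  · rintro ⟨t1, t1', t2, t2', u⟩ hi h1 h2 h3
    have h1' : t1 = 0 := by simpa [polarForm, bigF_mk, vy1, f_zero_left] using h1
    have h2' : t1' = 0 := by simpa [polarForm, bigF_mk, vx1, f_zero_left] using h2
    have h3' : t2 ≠ 0 := by simpa [polarForm, bigF_mk, vy2, f_zero_left] using h3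
    have hi' := bigQ_smul_mem (op t2⁻¹) hi
    -- The signs come from β, which moves x₂ to x₂ - x₂'s - b; replacing u by -u changes q only
    -- modulo K₀.
    have hm : Λ.q (-(op t2⁻¹ • u)) - -(t2' * t2⁻¹) ∈ Λ.K₀ := by
      convert add_mem hi' (Λ.q_neg (op t2⁻¹ • u)) using 1
      simp [bigQ_mk, h1', h2', h3']
      abel
    refine ⟨⟨(-(op t2⁻¹ • u), -(t2' * t2⁻¹)), hm⟩, mem_span_of_eq_smul (op t2⁻¹) ?_⟩
    ext <;> simp [beta, vx2, h1', h2', h3', f_zero_right]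

theorem exists_gamma :
    (∃ x₂ : Multiplicative K ≃* Λ.graph.labelling 4 (coord hΛ hK) 2,
      ∀ t, (x₂ t : (Equiv.Perm (Points Λ.Tot ⊕ isoLines Λ.Tot))ᵐᵒᵖ) =
        induced ((Λ.isometry_gamma t.toAdd).isIsom hΛ hK)) ∧
    Λ.graph.RootTransitive fun j => coord hΛ hK (j + 2) := by
  have hf := isFrame hΛ hK
  refine exists_mulEquiv_line (Λ := polarForm hΛ hK) (b := vx1 K) (c := vy2 K) (d := vy1 K)
    (isThickPolarSpace hΛ hK).isVeldkampPolygon (isStraightCircuit_coord hΛ hK) 2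
    hf.rotate.ne_zero hf.rotate.rotate.ne_zero (vertexSpace_frameCircuit_two hf)
    (vertexSpace_frameCircuit_three hf) (vertexSpace_frameCircuit_four hf)
    (vertexSpace_frameCircuit_five hf) (vertexSpace_frameCircuit_six hf)
    hf.rotate.notMem_span hf.rotate.rotate.notMem_span
    (fun t : Multiplicative K => gamma L t.toAdd)
    (fun t => (Λ.isometry_gamma t.toAdd).isIsom hΛ hK) ?_ ?_ ?_ ?_ ?_ ?_ ?_
  · rintro a b ⟨t1, t1', t2, t2', u⟩
    ext <;> simp [gamma, add_mul] <;> abel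
  · exact fun t => (isGamma_gamma t.toAdd).1
  · exact fun t => (isGamma_gamma t.toAdd).2.1
  · rintro a ⟨t1, t1', t2, t2', u⟩ h
    have h' : t1' = 0 := by simpa [polarForm, bigF_mk, vx1, f_zero_left] using h
    refine mem_span_of_eq_smul (op (-(a.toAdd * t2))) ?_
    ext <;> simp [gamma, vx1, h']
  · rintro a ⟨t1, t1', t2, t2', u⟩ h
    have h' : t2 = 0 := by simpa [polarForm, bigF_mk, vy2, f_zero_left] using h
    refine mem_span_of_eq_smul (op (star a.toAdd * t1')) ?_
    ext <;> simp [gamma, vy2, h']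
  · intro a h
    obtain ⟨t, ht⟩ := Submodule.mem_span_singleton.1 h
    have := congrArg (fun v : HypSum K L => v.2.2.2.1) ht
    have h0 : (0 : K) = star a.toAdd := by simpa [gamma, vy1] using this
    exact Multiplicative.toAdd.injective (star_eq_zero.1 h0.symm)
  · intro s
    -- γ_t adds x₂' t^σ to x₁', so the parameter is the conjugate of the scalar.
    refine ⟨.ofAdd (star (unop s)), (isGamma_gamma _).2.2.2.1.trans ?_⟩
    rw [toAdd_ofAdd, star_star, op_unop]

theorem exists_delta :
    ∃ x₄ : Multiplicative K ≃* Λ.graph.labelling 4 (coord hΛ hK) 4,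
      ∀ t, (x₄ t : (Equiv.Perm (Points Λ.Tot ⊕ isoLines Λ.Tot))ᵐᵒᵖ) =
        induced ((Λ.isometry_delta t.toAdd).isIsom hΛ hK) := by
  have hf := isFrame hΛ hK
  refine (exists_mulEquiv_line (Λ := polarForm hΛ hK) (b := vy2 K) (c := vy1 K) (d := vx2 K)
    (isThickPolarSpace hΛ hK).isVeldkampPolygon (isStraightCircuit_coord hΛ hK) 4
    hf.rotate.rotate.ne_zero hf.rotate.rotate.rotate.ne_zero (vertexSpace_frameCircuit_four hf)
    (vertexSpace_frameCircuit_five hf) (vertexSpace_frameCircuit_six hf)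
    (vertexSpace_frameCircuit_seven hf) (vertexSpace_frameCircuit_zero hf)
    hf.rotate.rotate.notMem_span hf.rotate.rotate.rotate.notMem_span
    (fun t : Multiplicative K => delta L t.toAdd)
    (fun t => (Λ.isometry_delta t.toAdd).isIsom hΛ hK) ?_ ?_ ?_ ?_ ?_ ?_ ?_).1
  · rintro a b ⟨t1, t1', t2, t2', u⟩
    ext <;> simp [delta, add_mul] <;> abel
  · exact fun t => (isDelta_delta t.toAdd).2.1
  · exact fun t => (isDelta_delta t.toAdd).1
  · rintro a ⟨t1, t1', t2, t2', u⟩ h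
    have h' : t2 = 0 := by simpa [polarForm, bigF_mk, vy2, f_zero_left] using h
    refine mem_span_of_eq_smul (op (-(star a.toAdd * t1))) ?_
    ext <;> simp [delta, vy2, h']
  · rintro a ⟨t1, t1', t2, t2', u⟩ h
    have h' : t1 = 0 := by simpa [polarForm, bigF_mk, vy1, f_zero_left] using h
    refine mem_span_of_eq_smul (op (-(a.toAdd * t2))) ?_
    ext <;> simp [delta, vy1, h']
  · intro a h
    obtain ⟨t, ht⟩ := Submodule.mem_span_singleton.1 h
    have := congrArg (fun v : HypSum K L => v.2.1) ht
    have h0 : (0 : K) = -a.toAdd := by simpa [delta, vx2] using this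
    exact Multiplicative.toAdd.injective (neg_eq_zero.1 h0.symm)
  · intro s
    refine ⟨.ofAdd (-unop s), (isDelta_delta _).2.2.2.2.trans ?_⟩
    rw [toAdd_ofAdd, op_neg, op_unop, neg_smul, sub_neg_eq_add]

theorem unop_induced_rotation (i : ZMod (2 * 4)) :
    unop (induced (Λ.isometry_rotation.isIsom hΛ hK)) (coord hΛ hK i) = coord hΛ hK (i + 2) := by
  refine (unop_induced_rotate (s₁ := 1) (s₂ := 1) (s₃ := 1) (s₄ := -1) (isFrame hΛ hK) _ one_ne_zero
    one_ne_zero one_ne_zero (neg_ne_zero.2 one_ne_zero) ?_ ?_ ?_ ?_ (i - 1)).trans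
    (congrArg _ (sub_add_eq_add_sub i 1 2)) <;>
  ext <;> simp [rotation, vx1, vx2, vy1, vy2]

theorem unop_induced_reflection (i : ZMod (2 * 4)) :
    unop (induced (Λ.isometry_reflection.isIsom hΛ hK)) (coord hΛ hK i) = coord hΛ hK (2 - i) := by
  refine (unop_induced_reflect (s₁ := 1) (s₂ := 1) (s₃ := 1) (s₄ := -1) (isFrame hΛ hK) _
    one_ne_zero one_ne_zero one_ne_zero (neg_ne_zero.2 one_ne_zero) ?_ ?_ ?_ ?_ (i - 1)).trans
    (congrArg (frameCircuit (isFrame hΛ hK)) (by ring)) <;>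
  ext <;> simp [reflection, vx1, vx2, vy1, vy2]

theorem exists_aut_rotate : ∃ r ∈ Λ.graph.Aut, ∀ i,
    unop r (coord hΛ hK i) = coord hΛ hK (i + 2) :=
  ⟨_, induced_mem_aut (Λ.isometry_rotation.isIsom hΛ hK), unop_induced_rotation hΛ hK⟩

theorem exists_aut_two_sub : ∃ s ∈ Λ.graph.Aut, ∀ i,
    unop s (coord hΛ hK i) = coord hΛ hK (2 - i) :=
  ⟨_, induced_mem_aut (Λ.isometry_reflection.isIsom hΛ hK), unop_induced_reflection hΛ hK⟩

/-- Because of the shift in `coord`, the reflection of the frame appears as i ↦ 2 - i; rotating back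
by two places gives i ↦ -i. -/
theorem exists_aut_neg : ∃ s ∈ Λ.graph.Aut, ∀ i, unop s (coord hΛ hK i) = coord hΛ hK (-i) := by
  obtain ⟨r, hr, hrw⟩ := exists_aut_rotate hΛ hK
  obtain ⟨s, hs, hsw⟩ := exists_aut_two_sub hΛ hK
  refine ⟨s * r⁻¹, mul_mem hs (inv_mem hr), fun i => ?_⟩
  change unop r⁻¹ (unop s (coord hΛ hK i)) = _
  rw [hsw, sub_eq_neg_add, ← hrw, OppGraph.unop_inv_apply_apply]

end Coordinates

theorem PQRel.map {G : Type*} [Group G] {U U' : ZMod (2 * 4) → Subgroup G} {e : G ≃* G}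
    (hU : ∀ i, U' i = (U i).map e.toMonoidHom) {x₁ x₂ x₃ x₄} (h : Λ.PQRel U x₁ x₂ x₃ x₄) :
    ∃ x₁ x₂ x₃ x₄, Λ.PQRel U' x₁ x₂ x₃ x₄ := by
  obtain ⟨E₁, h₁⟩ := exists_subgroup_mulEquiv hU 1
  obtain ⟨E₂, h₂⟩ := exists_subgroup_mulEquiv hU 2
  obtain ⟨E₃, h₃⟩ := exists_subgroup_mulEquiv hU 3
  obtain ⟨E₄, h₄⟩ := exists_subgroup_mulEquiv hU 4
  refine ⟨x₁.trans E₁, x₂.trans E₂, x₃.trans E₃, x₄.trans E₄,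
    fun i => comm_eq_one_of_map hU (h.1 i), fun y z => ?_, fun v w => ?_, fun y v => ?_⟩ <;>
  simp only [MulEquiv.trans_apply, h₁, h₂, h₃, h₄]
  · rw [← h.2.1, map_comm, map_inv]
  · rw [← h.2.2.1, map_comm, map_inv]
  · rw [← map_mul, ← h.2.2.2, map_comm, map_inv]

variable (hΛ : Λ.Nondegenerate) (hK : Λ.K₀ = ⊤ → ringChar K ≠ 2)

/-- As in the quadratic case, the relations between root groups that are not neighbours are
identities between composites of linear maps, read off in coordinates. -/
theorem exists_pqRel :
    ∃ x₁ x₂ x₃ x₄, Λ.PQRel (Λ.graph.labelling 4 (coord hΛ hK)) x₁ x₂ x₃ x₄ ∧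
      (∀ z : Λ.T, ∃ φ, IsAlpha z φ ∧ Λ.Isometry φ ∧ Induces Λ.Tot φ (x₁ z)) ∧
      (∀ t : K, ∃ φ, IsGamma t φ ∧ Λ.Isometry φ ∧ Induces Λ.Tot φ (x₂ (.ofAdd t))) ∧
      (∀ z : Λ.T, ∃ φ, IsBeta z φ ∧ Λ.Isometry φ ∧ Induces Λ.Tot φ (x₃ z)) ∧
      (∀ t : K, ∃ φ, IsDelta t φ ∧ Λ.Isometry φ ∧ Induces Λ.Tot φ (x₄ (.ofAdd t))) := by
  obtain ⟨x₁, h₁⟩ := (exists_alpha hΛ hK).1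
  obtain ⟨x₂, h₂⟩ := (exists_gamma hΛ hK).1
  obtain ⟨x₃, h₃⟩ := exists_beta hΛ hK
  obtain ⟨x₄, h₄⟩ := exists_delta hΛ hK
  have hΓ : Λ.graph.IsVeldkampPolygon 4 := (isThickPolarSpace hΛ hK).isVeldkampPolygon
  refine ⟨x₁, x₂, x₃, x₄, ⟨hΓ.comm_eq_one (isStraightCircuit_coord hΛ hK), ?_, ?_, ?_⟩,
    ?_, ?_, ?_, ?_⟩
  · intro y z
    refine comm_inv_eq ?_
    rw [h₁, h₂, h₃]
    refine (induced_mul _ _).trans ((induced_congr _ _ ?_).trans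
      ((congrArg (· * _) (induced_mul _ _)).trans (induced_mul _ _)).symm)
    rintro ⟨t1, t1', t2, t2', u⟩
    ext <;> simp [alpha, beta, gamma, f_add_right, f_sub_right, f_smul_right, Λ.f_skew]
    · abel
    · abel
    · abel
  · intro v w
    refine comm_inv_eq ?_
    rw [h₂, h₃, h₄]
    refine (induced_mul _ _).trans ((induced_congr _ _ ?_).trans
      ((congrArg (· * _) (induced_mul _ _)).trans (induced_mul _ _)).symm)
    rintro ⟨t1, t1', t2, t2', u⟩
    ext <;> simp [beta, gamma, delta, traceElt, f_zero_left]
    noncomm_ring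
  · intro y v
    refine comm_inv_eq ?_
    rw [h₁, h₂, h₃, h₄]
    refine (induced_mul _ _).trans ((induced_congr _ _ ?_).trans
      ((congrArg (· * _) ((congrArg (_ * ·) (induced_mul _ _)).trans (induced_mul _ _))).trans
        (induced_mul _ _)).symm)
    rintro ⟨t1, t1', t2, t2', u⟩
    -- Conjugating by δ_v produces a term v^σ f(a, a) v, which has to be rewritten through t and
    -- t^σ.
    have hy := T.f_self Λ hK y
    ext <;> simp [alpha, beta, gamma, delta, scaleElt, f_add_right, f_smul_right, f_smul_left',
      smul_smul, sub_smul, hy, mul_add, mul_sub, sub_mul, mul_assoc]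
    · abel
    · abel
    · abel
  · intro z
    refine ⟨_, isAlpha_alpha z, isometry_alpha hK z, ?_⟩
    rw [h₁]
    exact induces_induced ((isometry_alpha hK z).isIsom hΛ hK)
  · intro t
    refine ⟨_, isGamma_gamma t, Λ.isometry_gamma t, ?_⟩
    rw [h₂]
    exact induces_induced ((Λ.isometry_gamma t).isIsom hΛ hK)
  · intro z
    refine ⟨_, isBeta_beta z, isometry_beta hK z, ?_⟩
    rw [h₃]
    exact induces_induced ((isometry_beta hK z).isIsom hΛ hK)
  · intro t
    refine ⟨_, isDelta_delta t, Λ.isometry_delta t, ?_⟩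
    rw [h₄]
    exact induces_induced ((Λ.isometry_delta t).isIsom hΛ hK)

include hΛ hK

theorem isMoufang : Λ.graph.IsMoufang 4 := by
  obtain ⟨r, hr, hrw⟩ := exists_aut_rotate hΛ hK
  obtain ⟨s, hs, hsw⟩ := exists_aut_neg hΛ hK
  exact (isThickPolarSpace hΛ hK).isVeldkampPolygon.isMoufang hr hrw hs hsw
    (isStraightCircuit_coord hΛ hK) (exists_alpha hΛ hK).2 (exists_gamma hΛ hK).2

theorem isOfType : Λ.IsOfType Λ.graph := by
  have hΓ : Λ.graph.IsVeldkampPolygon 4 := (isThickPolarSpace hΛ hK).isVeldkampPolygon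
  obtain ⟨x₁, x₂, x₃, x₄, hx, -⟩ := exists_pqRel hΛ hK
  obtain ⟨r, hr, hrw⟩ := exists_aut_rotate hΛ hK
  obtain ⟨s, hs, hsw⟩ := exists_aut_neg hΛ hK
  refine ⟨⟨by norm_num, hΓ, isMoufang hΛ hK⟩, fun c hc => ?_⟩
  refine (hΓ.exists_aut hr hrw hs hsw (isStraightCircuit_coord hΛ hK) (exists_alpha hΛ hK).2
    (exists_gamma hΛ hK).2 hc).imp ?_ ?_
  · rintro ⟨g, hg, rfl⟩
    exact hx.map (OppGraph.labelling_map hg _)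
  · rintro ⟨g, hg, e⟩
    have e' : oppositeCoord 4 c = fun i => unop g (coord hΛ hK i) := e
    rw [e']
    exact hx.map (OppGraph.labelling_map hg _)

end PQSpace

end TitsQuad

/-! ### The main theorem -/

theorem mainTheorem5 :
    (∀ (K : Type u) [Field K] (L : Type v) [AddCommGroup L] [Module K L] [Nontrivial L]
        (q : QuadraticForm K L), QNondegenerate q →
      (isoLines (QTot q)).Nonempty ∧ IsPolarSpace (isoLines (QTot q)) ∧
      IsThick (isoLines (QTot q)) ∧ IsNondegeneratePolar (isoLines (QTot q)) ∧
      (quadGraph q).IsVeldkampPolygon 4 ∧ (quadGraph q).IsFlat 4 ∧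
      (∀ x, (quadGraph q).TrivialAt (Sum.inr x)) ∧
      (quadGraph q).IsMoufang 4 ∧
      IsOrthogonalOfType q (quadGraph q) ∧
      ∃ w : ZMod (2 * 4) → Points (QTot q) ⊕ isoLines (QTot q),
        IsQStandard q w ∧ (quadGraph q).IsStraightCircuit 4 w ∧
        ∃ x₁ x₂ x₃ x₄, OrthRel q ((quadGraph q).labelling 4 w) x₁ x₂ x₃ x₄ ∧
          (∀ t : K, ∃ φ, IsQDelta t φ ∧ QIsometry q φ ∧ Induces (QTot q) φ (x₁ (.ofAdd t))) ∧
          (∀ a : L, ∃ φ, IsQBeta q a φ ∧ QIsometry q φ ∧ Induces (QTot q) φ (x₂ (.ofAdd a))) ∧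
          (∀ t : K, ∃ φ, IsQGamma t φ ∧ QIsometry q φ ∧ Induces (QTot q) φ (x₃ (.ofAdd t))) ∧
          (∀ a : L, ∃ φ, IsQAlpha q a φ ∧ QIsometry q φ ∧ Induces (QTot q) φ (x₄ (.ofAdd a)))) ∧
    (∀ (K : Type u) [DivisionRing K] [StarRing K] (L : Type v) [AddCommGroup L] [Module Kᵐᵒᵖ L]
        (Λ : PQSpace K L), Λ.Nondegenerate → (Λ.K₀ = ⊤ → ringChar K ≠ 2) →
      (isoLines Λ.Tot).Nonempty ∧ IsPolarSpace (isoLines Λ.Tot) ∧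
      IsThick (isoLines Λ.Tot) ∧ IsNondegeneratePolar (isoLines Λ.Tot) ∧
      Λ.graph.IsVeldkampPolygon 4 ∧ Λ.graph.IsFlat 4 ∧
      (∀ x, Λ.graph.TrivialAt (Sum.inr x)) ∧
      Λ.graph.IsMoufang 4 ∧
      Λ.IsOfType Λ.graph ∧
      ∃ w : ZMod (2 * 4) → Points Λ.Tot ⊕ isoLines Λ.Tot,
        Λ.IsStandard w ∧ Λ.graph.IsStraightCircuit 4 w ∧
        ∃ x₁ x₂ x₃ x₄, Λ.PQRel (Λ.graph.labelling 4 w) x₁ x₂ x₃ x₄ ∧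
          (∀ z : Λ.T, ∃ φ, PQSpace.IsAlpha z φ ∧ Λ.Isometry φ ∧ Induces Λ.Tot φ (x₁ z)) ∧
          (∀ t : K, ∃ φ, PQSpace.IsGamma t φ ∧ Λ.Isometry φ ∧ Induces Λ.Tot φ (x₂ (.ofAdd t))) ∧
          (∀ z : Λ.T, ∃ φ, PQSpace.IsBeta z φ ∧ Λ.Isometry φ ∧ Induces Λ.Tot φ (x₃ z)) ∧
          (∀ t : K, ∃ φ, PQSpace.IsDelta t φ ∧ Λ.Isometry φ ∧ Induces Λ.Tot φ (x₄ (.ofAdd t)))) := by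
  refine ⟨fun K _ L _ _ _ q hq => ?_, fun K _ _ L _ _ Λ hΛ hK => ?_⟩
  · have h := quad_isThickPolarSpace hq
    exact ⟨h.nonempty_lines, h.polar, h.thick, h.nondegenerate, h.isVeldkampPolygon, h.isFlat,
      trivialAt_line, quad_isMoufang hq, quad_isOrthogonalOfType hq, quadCoord hq,
      isQStandard_quadCoord hq, isStraightCircuit_quadCoord hq, quad_exists_orthRel hq⟩
  · have h := PQSpace.isThickPolarSpace hΛ hK
    exact ⟨h.nonempty_lines, h.polar, h.thick, h.nondegenerate, h.isVeldkampPolygon, h.isFlat,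
      trivialAt_line, PQSpace.isMoufang hΛ hK, PQSpace.isOfType hΛ hK, PQSpace.coord hΛ hK,
      PQSpace.isStandard_coord hΛ hK, PQSpace.isStraightCircuit_coord hΛ hK,
      PQSpace.exists_pqRel hΛ hK⟩
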